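/- **Setting.** Fix integers $L\ge 1$, $K$, $d\ge 1$. Consider a sequence of populations $I_n=\{1,\dots,n\}$ with $n\to\infty$ (sizes running along any sequence tending to infinity). Population $n$ is connected by an undirected network with shortest-path distance $l(i,j)\in\{0,1,\dots,\infty\}$; write $N(i;r)^+=\{j: l(i,j)\le r\}$ ($N(i;-1)^+=\emptyset$) and $N^\partial(i;s)=\{j:l(i,j)=s\}$. All probabilities are conditional on the fixed attributes of the units. $N_i$ denotes the $L$ nearest neighbours of $i$ (not including $i$), sorted by distance, and we assume $l(i,j)\le K$ for $j\in N_i$. The networks are at most $d$-dimensional: for some $C$ and all $n,i$, $s\ge1$, $|N^\partial(i;s)|\le C s^{d-1}$. Unit $i$ has a binary treatment $D_i$, a first-period outcome $Y_{1i}$, an arbitrary unobservable $\epsilon_i$, and integrable potential outcomes $y_{2i}(a,\boldsymbol v)=m_i(Y_{1i},a,\boldsymbol v,\epsilon_i)$, $a\in\{0,1\}$, $\boldsymbol v\in\{0,1\}^L$, with $m_i$ measurable; the observed outcome is $Y_{2i}=y_{2i}(D_i,\boldsymbol D_{N_i})$, and $\Delta Y_i=Y_{2i}-Y_{1i}$.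 Let $\boldsymbol D_{N_j}^{-i}$ be the treatments of the members of $N_j$ other than $i$, and $\boldsymbol D_{N_j}^{(c)}$ the vector $\boldsymbol D_{N_j}$ with the treatment of $i$ (if $i\in N_j$) set to $c$. The estimands are $$\tau_{\rm dir}=\frac1n\sum_i E[y_{2i}(1,\boldsymbol D_{N_i})-y_{2i}(0,\boldsymbol D_{N_i})\mid D_i=1]\quad\text{(ADTT)},$$ $$\tau_{\rm ind}=\frac1n\sum_i\frac1{|N_i|}\sum_{j\in N_i}E[y_{2j}(D_j,\boldsymbol D_{N_j}^{(1)})-y_{2j}(D_j,\boldsymbol D_{N_j}^{(0)})\mid D_i=1]\quad\text{(AITT)}.$$ Let $\pi_i=P(D_i=1)$, $e_i=P(D_i=1\mid\boldsymbol D_{N_i})$, $\mu_{ai}=E[\Delta Y_i\mid D_i=a,\boldsymbol D_{N_i}]$, $e'_{ij}=P(D_i=1\mid D_j,\boldsymbol D_{N_j}^{-i})$, $\mu_{aij}=E[\Delta Y_j\mid D_i=a,D_j,\boldsymbol D_{N_j}^{-i}]$. With $$h(D,\pi,e,m_1,m_0,\Delta)=\frac{D}{\pi}(\Delta-m_1)-\frac{(1-D)e}{\pi(1-e)}(\Delta-m_0)+\frac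 e\pi(m_1-m_0),$$ the DR influence functions are $\phi_i^{DR,\rm dir}=h(D_i,\pi_i,e_i,\mu_{1i},\mu_{0i},\Delta Y_i)$ and $\phi_i^{DR,\rm ind}=\frac1{|N_i|}\sum_{j\in N_i}h(D_i,\pi_i,e'_{ij},\mu_{1ij},\mu_{0ij},\Delta Y_j)$. The DR estimators $\widehat\tau^{DR}_{\rm dir}$, $\widehat\tau^{DR}_{\rm ind}$ are the averages over $i$ of the same expressions with (random) estimates $\widehat\pi_i,\widehat e_i,\widehat\mu_{ai}$, respectively $\widehat\pi_i,\widehat e'_{ij},\widehat\mu_{aij}$, in place of the true nuisance functions. Put $(\sigma_{n,D}^{DR})^2=\mathrm{Var}(n^{-1/2}\sum_i\phi_i^{DR,\rm dir})$ and $(\sigma_{n,I}^{DR})^2=\mathrm{Var}(n^{-1/2}\sum_i\phi_i^{DR,\rm ind})$. **Assumptions.** 1. (Conditional parallel trends) For all $i$ and $\boldsymbol v$, $E[y_{2i}(0,\boldsymbol v)-Y_{1i}\mid D_i=c,\boldsymbol D_{N_i}=\boldsymbol v]$ is the same for $c=1$ and $c=0$; for $j\in N_i$, all $b\in\{0,1\}$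 and all $\boldsymbol v$, the conditional expectation of $y_{2j}(b,\cdot)-Y_{1j}$, where the neighbourhood treatments of $j$ are $0$ for $i$ and $\boldsymbol v$ for the others, given $D_i=c,D_j=b,\boldsymbol D_{N_j}^{-i}=\boldsymbol v$ is the same for $c=1$ and $c=0$ (whenever the conditioning events have positive probability). 2. (Local interference) The conditional law of $x_i=(Y_{1i},D_i,\epsilon_i)$ given the treatments of all other units equals its conditional law given the treatments of the other units within distance $K$. 3. (Overlap) $\pi_i$, $e_i$, and $e'_{ij}$ ($j\in N_i$) lie in a fixed compact subinterval of $(0,1)$. 4. (Bounded outcomes) $|Y_{1i}|,|Y_{2i}|<\overline Y$ almost surely, with $\overline Y$ independent of $i$ and $n$. 5. ($\alpha$-mixing) There are a bounded $\psi:\mathbb N^2\to[0,\infty)$ and $\widehat\alpha\ge0$ with $\widehat\alpha(s)\to0$ as $s\to\infty$ such that for every $n$ and all $H,H'\subseteq I_n$ with $|H|\le h$, $|H'|\le h'$ and $l(H,H')\ge s$, the $\alpha$-mixing coefficient of $\sigma(x_i:i\in H)$ and $\sigma(x_i:i\in H')$ is at most $\psi(h,h')\,\widehat\alpha(s)$.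 For $R\ge 0$ let $\theta^{(R)}_s=\mathbf 1\{s<R\}+\mathbf 1\{s\ge R\}\widehat\alpha(s-R)$. We say that the weak dependence condition holds for $(\theta,S_n)$ if $S_n>0$ for all large $n$ and there are $r_n>0$, $r_n\to\infty$, and $p>4$ such that, for $k=1,2$, $$\frac1{S_n^{2+k}}\sum_{i\in I_n}\sum_{s\ge0}s^{d-1}\max_{j\in N^\partial(i;s)}\left|N(i;r_n)^+\setminus N(j;s-1)^+\right|^k\theta_s^{1-\frac{2+k}p}\to0\quad\text{and}\quad\frac{n^2\,\theta_{r_n}^{1-1/p}}{S_n}\to0 .$$ **Theorem.** Under Assumptions 1–5: * if the weak dependence condition holds for $\theta^{(2K)}$ and $S_n=\mathrm{Var}(\sum_i\phi_i^{DR,\rm dir})^{1/2}$, and if either (a) the propensity score and outcome regression models are correctly specified, i.e. almost surely $\widehat\pi_i=\pi_i$, $\widehat e_i=e_i$, $\widehat\mu_{ai}=\mu_{ai}$ at $\boldsymbol D_{N_i}$, or (b) these functions are estimated by any method with sufficiently fast convergence, i.e. with $\mathrm{err}_i=|\widehat\pi_i-\pi_i|+|\widehat e_i-e_i|+\sum_a|\widehat\mu_{ai}-\mu_{ai}|$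 (evaluated at $\boldsymbol D_{N_i}$), $\max_i\mathrm{err}_i\to0$ in probability and $\frac1n\sum_i\mathrm{err}_i=o_P(\sigma_{n,D}^{DR}/\sqrt n)$, then $$\sqrt n\,(\widehat\tau^{DR}_{\rm dir}-\tau_{\rm dir})/\sigma_{n,D}^{DR}\to N(0,1)\quad\text{in distribution};$$ * if the weak dependence condition holds for $\theta^{(4K)}$ and $S_n=\mathrm{Var}(\sum_i\phi_i^{DR,\rm ind})^{1/2}$, and if (a) or (b) holds with $e'_{ij},\mu_{aij}$ ($j\in N_i$) in place of $e_i,\mu_{ai}$ (in (b), with $\mathrm{err}_i$ the average over $j\in N_i$ of the total error of the estimates used for the pair $(i,j)$, and $\sigma_{n,I}^{DR}$ in place of $\sigma_{n,D}^{DR}$), then $$\sqrt n\,(\widehat\tau^{DR}_{\rm ind}-\tau_{\rm ind})/\sigma_{n,I}^{DR}\to N(0,1)\quad\text{in distribution}.$$ -/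

import Mathlib

open MeasureTheory ProbabilityTheory Filter Topology

noncomputable section

/-! ### Network distances

`G.edist i j : ℕ∞` is the length of a shortest path, `⊤` if there is none. -/

/-- The closed ball `N(i; r)⁺`: unit `i` and all units at network distance at most `r`.
Distances are integers or infinite, so `r` may be rounded down. -/
def netBall {n : ℕ} (G : SimpleGraph (Fin n)) (i : Fin n) (r : ℝ) : Finset (Fin n) :=
  open Classical in Finset.univ.filter fun j => G.edist i j ≤ (⌊r⌋₊ : ℕ∞)

/-- The units at network distance strictly less than `s`, i.e. `N(j; s - 1)⁺` (empty for
`s = 0`). -/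
def netOpenBall {n : ℕ} (G : SimpleGraph (Fin n)) (j : Fin n) (s : ℕ) : Finset (Fin n) :=
  open Classical in Finset.univ.filter fun k => G.edist j k < (s : ℕ∞)

/-- The shell `N^∂(i; s)`: units at network distance exactly `s`. -/
def netShell {n : ℕ} (G : SimpleGraph (Fin n)) (i : Fin n) (s : ℕ) : Finset (Fin n) :=
  open Classical in Finset.univ.filter fun j => G.edist i j = (s : ℕ∞)

/-- The `α`-mixing coefficient of two `σ`-algebras. -/
def alphaCoeff {Ω : Type*} [MeasurableSpace Ω] (μ : Measure Ω) (m₁ m₂ : MeasurableSpace Ω) : ℝ :=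
  sSup {r : ℝ | ∃ A B : Set Ω, MeasurableSet[m₁] A ∧ MeasurableSet[m₂] B ∧
    r = |μ.real (A ∩ B) - μ.real A * μ.real B|}

/-! ### The model -/

/-- A two-period panel on a network with `n` units, seen conditionally on the fixed attributes of
the units (so that functions of attributes are simply indexed by units).

* `nbr i k` is the `k`-th nearest neighbour of unit `i` (`N_i` has `L` members; ties are broken
  arbitrarily);
* `Y1`, `D`, `ε` are the first period outcome, the treatment and the (arbitrary) unobservables;
* `out i y a v e` is the structural equation of the second period potential outcome of `i` under
  own treatment `a` and neighbourhood treatment vector `v`. -/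
structure NetworkDID (L n : ℕ) (Ω 𝓔 : Type*) [MeasurableSpace Ω] [MeasurableSpace 𝓔] where
  G : SimpleGraph (Fin n)
  nbr : Fin n → Fin L → Fin n
  nbr_injective : ∀ i, Function.Injective (nbr i)
  nbr_ne : ∀ i k, nbr i k ≠ i
  nbr_sorted : ∀ i, Monotone fun k => G.edist i (nbr i k)
  nbr_nearest : ∀ i j, j ≠ i → (∀ k, nbr i k ≠ j) → ∀ k, G.edist i (nbr i k) ≤ G.edist i j
  Y1 : Fin n → Ω → ℝ
  D : Fin n → Ω → Bool
  ε : Fin n → Ω → 𝓔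
  out : Fin n → ℝ → Bool → (Fin L → Bool) → 𝓔 → ℝ
  measurable_Y1 : ∀ i, Measurable (Y1 i)
  measurable_D : ∀ i, Measurable (D i)
  measurable_ε : ∀ i, Measurable (ε i)
  measurable_out : ∀ i a v, Measurable fun p : ℝ × 𝓔 => out i p.1 a v p.2

/-- Nuisance functions for the direct effect: `π_i`, `e_i(v)` and the outcome regressions
`μ_{ai}(v)`, `a ∈ {0, 1}`. -/
structure DirNuisance (L n : ℕ) where
  pi : Fin n → ℝ
  e : Fin n → (Fin L → Bool) → ℝ
  m : Fin n → Bool → (Fin L → Bool) → ℝ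

/-- The summand of the doubly robust estimators, from the treatment indicator `d`, the propensities
`p` (marginal) and `e` (conditional), the predictions `m₁`, `m₀` and the outcome change `y`. -/
def drScore (d p e m₁ m₀ y : ℝ) : ℝ :=
  d / p * (y - m₁) - (1 - d) * e / (p * (1 - e)) * (y - m₀) + e / p * (m₁ - m₀)

namespace NetworkDID

variable {L n : ℕ} {Ω 𝓔 : Type*} [MeasurableSpace Ω] [MeasurableSpace 𝓔]

/-- The treatment vector `D_{N_i}` of the neighbours of `i`, sorted by distance. -/
def DN (P : NetworkDID L n Ω 𝓔) (i : Fin n) (ω : Ω) : Fin L → Bool := fun k => P.D (P.nbr i k) ω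

/-- Potential outcome `y_{2i}(a, v)`. -/
def y2 (P : NetworkDID L n Ω 𝓔) (i : Fin n) (a : Bool) (v : Fin L → Bool) (ω : Ω) : ℝ :=
  P.out i (P.Y1 i ω) a v (P.ε i ω)

/-- Observed second period outcome. -/
def Y2 (P : NetworkDID L n Ω 𝓔) (i : Fin n) (ω : Ω) : ℝ := P.y2 i (P.D i ω) (P.DN i ω) ω

/-- Observed outcome change. -/
def dY (P : NetworkDID L n Ω 𝓔) (i : Fin n) (ω : Ω) : ℝ := P.Y2 i ω - P.Y1 i ω

/-- The treatment of `i` as a real number. -/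
def treat (P : NetworkDID L n Ω 𝓔) (i : Fin n) (ω : Ω) : ℝ := if P.D i ω then 1 else 0

/-- Treatment assignments to the neighbours of `j` other than `i`. -/
abbrev Others (P : NetworkDID L n Ω 𝓔) (i j : Fin n) : Type := {k : Fin L // P.nbr j k ≠ i} → Bool

/-- `D_{N_j}^{-i}`. -/
def DNminus (P : NetworkDID L n Ω 𝓔) (i j : Fin n) (ω : Ω) : P.Others i j :=
  fun k => P.D (P.nbr j k) ω

/-- The treatment vector of the neighbours of `j` that gives `c` to unit `i` (if `i` is a neighbour
of `j`) and `v` to the others. -/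
def fill (P : NetworkDID L n Ω 𝓔) (i j : Fin n) (c : Bool) (v : P.Others i j) : Fin L → Bool :=
  fun k => if h : P.nbr j k = i then c else v ⟨k, h⟩

/-! Estimands -/

/-- Average direct treatment effect on the treated. -/
def tauDir (P : NetworkDID L n Ω 𝓔) (μ : Measure Ω) : ℝ :=
  (1 / (n : ℝ)) * ∑ i, ∫ ω, (P.y2 i true (P.DN i ω) ω - P.y2 i false (P.DN i ω) ω)
    ∂(cond μ {ω | P.D i ω = true})

/-- Average indirect treatment effect on the treated. -/
def tauInd (P : NetworkDID L n Ω 𝓔) (μ : Measure Ω) : ℝ :=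
  (1 / (n : ℝ)) * ∑ i, (1 / (L : ℝ)) * ∑ k, ∫ ω,
    (P.y2 (P.nbr i k) (P.D (P.nbr i k) ω) (P.fill i (P.nbr i k) true (P.DNminus i (P.nbr i k) ω)) ω
      - P.y2 (P.nbr i k) (P.D (P.nbr i k) ω)
          (P.fill i (P.nbr i k) false (P.DNminus i (P.nbr i k) ω)) ω)
    ∂(cond μ {ω | P.D i ω = true})

/-! True nuisance functions (the values on conditioning events of probability zero are
irrelevant) -/

/-- `π_i = P(D_i = 1)`, `e_i(v) = P(D_i = 1 | D_{N_i} = v)` and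
`μ_{ai}(v) = E[ΔY_i | D_i = a, D_{N_i} = v]`. -/
def dirTruth (P : NetworkDID L n Ω 𝓔) (μ : Measure Ω) : DirNuisance L n where
  pi i := μ.real {ω | P.D i ω = true}
  e i v := (cond μ {ω | P.DN i ω = v}).real {ω | P.D i ω = true}
  m i a v := ∫ ω, P.dY i ω ∂(cond μ {ω | P.D i ω = a ∧ P.DN i ω = v})

/-- Nuisance functions for the indirect effect: `π_i`, `e'_{ij}(b, v)` and the outcome regressions
`μ_{aij}(b, v)`, `a ∈ {0, 1}`, with `b` the treatment of `j` and `v` that of the other neighbours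
of `j`. -/
structure IndNuisance (P : NetworkDID L n Ω 𝓔) where
  pi : Fin n → ℝ
  e : ∀ i j : Fin n, Bool → P.Others i j → ℝ
  m : ∀ i j : Fin n, Bool → Bool → P.Others i j → ℝ

/-- `π_i = P(D_i = 1)`, `e'_{ij}(b, v) = P(D_i = 1 | D_j = b, D_{N_j}^{-i} = v)` and
`μ_{aij}(b, v) = E[ΔY_j | D_i = a, D_j = b, D_{N_j}^{-i} = v]`. -/
def indTruth (P : NetworkDID L n Ω 𝓔) (μ : Measure Ω) : P.IndNuisance where
  pi i := μ.real {ω | P.D i ω = true}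
  e i j b v := (cond μ {ω | P.D j ω = b ∧ P.DNminus i j ω = v}).real {ω | P.D i ω = true}
  m i j a b v :=
    ∫ ω, P.dY j ω ∂(cond μ {ω | P.D i ω = a ∧ P.D j ω = b ∧ P.DNminus i j ω = v})

/-! Doubly robust summands and estimators -/

/-- The summand of the DR estimator of the direct effect, with nuisance functions `η`. -/
def phiDir (P : NetworkDID L n Ω 𝓔) (η : DirNuisance L n) (i : Fin n) (ω : Ω) : ℝ :=
  drScore (P.treat i ω) (η.pi i) (η.e i (P.DN i ω)) (η.m i true (P.DN i ω)) (η.m i false (P.DN i ω))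
    (P.dY i ω)

/-- The `(i, j)` term of the DR estimator of the indirect effect, with nuisance functions `η`. -/
def phiPair (P : NetworkDID L n Ω 𝓔) (η : P.IndNuisance) (i j : Fin n) (ω : Ω) : ℝ :=
  drScore (P.treat i ω) (η.pi i) (η.e i j (P.D j ω) (P.DNminus i j ω))
    (η.m i j true (P.D j ω) (P.DNminus i j ω)) (η.m i j false (P.D j ω) (P.DNminus i j ω))
    (P.dY j ω)

/-- The summand of the DR estimator of the indirect effect, with nuisance functions `η`. -/
def phiInd (P : NetworkDID L n Ω 𝓔) (η : P.IndNuisance) (i : Fin n) (ω : Ω) : ℝ :=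
  (1 / (L : ℝ)) * ∑ k, P.phiPair η i (P.nbr i k) ω

/-- The DR estimator of the direct effect; `η ω` are the nuisance estimates. -/
def tauHatDir (P : NetworkDID L n Ω 𝓔) (η : Ω → DirNuisance L n) (ω : Ω) : ℝ :=
  (1 / (n : ℝ)) * ∑ i, P.phiDir (η ω) i ω

/-- The DR estimator of the indirect effect; `η ω` are the nuisance estimates. -/
def tauHatInd (P : NetworkDID L n Ω 𝓔) (η : Ω → P.IndNuisance) (ω : Ω) : ℝ :=
  (1 / (n : ℝ)) * ∑ i, P.phiInd (η ω) i ω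

/-- Standard deviation of the sum of the DR influence functions of the direct effect. -/
def sumSdDir (P : NetworkDID L n Ω 𝓔) (μ : Measure Ω) : ℝ :=
  √(variance (fun ω => ∑ i, P.phiDir (P.dirTruth μ) i ω) μ)

/-- Standard deviation of the sum of the DR influence functions of the indirect effect. -/
def sumSdInd (P : NetworkDID L n Ω 𝓔) (μ : Measure Ω) : ℝ :=
  √(variance (fun ω => ∑ i, P.phiInd (P.indTruth μ) i ω) μ)

/-- `σ_{n,D}^{DR}`, the square root of `Var(n^{-1/2} ∑ φ_i^{DR,dir})`. -/
def sigmaDir (P : NetworkDID L n Ω 𝓔) (μ : Measure Ω) : ℝ :=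
  √(variance (fun ω => (√(n : ℝ))⁻¹ * ∑ i, P.phiDir (P.dirTruth μ) i ω) μ)

/-- `σ_{n,I}^{DR}`, the square root of `Var(n^{-1/2} ∑ φ_i^{DR,ind})`. -/
def sigmaInd (P : NetworkDID L n Ω 𝓔) (μ : Measure Ω) : ℝ :=
  √(variance (fun ω => (√(n : ℝ))⁻¹ * ∑ i, P.phiInd (P.indTruth μ) i ω) μ)

/-! Quality of the nuisance estimates -/

/-- The nuisance estimates for the direct effect are random variables. -/
def MeasurableDirEst (η : Ω → DirNuisance L n) : Prop :=
  (∀ i, Measurable fun ω => (η ω).pi i) ∧ (∀ i v, Measurable fun ω => (η ω).e i v) ∧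
    ∀ i a v, Measurable fun ω => (η ω).m i a v

/-- The nuisance estimates for the indirect effect are random variables. -/
def MeasurableIndEst (P : NetworkDID L n Ω 𝓔) (η : Ω → P.IndNuisance) : Prop :=
  (∀ i, Measurable fun ω => (η ω).pi i) ∧ (∀ i j b v, Measurable fun ω => (η ω).e i j b v) ∧
    ∀ i j a b v, Measurable fun ω => (η ω).m i j a b v

/-- Total error of the nuisance estimates used in the `i`-th summand, direct effect. -/
def errDir (P : NetworkDID L n Ω 𝓔) (μ : Measure Ω) (η : Ω → DirNuisance L n) (i : Fin n)
    (ω : Ω) : ℝ :=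
  |(η ω).pi i - (P.dirTruth μ).pi i| + |(η ω).e i (P.DN i ω) - (P.dirTruth μ).e i (P.DN i ω)| +
    |(η ω).m i true (P.DN i ω) - (P.dirTruth μ).m i true (P.DN i ω)| +
    |(η ω).m i false (P.DN i ω) - (P.dirTruth μ).m i false (P.DN i ω)|

/-- Total error of the nuisance estimates used in the `(i, j)` term, indirect effect. -/
def errPair (P : NetworkDID L n Ω 𝓔) (μ : Measure Ω) (η : Ω → P.IndNuisance) (i j : Fin n)
    (ω : Ω) : ℝ :=
  |(η ω).pi i - (P.indTruth μ).pi i| +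
    |(η ω).e i j (P.D j ω) (P.DNminus i j ω)
      - (P.indTruth μ).e i j (P.D j ω) (P.DNminus i j ω)| +
    |(η ω).m i j true (P.D j ω) (P.DNminus i j ω)
      - (P.indTruth μ).m i j true (P.D j ω) (P.DNminus i j ω)| +
    |(η ω).m i j false (P.D j ω) (P.DNminus i j ω)
      - (P.indTruth μ).m i j false (P.D j ω) (P.DNminus i j ω)|

/-- Average total error of the nuisance estimates used in the `i`-th summand, indirect effect. -/
def errInd (P : NetworkDID L n Ω 𝓔) (μ : Measure Ω) (η : Ω → P.IndNuisance) (i : Fin n)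
    (ω : Ω) : ℝ :=
  (1 / (L : ℝ)) * ∑ k, P.errPair μ η i (P.nbr i k) ω

/-- The fitted propensity scores and outcome regressions are the true ones, direct effect. -/
def CorrectDir (P : NetworkDID L n Ω 𝓔) (μ : Measure Ω) (η : Ω → DirNuisance L n) : Prop :=
  ∀ i, ∀ᵐ ω ∂μ, (η ω).pi i = (P.dirTruth μ).pi i ∧
    (η ω).e i (P.DN i ω) = (P.dirTruth μ).e i (P.DN i ω) ∧
    ∀ a, (η ω).m i a (P.DN i ω) = (P.dirTruth μ).m i a (P.DN i ω)

/-- The fitted propensity scores and outcome regressions are the true ones, indirect effect. -/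
def CorrectInd (P : NetworkDID L n Ω 𝓔) (μ : Measure Ω) (η : Ω → P.IndNuisance) : Prop :=
  ∀ i k, ∀ᵐ ω ∂μ, (η ω).pi i = (P.indTruth μ).pi i ∧
    (η ω).e i (P.nbr i k) (P.D (P.nbr i k) ω) (P.DNminus i (P.nbr i k) ω)
      = (P.indTruth μ).e i (P.nbr i k) (P.D (P.nbr i k) ω) (P.DNminus i (P.nbr i k) ω) ∧
    ∀ a, (η ω).m i (P.nbr i k) a (P.D (P.nbr i k) ω) (P.DNminus i (P.nbr i k) ω)
      = (P.indTruth μ).m i (P.nbr i k) a (P.D (P.nbr i k) ω) (P.DNminus i (P.nbr i k) ω)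

/-! Assumptions on one population -/

/-- All potential outcomes have expectations. -/
def IntegrableOutcomes (P : NetworkDID L n Ω 𝓔) (μ : Measure Ω) : Prop :=
  ∀ i a v, Integrable (P.y2 i a v) μ

/-- Conditional parallel trends under interference (wherever the conditional expectations are
defined). -/
def ParallelTrends (P : NetworkDID L n Ω 𝓔) (μ : Measure Ω) : Prop :=
  (∀ i v, (∀ c, μ {ω | P.D i ω = c ∧ P.DN i ω = v} ≠ 0) →
    ∫ ω, (P.y2 i false v ω - P.Y1 i ω) ∂(cond μ {ω | P.D i ω = true ∧ P.DN i ω = v}) =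
    ∫ ω, (P.y2 i false v ω - P.Y1 i ω) ∂(cond μ {ω | P.D i ω = false ∧ P.DN i ω = v})) ∧
  (∀ i j, (∃ k, P.nbr i k = j) → ∀ (b : Bool) (v : P.Others i j),
    (∀ c, μ {ω | P.D i ω = c ∧ P.D j ω = b ∧ P.DNminus i j ω = v} ≠ 0) →
    ∫ ω, (P.y2 j b (P.fill i j false v) ω - P.Y1 j ω)
      ∂(cond μ {ω | P.D i ω = true ∧ P.D j ω = b ∧ P.DNminus i j ω = v}) =
    ∫ ω, (P.y2 j b (P.fill i j false v) ω - P.Y1 j ω)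
      ∂(cond μ {ω | P.D i ω = false ∧ P.D j ω = b ∧ P.DNminus i j ω = v}))

/-- The `L` nearest neighbours are within the interference range `K`. -/
def Locality (P : NetworkDID L n Ω 𝓔) (K : ℕ) : Prop :=
  ∀ i k, P.G.edist i (P.nbr i k) ≤ (K : ℕ∞)

/-- The fundamental variables of unit `i`. -/
def x (P : NetworkDID L n Ω 𝓔) (i : Fin n) (ω : Ω) : ℝ × Bool × 𝓔 :=
  (P.Y1 i ω, P.D i ω, P.ε i ω)

/-- Local interference: given all other treatments, the law of the fundamental variables of `i`
depends only on the treatments within distance `K`. -/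
def LocalInterference (P : NetworkDID L n Ω 𝓔) (μ : Measure Ω) (K : ℕ) : Prop :=
  ∀ (i : Fin n) (d : Fin n → Bool), μ {ω | ∀ j, j ≠ i → P.D j ω = d j} ≠ 0 →
    ∀ S : Set (ℝ × Bool × 𝓔), MeasurableSet S →
      cond μ {ω | ∀ j, j ≠ i → P.D j ω = d j} {ω | P.x i ω ∈ S} =
      cond μ {ω | ∀ j, j ≠ i → P.G.edist i j ≤ (K : ℕ∞) → P.D j ω = d j} {ω | P.x i ω ∈ S}

/-- Overlap with bounds `lo` and `hi`. -/
def Overlap (P : NetworkDID L n Ω 𝓔) (μ : Measure Ω) (lo hi : ℝ) : Prop :=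
  (∀ i, (P.dirTruth μ).pi i ∈ Set.Icc lo hi) ∧
  (∀ i v, μ {ω | P.DN i ω = v} ≠ 0 → (P.dirTruth μ).e i v ∈ Set.Icc lo hi) ∧
  (∀ i j, (∃ k, P.nbr i k = j) → ∀ b v, μ {ω | P.D j ω = b ∧ P.DNminus i j ω = v} ≠ 0 →
    (P.indTruth μ).e i j b v ∈ Set.Icc lo hi)

/-- Outcomes bounded by `Y`. -/
def BoundedOutcomes (P : NetworkDID L n Ω 𝓔) (μ : Measure Ω) (Y : ℝ) : Prop :=
  ∀ i, ∀ᵐ ω ∂μ, |P.Y1 i ω| < Y ∧ |P.Y2 i ω| < Y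

/-- The `σ`-algebra generated by the fundamental variables of the units in `H`. -/
abbrev sigmaAlg (P : NetworkDID L n Ω 𝓔) (H : Finset (Fin n)) : MeasurableSpace Ω :=
  ⨆ i ∈ H, MeasurableSpace.comap (P.x i) inferInstance

end NetworkDID

/-! ### Conditions on sequences of populations -/

section Sequences

variable {L : ℕ} {N : ℕ → ℕ} {Ω 𝓔 : ℕ → Type*} [∀ t, MeasurableSpace (Ω t)]
  [∀ t, MeasurableSpace (𝓔 t)]

/-- `α`-mixing of the fundamental variables, uniformly over the populations, with rate `αhat`. -/
def AlphaMixing (P : ∀ t, NetworkDID L (N t) (Ω t) (𝓔 t)) (μ : ∀ t, Measure (Ω t))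
    (αhat : ℝ → ℝ) : Prop :=
  (∀ s, 0 ≤ s → 0 ≤ αhat s) ∧ Tendsto αhat atTop (𝓝 0) ∧
  ∃ ψ : ℕ → ℕ → ℝ, (∀ h h', 0 ≤ ψ h h') ∧ (∃ C, ∀ h h', ψ h h' ≤ C) ∧
    ∀ (h h' : ℕ) (s : ℝ), 0 ≤ s → ∀ (t : ℕ) (H H' : Finset (Fin (N t))),
      H.card ≤ h → H'.card ≤ h' →
      (∀ i ∈ H, ∀ j ∈ H', (⌈s⌉₊ : ℕ∞) ≤ (P t).G.edist i j) →
      alphaCoeff (μ t) ((P t).sigmaAlg H) ((P t).sigmaAlg H') ≤ ψ h h' * αhat s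

/-- The dependence coefficients `θ_s = 1{s < R} + 1{s ≥ R} αhat(s - R)`. -/
def thetaCoeff (R : ℝ) (αhat : ℝ → ℝ) (s : ℝ) : ℝ := if s < R then 1 else αhat (s - R)

/-- The networks have dimension at most `d`: spheres of radius `s` have at most `C s^(d-1)`
points. -/
def DimensionAtMost (G : ∀ t, SimpleGraph (Fin (N t))) (d : ℕ) : Prop :=
  ∃ C : ℝ, ∀ t i (s : ℕ), 1 ≤ s → ((netShell (G t) i s).card : ℝ) ≤ C * (s : ℝ) ^ (d - 1)

/-- Weak dependence condition for the CLT, for summands whose sum has standard deviation `S t` and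
which have dependence coefficients `θ`. Finite distances in a network of `N t` units are smaller
than `N t`, so the sum over `s` is finite; the maximum over an empty shell is `0`. -/
def WeakDependenceCLT (G : ∀ t, SimpleGraph (Fin (N t))) (d : ℕ) (θ : ℝ → ℝ) (S : ℕ → ℝ) : Prop :=
  (∀ᶠ t in atTop, 0 < S t) ∧
  ∃ r : ℕ → ℝ, (∀ t, 0 < r t) ∧ Tendsto r atTop atTop ∧ ∃ p : ℝ, 4 < p ∧
    (∀ k : ℕ, k = 1 ∨ k = 2 →
      Tendsto (fun t => 1 / S t ^ (2 + k) * ∑ i, ∑ s ∈ Finset.range (N t), (s : ℝ) ^ (d - 1) *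
        (((netShell (G t) i s).sup fun j =>
          (netBall (G t) i (r t) \ netOpenBall (G t) j s).card ^ k : ℕ) : ℝ) *
        θ s ^ (1 - (2 + (k : ℝ)) / p)) atTop (𝓝 0)) ∧
    Tendsto (fun t => (N t : ℝ) ^ 2 * θ (r t) ^ (1 - 1 / p) / S t) atTop (𝓝 0)

/-- The estimation errors `err` vanish uniformly in probability and their average over the units is
`o_P(σ / √n)`. -/
def FastRates (μ : ∀ t, Measure (Ω t)) (err : ∀ t, Fin (N t) → Ω t → ℝ) (σ : ℕ → ℝ) : Prop :=
  (∀ δ : ℝ, 0 < δ →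
    Tendsto (fun t => (μ t).real {ω | ∃ i, δ < err t i ω}) atTop (𝓝 0)) ∧
  ∀ δ : ℝ, 0 < δ →
    Tendsto (fun t => (μ t).real {ω | δ * (σ t / √(N t : ℝ)) < (1 / (N t : ℝ)) * ∑ i, err t i ω})
      atTop (𝓝 0)

end Sequences

end

/-!
The doubly robust estimator is an average of scores `φ_i` with estimated nuisance functions, and the
proof has three parts.

*Identification.* Within a cell of the conditioning treatments, the inverse probability terms of the
score have mean zero and the regression term compares treated and control outcome changes. Parallel
trends turns the latter into the untreated outcome change of the treated, so the mean of `φ_i` is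
the effect on the treated (`integral_drScore`, `NetworkDID.integral_phiDir`,
`NetworkDID.integral_phiPair`).

*Central limit theorem.* The score `φ_i` depends on the fundamental variables of units within
distance `K` (direct effect) or `2K` (indirect effect) only, so the scores are `α`-mixing along the
network with coefficients shifted by `2K` or `4K`, and bounded by overlap. Let `Z = ∑ X_i / S` be the
normalized sum of the centred scores and `Z_i` the part of it that belongs to the units within
distance `r` of `i`. In

`E[Z e^{iuZ}] - iu E[e^{iuZ}] = ∑ E[X_i e^{iu(Z - Z_i)}] / S`
`  + ∑ E[X_i (e^{iuZ} - e^{iu(Z - Z_i)} - iu Z_i e^{iuZ})] / S + iu E[e^{iuZ} (∑ X_i Z_i / S - 1)]`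

the first sum is small by mixing at distance `r`, the second is bounded by third moments
`E[|X_i| X_j X_k]` and the last term by covariances `Cov(X_i X_j, X_k X_l)`
(`WeaklyDependent.norm_stein_le`). A triple whose smallest distance `s` occurs at the pair `(a, b)`
contributes at most the mixing coefficient at distance `s`, and its third unit lies in the ball around
`a` but at distance at least `s` from `b`; quadruples are similar. Counting such configurations
(`sum_triples_le`, `sum_quadruples_le`, `pairSum_le_weakDependence`) gives exactly the sums of the
weak dependence condition for `k = 1` and `k = 2`. Hence the characteristic function of `Z` nearly
solves `f' = -u f`, so it tends to `e^{-u²/2}` (`norm_integral_cexp_sub_gaussian_le`,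
`tendsto_charFun_of_weaklyDependent`). The bound for covariances of bounded variables under
`α`-mixing is `MixingLE.abs_cov_le`.

*Estimation error.* Under overlap the score is Lipschitz in the nuisance functions near the truth
(`exists_abs_drScore_sub_le`), so under fast convergence the estimated and the true average differ by
`o_P(σ / √n)`. Slutsky's lemma, in terms of characteristic functions
(`tendstoInDistribution_of_charFun`), and Lévy's continuity theorem conclude.
-/

noncomputable section

/-! ### Covariances under `α`-mixing -/

/-- Two measures that are uniformly close on the superlevel sets of `Y ∈ [0, 1]` give close
integrals of `Y`, by the layer cake formula. -/
lemma abs_integral_sub_integral_le_of_superlevel {Ω : Type*} [MeasurableSpace Ω]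
    {ν₁ ν₂ : Measure Ω} [IsFiniteMeasure ν₁] [IsFiniteMeasure ν₂] {Y : Ω → ℝ} (hY : Measurable Y)
    (h0 : ∀ ω, 0 ≤ Y ω) (h1 : ∀ ω, Y ω ≤ 1) {α : ℝ}
    (h : ∀ t : ℝ, |ν₁.real {ω | t < Y ω} - ν₂.real {ω | t < Y ω}| ≤ α) :
    |∫ ω, Y ω ∂ν₁ - ∫ ω, Y ω ∂ν₂| ≤ α := by
  have key : ∀ ν : Measure Ω, IsFiniteMeasure ν →
      ∫ ω, Y ω ∂ν = ∫ t in Set.Ioc (0 : ℝ) 1, ν.real {ω | t < Y ω} := by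
    intro ν _
    have hi : Integrable Y ν := Integrable.of_bound hY.aestronglyMeasurable 1
      (ae_of_all _ fun ω => by rw [Real.norm_eq_abs, abs_of_nonneg (h0 ω)]; exact h1 ω)
    rw [hi.integral_eq_integral_meas_lt (ae_of_all _ h0)]
    refine setIntegral_eq_of_subset_of_forall_sdiff_eq_zero measurableSet_Ioi
      Set.Ioc_subset_Ioi_self ?_
    rintro t ⟨ht0, ht1⟩
    have : {ω | t < Y ω} = ∅ := by
      ext ω
      simp only [Set.mem_ofPred_eq, Set.mem_empty_iff_false, iff_false, not_lt]
      by_contra hlt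
      exact ht1 (Set.mem_Ioc.2 ⟨ht0, (not_le.1 hlt).le.trans (h1 ω)⟩)
    simp [this]
  have hint : ∀ ν : Measure Ω, IsFiniteMeasure ν →
      IntegrableOn (fun t : ℝ => ν.real {ω | t < Y ω}) (Set.Ioc (0 : ℝ) 1) := by
    intro ν _
    have hanti : Antitone fun t : ℝ => ν.real {ω | t < Y ω} := fun a b hab =>
      measureReal_mono fun ω hω => lt_of_le_of_lt hab hω
    exact (hanti.antitoneOn (Set.Icc (0 : ℝ) 1)).integrableOn_isCompact isCompact_Icc
      |>.mono_set Set.Ioc_subset_Icc_self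
  rw [key ν₁ ‹_›, key ν₂ ‹_›, ← integral_sub (hint ν₁ ‹_›) (hint ν₂ ‹_›)]
  have := norm_setIntegral_le_of_norm_le_const (μ := (volume : Measure ℝ)) (s := Set.Ioc (0 : ℝ) 1)
    (f := fun t : ℝ => ν₁.real {ω | t < Y ω} - ν₂.real {ω | t < Y ω}) (C := α)
    (by simp) (fun t _ => h t)
  simpa using this

/-- The weak form of `α`-mixing used below: the events of `m₁` and `m₂` are independent up to
`α`. -/
def MixingLE {Ω : Type*} (m₁ m₂ : MeasurableSpace Ω) [MeasurableSpace Ω] (μ : Measure Ω)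
    (α : ℝ) : Prop :=
  ∀ A B : Set Ω, MeasurableSet[m₁] A → MeasurableSet[m₂] B →
    |μ.real (A ∩ B) - μ.real A * μ.real B| ≤ α

lemma MixingLE.nonneg {Ω : Type*} {m₁ m₂ : MeasurableSpace Ω} [MeasurableSpace Ω] {μ : Measure Ω}
    {α : ℝ} (h : MixingLE m₁ m₂ μ α) : 0 ≤ α :=
  (abs_nonneg _).trans (h ∅ ∅ (@MeasurableSet.empty _ m₁) (@MeasurableSet.empty _ m₂))

lemma MixingLE.mono {Ω : Type*} {m₁ m₂ m₁' m₂' : MeasurableSpace Ω} [MeasurableSpace Ω]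
    {μ : Measure Ω} {α : ℝ} (h : MixingLE m₁' m₂' μ α) (h₁ : m₁ ≤ m₁')
    (h₂ : m₂ ≤ m₂') : MixingLE m₁ m₂ μ α :=
  fun A B hA hB => h A B (h₁ A hA) (h₂ B hB)

/-- Covariance inequality for `[0, 1]`-valued variables: the layer cake formula is applied to each
of the two variables in turn. -/
lemma MixingLE.abs_cov_le_unit {Ω : Type*} {m₁ m₂ m0 : MeasurableSpace Ω} {μ : Measure Ω}
    [IsProbabilityMeasure μ] (hm₁ : m₁ ≤ m0) (hm₂ : m₂ ≤ m0) {α : ℝ}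
    (h : MixingLE m₁ m₂ μ α) {X Y : Ω → ℝ} (hX : Measurable[m₁] X) (hY : Measurable[m₂] Y)
    (hX0 : ∀ ω, 0 ≤ X ω) (hX1 : ∀ ω, X ω ≤ 1) (hY0 : ∀ ω, 0 ≤ Y ω) (hY1 : ∀ ω, Y ω ≤ 1) :
    |∫ ω, X ω * Y ω ∂μ - (∫ ω, X ω ∂μ) * ∫ ω, Y ω ∂μ| ≤ α := by
  have hX' : Measurable X := hX.mono hm₁ le_rfl
  have hY' : Measurable Y := hY.mono hm₂ le_rfl
  have hYi : Integrable Y μ := Integrable.of_bound hY'.aestronglyMeasurable 1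
      (ae_of_all _ fun ω => by rw [Real.norm_eq_abs, abs_of_nonneg (hY0 ω)]; exact hY1 ω)
  -- closeness for an event and `Y`
  have step : ∀ A, MeasurableSet[m₁] A →
      |∫ ω in A, Y ω ∂μ - μ.real A * ∫ ω, Y ω ∂μ| ≤ α := by
    intro A hA
    have : IsFiniteMeasure (μ A • μ) := Measure.smul_finite μ (measure_ne_top μ A)
    have := abs_integral_sub_integral_le_of_superlevel (ν₁ := μ.restrict A)
      (ν₂ := μ A • μ) hY' hY0 hY1 (α := α) (fun t => by
        have hB : MeasurableSet[m₂] {ω | t < Y ω} := hY measurableSet_Ioi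
        have h2 := h A _ hA hB
        rw [measureReal_restrict_apply (hm₂ _ hB), measureReal_ennreal_smul_apply, Set.inter_comm]
        exact h2)
    rwa [integral_smul_measure] at this
  set f : Ω → NNReal := fun ω => (Y ω).toNNReal
  have hf : Measurable f := hY'.real_toNNReal
  have hν : IsFiniteMeasure (μ.withDensity fun ω => (f ω : ENNReal)) :=
    isFiniteMeasure_withDensity (ne_of_lt hYi.lintegral_lt_top)
  set c : NNReal := (∫ ω, Y ω ∂μ).toNNReal
  have hc : (c : ℝ) = ∫ ω, Y ω ∂μ := Real.coe_toNNReal _ (integral_nonneg hY0)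
  have := abs_integral_sub_integral_le_of_superlevel
    (ν₁ := μ.withDensity fun ω => (f ω : ENNReal)) (ν₂ := c • μ) hX' hX0 hX1 (α := α) (fun t => by
      have hA : MeasurableSet[m₁] {ω | t < X ω} := hX measurableSet_Ioi
      have h2 := step _ hA
      have e1 : (μ.withDensity fun ω => (f ω : ENNReal)).real {ω | t < X ω}
          = ∫ ω in {ω | t < X ω}, Y ω ∂μ := by
        rw [Measure.real, withDensity_apply _ (hm₁ _ hA),
          integral_eq_lintegral_of_nonneg_ae (ae_of_all _ hY0) hY'.aestronglyMeasurable]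
        rfl
      rw [e1, measureReal_nnreal_smul_apply, hc, mul_comm]
      exact h2)
  rw [integral_withDensity_eq_integral_smul hf, integral_smul_nnreal_measure] at this
  have e2 : ∀ ω, f ω • X ω = X ω * Y ω := fun ω => by
    rw [NNReal.smul_def, Real.coe_toNNReal _ (hY0 ω), smul_eq_mul, mul_comm]
  simp_rw [e2] at this
  rw [NNReal.smul_def, hc, smul_eq_mul, mul_comm (∫ ω, Y ω ∂μ)] at this
  exact this

/-- Covariance inequality for bounded variables. -/
lemma MixingLE.abs_cov_le {Ω : Type*} {m₁ m₂ m0 : MeasurableSpace Ω} {μ : Measure Ω}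
    [IsProbabilityMeasure μ] (hm₁ : m₁ ≤ m0) (hm₂ : m₂ ≤ m0) {α : ℝ}
    (h : MixingLE m₁ m₂ μ α) {X Y : Ω → ℝ} (hX : Measurable[m₁] X) (hY : Measurable[m₂] Y)
    {a b : ℝ} (ha : 0 < a) (hb : 0 < b) (hXa : ∀ ω, |X ω| ≤ a) (hYb : ∀ ω, |Y ω| ≤ b) :
    |∫ ω, X ω * Y ω ∂μ - (∫ ω, X ω ∂μ) * ∫ ω, Y ω ∂μ| ≤ 4 * a * b * α := by
  have hX' : Measurable X := hX.mono hm₁ le_rfl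
  have hY' : Measurable Y := hY.mono hm₂ le_rfl
  have hXi : Integrable X μ := Integrable.of_bound hX'.aestronglyMeasurable a (ae_of_all _ hXa)
  have hYi : Integrable Y μ := Integrable.of_bound hY'.aestronglyMeasurable b (ae_of_all _ hYb)
  have hXYi : Integrable (fun ω => X ω * Y ω) μ :=
    Integrable.of_bound (hX'.mul hY').aestronglyMeasurable (a * b) (ae_of_all _ fun ω => by
      rw [Real.norm_eq_abs, abs_mul]
      exact mul_le_mul (hXa ω) (hYb ω) (abs_nonneg _) ha.le)
  have hX1 : ∀ ω, -a ≤ X ω ∧ X ω ≤ a := fun ω => abs_le.1 (hXa ω)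
  have hY1 : ∀ ω, -b ≤ Y ω ∧ Y ω ≤ b := fun ω => abs_le.1 (hYb ω)
  -- rescale both variables to `[0, 1]`
  have key := h.abs_cov_le_unit hm₁ hm₂ (X := fun ω => (X ω + a) / (2 * a))
    (Y := fun ω => (Y ω + b) / (2 * b)) ((hX.add_const a).div_const _) ((hY.add_const b).div_const _)
    (fun ω => div_nonneg (by linarith [hX1 ω]) (by linarith))
    (fun ω => by rw [div_le_one (by linarith)]; linarith [hX1 ω])
    (fun ω => div_nonneg (by linarith [hY1 ω]) (by linarith))
    (fun ω => by rw [div_le_one (by linarith)]; linarith [hY1 ω])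
  have e1 : ∫ ω, (X ω + a) / (2 * a) ∂μ = ((∫ ω, X ω ∂μ) + a) / (2 * a) := by
    rw [integral_div, integral_add hXi (integrable_const _)]; simp
  have e2 : ∫ ω, (Y ω + b) / (2 * b) ∂μ = ((∫ ω, Y ω ∂μ) + b) / (2 * b) := by
    rw [integral_div, integral_add hYi (integrable_const _)]; simp
  have e3 : ∫ ω, (X ω + a) / (2 * a) * ((Y ω + b) / (2 * b)) ∂μ
      = ((∫ ω, X ω * Y ω ∂μ) + b * (∫ ω, X ω ∂μ) + a * (∫ ω, Y ω ∂μ) + a * b) / (4 * a * b) := by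
    have : ∀ ω, (X ω + a) / (2 * a) * ((Y ω + b) / (2 * b))
        = (X ω * Y ω + b * X ω + a * Y ω + a * b) / (4 * a * b) := fun ω => by
      field_simp; ring
    simp_rw [this]
    rw [integral_div, integral_add _ (integrable_const _), integral_add _ (hYi.const_mul a),
      integral_add hXYi (hXi.const_mul b), integral_const_mul, integral_const_mul]
    · simp
    · exact hXYi.add (hXi.const_mul b)
    · exact (hXYi.add (hXi.const_mul b)).add (hYi.const_mul a)
  rw [e1, e2, e3] at key
  have e4 : ((∫ ω, X ω * Y ω ∂μ) + b * (∫ ω, X ω ∂μ) + a * (∫ ω, Y ω ∂μ) + a * b) / (4 * a * b)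
      - ((∫ ω, X ω ∂μ) + a) / (2 * a) * (((∫ ω, Y ω ∂μ) + b) / (2 * b))
      = (∫ ω, X ω * Y ω ∂μ - (∫ ω, X ω ∂μ) * ∫ ω, Y ω ∂μ) / (4 * a * b) := by
    field_simp; ring
  have h4 : 0 < 4 * a * b := by positivity
  rw [e4, abs_div, abs_of_pos h4, div_le_iff₀ h4] at key
  linarith

/-! ### The Stein–Tikhomirov method -/

lemma norm_cexp_sub_one_sub_le (x : ℝ) :
    ‖Complex.exp (Complex.I * x) - 1 - Complex.I * x‖ ≤ 2 * x ^ 2 := by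
  have hn : ‖Complex.I * (x : ℂ)‖ = |x| := by simp
  by_cases hx : |x| ≤ 1
  · have := Complex.norm_exp_sub_one_sub_id_le (x := Complex.I * x) (by rw [hn]; exact hx)
    rw [hn, sq_abs] at this
    nlinarith [sq_nonneg x]
  · have h1 : ‖Complex.exp (Complex.I * x) - 1‖ ≤ |x| := Real.norm_exp_I_mul_ofReal_sub_one_le
    have h2 := norm_sub_le (Complex.exp (Complex.I * x) - 1) (Complex.I * x)
    rw [hn] at h2
    have h3 : |x| ≤ x ^ 2 := by rw [← sq_abs]; nlinarith [not_le.1 hx]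
    linarith

/-- If the function `u ↦ E e^{iuZ}` nearly solves the differential equation `φ' = -u φ` of the
Gaussian characteristic function, then it is close to `e^{-u²/2}`. -/
lemma norm_integral_cexp_sub_gaussian_le {Ω : Type*} [MeasurableSpace Ω] {μ : Measure Ω}
    [IsProbabilityMeasure μ] {Z : Ω → ℝ} (hZ : Measurable Z) {M : ℝ} (hM : ∀ ω, |Z ω| ≤ M) {ε : ℝ}
    (h : ∀ v : ℝ, ‖∫ ω, (Z ω : ℂ) * Complex.exp (Complex.I * (v * Z ω : ℝ)) ∂μ
      - Complex.I * v * ∫ ω, Complex.exp (Complex.I * (v * Z ω : ℝ)) ∂μ‖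
        ≤ ε * (1 + |v| + v ^ 2)) (u : ℝ) :
    ‖∫ ω, Complex.exp (Complex.I * (u * Z ω : ℝ)) ∂μ - Complex.exp (-(u : ℂ) ^ 2 / 2)‖
      ≤ ε * ((1 + |u| + u ^ 2) * Real.exp (u ^ 2 / 2) * |u|) := by
  have hε : 0 ≤ ε := by
    have := (norm_nonneg _).trans (h 0)
    simpa using this
  set φ : ℝ → ℂ := fun v => ∫ ω, Complex.exp (Complex.I * (v * Z ω : ℝ)) ∂μ with hφ
  have hmeas : ∀ v : ℝ, Measurable fun ω => Complex.exp (Complex.I * (v * Z ω : ℝ)) := fun v => by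
    fun_prop
  have hderiv : ∀ v : ℝ, HasDerivAt φ
      (∫ ω, Complex.I * (Z ω : ℂ) * Complex.exp (Complex.I * (v * Z ω : ℝ)) ∂μ) v := by
    intro v
    refine (hasDerivAt_integral_of_dominated_loc_of_deriv_le (s := Set.univ)
      (bound := fun _ => M) (F := fun (v : ℝ) ω => Complex.exp (Complex.I * (v * Z ω : ℝ)))
      (F' := fun (v : ℝ) ω => Complex.I * (Z ω : ℂ) * Complex.exp (Complex.I * (v * Z ω : ℝ)))
      univ_mem ?_ ?_ ?_ ?_ ?_ ?_).2
    · exact Eventually.of_forall fun v => (hmeas v).aestronglyMeasurable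
    · exact Integrable.of_bound (hmeas v).aestronglyMeasurable 1
        (ae_of_all _ fun ω => (Complex.norm_exp_I_mul_ofReal _).le)
    · have : Measurable fun ω =>
          Complex.I * (Z ω : ℂ) * Complex.exp (Complex.I * (v * Z ω : ℝ)) := by fun_prop
      exact this.aestronglyMeasurable
    · refine ae_of_all _ fun ω v _ => ?_
      rw [norm_mul, norm_mul, Complex.norm_exp_I_mul_ofReal]
      simpa using hM ω
    · exact integrable_const _
    · refine ae_of_all _ fun ω v _ => ?_
      have h1 : HasDerivAt (fun v : ℝ => Complex.I * ((v * Z ω : ℝ) : ℂ)) (Complex.I * (Z ω : ℂ)) v := by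
        have h2 : HasDerivAt (fun v : ℝ => v * Z ω) (Z ω) v := hasDerivAt_mul_const (Z ω)
        exact h2.ofReal_comp.const_mul _
      have := h1.cexp
      rwa [mul_comm] at this
  set g : ℝ → ℂ := fun v => φ v * Complex.exp ((v : ℂ) ^ 2 / 2) with hg
  have hexp : ∀ v : ℝ, HasDerivAt (fun v : ℝ => Complex.exp ((v : ℂ) ^ 2 / 2))
      (Complex.exp ((v : ℂ) ^ 2 / 2) * v) v := by
    intro v
    have h1 : HasDerivAt (fun z : ℂ => z ^ 2 / 2) (v : ℂ) (v : ℂ) := by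
      have := (hasDerivAt_pow 2 (v : ℂ)).div_const 2
      simpa using this
    exact h1.cexp.comp_ofReal
  have hgd : ∀ v : ℝ, HasDerivAt g
      ((∫ ω, Complex.I * (Z ω : ℂ) * Complex.exp (Complex.I * (v * Z ω : ℝ)) ∂μ)
        * Complex.exp ((v : ℂ) ^ 2 / 2) + φ v * (Complex.exp ((v : ℂ) ^ 2 / 2) * v)) v :=
    fun v => (hderiv v).mul (hexp v)
  have hnexp : ∀ v : ℝ, ‖Complex.exp ((v : ℂ) ^ 2 / 2)‖ = Real.exp (v ^ 2 / 2) := fun v => by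
    rw [show (v : ℂ) ^ 2 / 2 = ((v ^ 2 / 2 : ℝ) : ℂ) by push_cast; rfl, Complex.norm_exp_ofReal]
  have hbound : ∀ v ∈ Set.Icc (-|u|) |u|,
      ‖(∫ ω, Complex.I * (Z ω : ℂ) * Complex.exp (Complex.I * (v * Z ω : ℝ)) ∂μ)
        * Complex.exp ((v : ℂ) ^ 2 / 2) + φ v * (Complex.exp ((v : ℂ) ^ 2 / 2) * v)‖
      ≤ ε * ((1 + |u| + u ^ 2) * Real.exp (u ^ 2 / 2)) := by
    intro v hv
    have hv' : |v| ≤ |u| := abs_le.2 hv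
    have hv2 : v ^ 2 ≤ u ^ 2 := sq_le_sq.2 hv'
    have e : (∫ ω, Complex.I * (Z ω : ℂ) * Complex.exp (Complex.I * (v * Z ω : ℝ)) ∂μ)
        * Complex.exp ((v : ℂ) ^ 2 / 2) + φ v * (Complex.exp ((v : ℂ) ^ 2 / 2) * v)
        = Complex.I * (∫ ω, (Z ω : ℂ) * Complex.exp (Complex.I * (v * Z ω : ℝ)) ∂μ
          - Complex.I * v * φ v) * Complex.exp ((v : ℂ) ^ 2 / 2) := by
      have e0 : ∫ ω, Complex.I * (Z ω : ℂ) * Complex.exp (Complex.I * (v * Z ω : ℝ)) ∂μ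
          = Complex.I * ∫ ω, (Z ω : ℂ) * Complex.exp (Complex.I * (v * Z ω : ℝ)) ∂μ := by
        rw [← integral_const_mul]
        simp_rw [mul_assoc]
      rw [e0]
      linear_combination ((v : ℂ) * φ v * Complex.exp ((v : ℂ) ^ 2 / 2)) * Complex.I_mul_I
    rw [e, norm_mul, norm_mul, Complex.norm_I, one_mul, hnexp]
    calc _ ≤ ε * (1 + |v| + v ^ 2) * Real.exp (v ^ 2 / 2) := by gcongr; exact h v
      _ ≤ ε * (1 + |u| + u ^ 2) * Real.exp (u ^ 2 / 2) := by gcongr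
      _ = _ := by ring
  have hmv := (convex_Icc (-|u|) |u|).norm_image_sub_le_of_norm_hasDerivWithin_le
    (fun v _ => (hgd v).hasDerivWithinAt) hbound
    (x := 0) (y := u) (by simp) (abs_le.1 le_rfl)
  have hg0 : g 0 = 1 := by simp [hg, hφ]
  have e2 : φ u - Complex.exp (-(u : ℂ) ^ 2 / 2)
      = (g u - g 0) * Complex.exp (-(u : ℂ) ^ 2 / 2) := by
    rw [hg0]
    simp only [hg]
    rw [sub_mul, mul_assoc, ← Complex.exp_add, one_mul]
    rw [show (u : ℂ) ^ 2 / 2 + -(u : ℂ) ^ 2 / 2 = 0 by ring, Complex.exp_zero, mul_one]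
  change ‖φ u - _‖ ≤ _
  rw [e2, norm_mul, show -(u : ℂ) ^ 2 / 2 = ((-u ^ 2 / 2 : ℝ) : ℂ) by push_cast; rfl,
    Complex.norm_exp_ofReal]
  calc _ ≤ ‖g u - g 0‖ * 1 := by
        gcongr
        rw [Real.exp_le_one_iff]
        nlinarith [sq_nonneg u]
    _ ≤ _ := by
        rw [mul_one]
        refine hmv.trans (le_of_eq ?_)
        rw [sub_zero, Real.norm_eq_abs]; ring

/-! ### Counting tuples of units by their distances -/

section Counting

variable {n : ℕ} {G : SimpleGraph (Fin n)} {r : ℝ}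

lemma mem_netBall {i j : Fin n} : j ∈ netBall G i r ↔ G.edist i j ≤ (⌊r⌋₊ : ℕ∞) := by
  simp [netBall]

lemma mem_netBall_comm {i j : Fin n} : j ∈ netBall G i r ↔ i ∈ netBall G j r := by
  rw [mem_netBall, mem_netBall, SimpleGraph.edist_comm]

lemma mem_netOpenBall {j k : Fin n} {s : ℕ} : k ∈ netOpenBall G j s ↔ G.edist j k < (s : ℕ∞) := by
  simp [netOpenBall]

lemma mem_netShell {i j : Fin n} {s : ℕ} : j ∈ netShell G i s ↔ G.edist i j = (s : ℕ∞) := by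
  simp [netShell]

lemma reachable_of_mem_netBall {i j : Fin n} (h : j ∈ netBall G i r) : G.Reachable i j :=
  SimpleGraph.reachable_of_edist_ne_top
    (ne_top_of_le_ne_top (ENat.natCast_ne_top _) (mem_netBall.1 h))

lemma dist_lt_card_of_reachable {i j : Fin n} (h : G.Reachable i j) : G.dist i j < n := by
  obtain ⟨p, hp, hl⟩ := h.exists_path_of_dist
  rw [← hl]
  simpa using hp.length_lt

/-- The units within distance `r` of `a` that are at least as far from `b` as `a` is. -/
def farBall (G : SimpleGraph (Fin n)) (r : ℝ) (a b : Fin n) : Finset (Fin n) :=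
  netBall G a r \ netOpenBall G b (G.dist a b)

lemma mem_farBall {a b c : Fin n} :
    c ∈ farBall G r a b ↔ c ∈ netBall G a r ∧ ((G.dist a b : ℕ) : ℕ∞) ≤ G.edist b c := by
  simp [farBall, mem_netOpenBall]

open Classical in
/-- The sum of `τ(l(a, b)) |N(a; r)⁺ \ N(b; l(a, b) - 1)⁺|^k` over the pairs of units at finite
distance `l(a, b)`. -/
def pairSum (G : SimpleGraph (Fin n)) (r : ℝ) (τ : ℕ → ℝ) (k : ℕ) : ℝ :=
  ∑ a, ∑ b, if G.Reachable a b then τ (G.dist a b) * ((farBall G r a b).card : ℝ) ^ k else 0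

lemma pairSum_nonneg {τ : ℕ → ℝ} (hτ : ∀ s, 0 ≤ τ s) (k : ℕ) : 0 ≤ pairSum G r τ k := by
  refine Finset.sum_nonneg fun a _ => Finset.sum_nonneg fun b _ => ?_
  split_ifs
  · exact mul_nonneg (hτ _) (by positivity)
  · exact le_rfl

lemma pairSum_mono {τ τ' : ℕ → ℝ} (h : ∀ s, τ s ≤ τ' s) (k : ℕ) :
    pairSum G r τ k ≤ pairSum G r τ' k := by
  refine Finset.sum_le_sum fun a _ => Finset.sum_le_sum fun b _ => ?_
  split_ifs
  · exact mul_le_mul_of_nonneg_right (h _) (by positivity)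
  · exact le_rfl

lemma pairSum_const_mul (c : ℝ) (τ : ℕ → ℝ) (k : ℕ) :
    pairSum G r (fun s => c * τ s) k = c * pairSum G r τ k := by
  simp only [pairSum, Finset.mul_sum, mul_ite, mul_zero, mul_assoc]

open Classical in
/-- Sums over triples `(i, j, k)` with `j` and `k` close to `i` of terms that are controlled by the
smallest pairwise distance: the pair `(a, b)` at the smallest distance is singled out, and the third
unit lies in `farBall G r a b`. -/
lemma sum_triples_le {τ : ℕ → ℝ} (hτ : ∀ s, 0 ≤ τ s) {g : Fin n → Fin n → Fin n → ℝ}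
    (hg : ∀ i j k (s : ℕ), (s : ℕ∞) ≤ G.edist i j → (s : ℕ∞) ≤ G.edist i k →
      (s : ℕ∞) ≤ G.edist j k → g i j k ≤ τ s) :
    ∑ i, ∑ j ∈ netBall G i r, ∑ k ∈ netBall G i r, g i j k ≤ 3 * pairSum G r τ 1 := by
  set F : Fin n → Fin n → Fin n → ℝ := fun a b c =>
    if G.Reachable a b ∧ c ∈ farBall G r a b then τ (G.dist a b) else 0 with hF
  have hF0 : ∀ a b c, 0 ≤ F a b c := fun a b c => by
    simp only [hF]; split_ifs <;> simp [hτ]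
  have hsum : ∑ a, ∑ b, ∑ c, F a b c = pairSum G r τ 1 := by
    refine Finset.sum_congr rfl fun a _ => Finset.sum_congr rfl fun b _ => ?_
    by_cases hab : G.Reachable a b
    · simp [hF, hab, Finset.sum_ite_mem, mul_comm]
    · simp [hF, hab]
  have hpt : ∀ i j k, j ∈ netBall G i r → k ∈ netBall G i r →
      g i j k ≤ F i j k + F i k j + F j k i := by
    intro i j k hj hk
    have rij := reachable_of_mem_netBall hj
    have rik := reachable_of_mem_netBall hk
    have rjk := rij.symm.trans rik
    have eij := rij.coe_dist_eq_edist
    have eik := rik.coe_dist_eq_edist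
    have ejk := rjk.coe_dist_eq_edist
    have h1 := hF0 i j k
    have h2 := hF0 i k j
    have h3 := hF0 j k i
    rcases le_total (G.dist i j) (G.dist i k) with hle | hle
    · rcases le_total (G.dist i j) (G.dist j k) with hle' | hle'
      · have := hg i j k (G.dist i j) eij.le (by rw [← eik]; exact_mod_cast hle)
          (by rw [← ejk]; exact_mod_cast hle')
        have hm : k ∈ farBall G r i j := mem_farBall.2 ⟨hk, by rw [← ejk]; exact_mod_cast hle'⟩
        have : F i j k = τ (G.dist i j) := by simp [hF, rij, hm]
        linarith
      · have := hg i j k (G.dist j k) (by rw [← eij]; exact_mod_cast hle')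
          (by rw [← eik]; exact_mod_cast hle'.trans hle) ejk.le
        have hm : i ∈ farBall G r j k := mem_farBall.2 ⟨mem_netBall_comm.1 hj, by
          rw [SimpleGraph.edist_comm, ← eik]; exact_mod_cast hle'.trans hle⟩
        have : F j k i = τ (G.dist j k) := by simp [hF, rjk, hm]
        linarith
    · rcases le_total (G.dist i k) (G.dist j k) with hle' | hle'
      · have := hg i j k (G.dist i k) (by rw [← eij]; exact_mod_cast hle) eik.le
          (by rw [← ejk]; exact_mod_cast hle')
        have hm : j ∈ farBall G r i k := mem_farBall.2 ⟨hj, by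
          rw [SimpleGraph.edist_comm, ← ejk]; exact_mod_cast hle'⟩
        have : F i k j = τ (G.dist i k) := by simp [hF, rik, hm]
        linarith
      · have := hg i j k (G.dist j k) (by rw [← eij]; exact_mod_cast hle'.trans hle)
          (by rw [← eik]; exact_mod_cast hle') ejk.le
        have hm : i ∈ farBall G r j k := mem_farBall.2 ⟨mem_netBall_comm.1 hj, by
          rw [SimpleGraph.edist_comm, ← eik]; exact_mod_cast hle'⟩
        have : F j k i = τ (G.dist j k) := by simp [hF, rjk, hm]
        linarith
  calc ∑ i, ∑ j ∈ netBall G i r, ∑ k ∈ netBall G i r, g i j k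
      ≤ ∑ i, ∑ j ∈ netBall G i r, ∑ k ∈ netBall G i r, (F i j k + F i k j + F j k i) :=
        Finset.sum_le_sum fun i _ => Finset.sum_le_sum fun j hj => Finset.sum_le_sum fun k hk =>
          hpt i j k hj hk
    _ ≤ ∑ i, ∑ j, ∑ k, (F i j k + F i k j + F j k i) := by
        have h0 : ∀ i j k, 0 ≤ F i j k + F i k j + F j k i := fun i j k =>
          add_nonneg (add_nonneg (hF0 _ _ _) (hF0 _ _ _)) (hF0 _ _ _)
        refine Finset.sum_le_sum fun i _ => (Finset.sum_le_sum fun j _ =>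
          Finset.sum_le_univ_sum_of_nonneg fun k => h0 i j k).trans
          (Finset.sum_le_univ_sum_of_nonneg fun j => Finset.sum_nonneg fun k _ => h0 i j k)
    _ = 3 * pairSum G r τ 1 := by
        simp only [Finset.sum_add_distrib]
        have e2 : ∑ i, ∑ j, ∑ k, F i k j = ∑ i, ∑ k, ∑ j, F i k j :=
          Finset.sum_congr rfl fun i _ => Finset.sum_comm
        have e3 : ∑ i, ∑ j, ∑ k, F j k i = ∑ j, ∑ k, ∑ i, F j k i := by
          rw [Finset.sum_comm]
          exact Finset.sum_congr rfl fun i _ => Finset.sum_comm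
        rw [e2, e3, hsum]; ring

open Classical in
/-- Sums over quadruples `(i, j, k, l)` with `j` close to `i` and `l` close to `k` of terms that are
controlled by the distance of `{i, j}` and `{k, l}`: the pair `(a, b)` at which this distance is
attained is singled out, and the other two units lie in `farBall G r a b` and `farBall G r b a`. -/
lemma sum_quadruples_le {τ : ℕ → ℝ} (hτ : ∀ s, 0 ≤ τ s)
    {g : Fin n → Fin n → Fin n → Fin n → ℝ}
    (hg : ∀ i j k l (s : ℕ), (s : ℕ∞) ≤ G.edist i k → (s : ℕ∞) ≤ G.edist i l →
      (s : ℕ∞) ≤ G.edist j k → (s : ℕ∞) ≤ G.edist j l → g i j k l ≤ τ s)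
    (hg0 : ∀ i j k l, G.edist i k = ⊤ → G.edist i l = ⊤ → G.edist j k = ⊤ → G.edist j l = ⊤ →
      g i j k l ≤ 0) :
    ∑ i, ∑ j ∈ netBall G i r, ∑ k, ∑ l ∈ netBall G k r, g i j k l ≤ 4 * pairSum G r τ 2 := by
  set F : Fin n → Fin n → Fin n → Fin n → ℝ := fun a b c e =>
    if G.Reachable a b ∧ c ∈ farBall G r a b ∧ e ∈ farBall G r b a then τ (G.dist a b) else 0
    with hF
  have hF0 : ∀ a b c e, 0 ≤ F a b c e := fun a b c e => by
    simp only [hF]; split_ifs <;> simp [hτ]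
  have hin : ∀ a b, ∑ c, ∑ e, F a b c e = if G.Reachable a b then
      τ (G.dist a b) * ((farBall G r a b).card * (farBall G r b a).card : ℝ) else 0 := by
    intro a b
    by_cases hab : G.Reachable a b
    · simp only [hF, hab, ite_and, if_true]
      have : ∀ c, (∑ e, if c ∈ farBall G r a b then
          (if e ∈ farBall G r b a then τ (G.dist a b) else 0) else 0)
          = if c ∈ farBall G r a b then (farBall G r b a).card * τ (G.dist a b) else 0 := by
        intro c
        split_ifs <;> simp [Finset.sum_ite_mem]
      simp_rw [this]
      simp [Finset.sum_ite_mem]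
      ring
    · simp [hF, hab]
  have hsum : ∑ a, ∑ b, ∑ c, ∑ e, F a b c e ≤ pairSum G r τ 2 := by
    have hsw : pairSum G r τ 2 = ∑ a, ∑ b, if G.Reachable a b then
        τ (G.dist a b) * ((farBall G r b a).card : ℝ) ^ 2 else 0 := by
      rw [pairSum, Finset.sum_comm]
      refine Finset.sum_congr rfl fun a _ => Finset.sum_congr rfl fun b _ => ?_
      simp only [SimpleGraph.reachable_comm (u := b) (v := a),
        SimpleGraph.dist_comm (u := b) (v := a)]
    have h2 : 2 * ∑ a, ∑ b, ∑ c, ∑ e, F a b c e ≤ pairSum G r τ 2 + pairSum G r τ 2 := by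
      nth_rewrite 2 [hsw]
      rw [pairSum, ← Finset.sum_add_distrib, Finset.mul_sum]
      refine Finset.sum_le_sum fun a _ => ?_
      rw [← Finset.sum_add_distrib, Finset.mul_sum]
      refine Finset.sum_le_sum fun b _ => ?_
      rw [hin]
      split_ifs
      · have := two_mul_le_add_sq ((farBall G r a b).card : ℝ) ((farBall G r b a).card : ℝ)
        nlinarith [mul_le_mul_of_nonneg_left this (hτ (G.dist a b))]
      · simp
    linarith
  have hFeq : ∀ a b c e, G.Reachable a b → c ∈ netBall G a r → e ∈ netBall G b r →
      G.edist a b ≤ G.edist b c → G.edist a b ≤ G.edist a e → F a b c e = τ (G.dist a b) := by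
    intro a b c e hab hc he h1 h2
    have hd := hab.coe_dist_eq_edist
    have m1 : c ∈ farBall G r a b := mem_farBall.2 ⟨hc, by rw [hd]; exact h1⟩
    have m2 : e ∈ farBall G r b a := mem_farBall.2 ⟨he, by
      rw [SimpleGraph.dist_comm, hd]; exact h2⟩
    simp [hF, hab, m1, m2]
  have hpt : ∀ i j k l, j ∈ netBall G i r → l ∈ netBall G k r →
      g i j k l ≤ F i k j l + F i l j k + F j k i l + F j l i k := by
    intro i j k l hj hl
    have rij := reachable_of_mem_netBall hj
    have rkl := reachable_of_mem_netBall hl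
    have h1 := hF0 i k j l
    have h2 := hF0 i l j k
    have h3 := hF0 j k i l
    have h4 := hF0 j l i k
    have hj' := mem_netBall_comm.1 hj
    have hl' := mem_netBall_comm.1 hl
    by_cases rik : G.Reachable i k
    · have ril := rik.trans rkl
      have rjk := rij.symm.trans rik
      have rjl := rjk.trans rkl
      -- the case in which the distance is attained at the pair `(a, b)`
      have main : ∀ a b, G.Reachable a b → G.edist a b ≤ G.edist i k → G.edist a b ≤ G.edist i l →
          G.edist a b ≤ G.edist j k → G.edist a b ≤ G.edist j l →
          g i j k l ≤ τ (G.dist a b) := by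
        intro a b hab q1 q2 q3 q4
        have hd := hab.coe_dist_eq_edist
        rw [← hd] at q1 q2 q3 q4
        exact hg i j k l _ q1 q2 q3 q4
      have hmin : ∃ m : ℕ∞, (m = G.edist i k ∨ m = G.edist i l ∨ m = G.edist j k ∨
          m = G.edist j l) ∧ m ≤ G.edist i k ∧ m ≤ G.edist i l ∧ m ≤ G.edist j k ∧
          m ≤ G.edist j l := by
        refine ⟨min (min (G.edist i k) (G.edist i l)) (min (G.edist j k) (G.edist j l)), ?_, ?_⟩
        · rcases min_choice (min (G.edist i k) (G.edist i l)) (min (G.edist j k) (G.edist j l))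
            with h | h <;> rw [h]
          · rcases min_choice (G.edist i k) (G.edist i l) with h | h <;> simp [h]
          · rcases min_choice (G.edist j k) (G.edist j l) with h | h <;> simp [h]
        · simp
      obtain ⟨m, hm, q1, q2, q3, q4⟩ := hmin
      rcases hm with rfl | rfl | rfl | rfl
      · have := main i k rik q1 q2 q3 q4
        rw [← hFeq i k j l rik hj hl (by rwa [SimpleGraph.edist_comm (u := k)]) q2] at this
        linarith
      · have := main i l ril q1 q2 q3 q4
        rw [← hFeq i l j k ril hj hl' (by rwa [SimpleGraph.edist_comm (u := l)]) q1] at this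
        linarith
      · have := main j k rjk q1 q2 q3 q4
        rw [← hFeq j k i l rjk hj' hl (by rwa [SimpleGraph.edist_comm (u := k)]) q4] at this
        linarith
      · have := main j l rjl q1 q2 q3 q4
        rw [← hFeq j l i k rjl hj' hl' (by rwa [SimpleGraph.edist_comm (u := l)]) q3] at this
        linarith
    · have t1 := SimpleGraph.edist_eq_top_of_not_reachable rik
      have t2 := SimpleGraph.edist_eq_top_of_not_reachable
        (fun h => rik (h.trans rkl.symm) : ¬ G.Reachable i l)
      have t3 := SimpleGraph.edist_eq_top_of_not_reachable
        (fun h => rik (rij.trans h) : ¬ G.Reachable j k)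
      have t4 := SimpleGraph.edist_eq_top_of_not_reachable
        (fun h => rik (rij.trans (h.trans rkl.symm)) : ¬ G.Reachable j l)
      have := hg0 i j k l t1 t2 t3 t4
      linarith
  calc ∑ i, ∑ j ∈ netBall G i r, ∑ k, ∑ l ∈ netBall G k r, g i j k l
      ≤ ∑ i, ∑ j ∈ netBall G i r, ∑ k, ∑ l ∈ netBall G k r,
          (F i k j l + F i l j k + F j k i l + F j l i k) :=
        Finset.sum_le_sum fun i _ => Finset.sum_le_sum fun j hj => Finset.sum_le_sum fun k _ =>
          Finset.sum_le_sum fun l hl => hpt i j k l hj hl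
    _ ≤ ∑ i, ∑ j, ∑ k, ∑ l, (F i k j l + F i l j k + F j k i l + F j l i k) := by
        have h0 : ∀ i j k l, 0 ≤ F i k j l + F i l j k + F j k i l + F j l i k :=
          fun i j k l => add_nonneg (add_nonneg (add_nonneg (hF0 _ _ _ _) (hF0 _ _ _ _))
            (hF0 _ _ _ _)) (hF0 _ _ _ _)
        refine Finset.sum_le_sum fun i _ => (Finset.sum_le_sum fun j _ =>
          Finset.sum_le_sum fun k _ =>
          Finset.sum_le_univ_sum_of_nonneg fun l => h0 i j k l).trans
          (Finset.sum_le_univ_sum_of_nonneg fun j => Finset.sum_nonneg fun k _ =>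
            Finset.sum_nonneg fun l _ => h0 i j k l)
    _ = 4 * ∑ a, ∑ b, ∑ c, ∑ e, F a b c e := by
        simp only [Finset.sum_add_distrib]
        have e1 : ∑ i, ∑ j, ∑ k, ∑ l, F i k j l = ∑ i, ∑ k, ∑ j, ∑ l, F i k j l :=
          Finset.sum_congr rfl fun i _ => Finset.sum_comm
        have e2 : ∑ i, ∑ j, ∑ k, ∑ l, F i l j k = ∑ i, ∑ l, ∑ j, ∑ k, F i l j k := by
          refine Finset.sum_congr rfl fun i _ => ?_
          rw [Finset.sum_comm' (s' := fun _ => Finset.univ) (t' := Finset.univ) (by simp)]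
          rw [Finset.sum_comm]
          rw [Finset.sum_congr rfl fun j _ => Finset.sum_comm, Finset.sum_comm]
        have e3 : ∑ i, ∑ j, ∑ k, ∑ l, F j k i l = ∑ j, ∑ k, ∑ i, ∑ l, F j k i l := by
          rw [Finset.sum_comm]
          exact Finset.sum_congr rfl fun i _ => Finset.sum_comm
        have e4 : ∑ i, ∑ j, ∑ k, ∑ l, F j l i k = ∑ j, ∑ l, ∑ i, ∑ k, F j l i k := by
          rw [Finset.sum_comm]
          refine Finset.sum_congr rfl fun i _ => ?_
          rw [Finset.sum_congr rfl fun j _ => Finset.sum_comm, Finset.sum_comm]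
        rw [e1, e2, e3, e4]; ring
    _ ≤ 4 * pairSum G r τ 2 := by linarith

open Classical in
/-- The pair sums are controlled by the sums over distances of the weak dependence condition. Since
`0 ^ (d - 1)` vanishes for `d ≥ 2`, the pairs at distance `0` are absorbed by those at distance
`1`; this needs that no unit is isolated. -/
lemma pairSum_le_weakDependence {d : ℕ} {C : ℝ}
    (hC : ∀ i (s : ℕ), 1 ≤ s → ((netShell G i s).card : ℝ) ≤ C * (s : ℝ) ^ (d - 1))
    (hadj : ∀ i, ∃ j, G.Adj i j) (hr : 1 ≤ r) {θ : ℕ → ℝ} (hθ : ∀ s, 0 ≤ θ s) (hθ01 : θ 0 ≤ θ 1)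
    (k : ℕ) :
    pairSum G r θ k ≤ (C + 2 ^ k) * ∑ i, ∑ s ∈ Finset.range n, (s : ℝ) ^ (d - 1) *
        (((netShell G i s).sup fun j =>
          (netBall G i r \ netOpenBall G j s).card ^ k : ℕ) : ℝ) * θ s := by
  rw [pairSum, Finset.mul_sum]
  refine Finset.sum_le_sum fun a _ => ?_
  set c : ℕ → Fin n → ℕ := fun s b => (netBall G a r \ netOpenBall G b s).card with hc
  set sp : ℕ → ℝ := fun s => (((netShell G a s).sup fun b => c s b ^ k : ℕ) : ℝ) with hsp
  have hsp0 : ∀ s, 0 ≤ sp s := fun s => Nat.cast_nonneg _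
  have hterm0 : ∀ s ∈ Finset.range n, 0 ≤ (s : ℝ) ^ (d - 1) * sp s * θ s := fun s _ =>
    mul_nonneg (mul_nonneg (by positivity) (hsp0 s)) (hθ s)
  have hle : ∀ s b, b ∈ netShell G a s → ((c s b : ℝ)) ^ k ≤ sp s := fun s b hb => by
    have := Finset.le_sup (f := fun b => c s b ^ k) hb
    simp only [hsp]
    exact_mod_cast this
  have e1 : (∑ b, if G.Reachable a b then θ (G.dist a b) * ((farBall G r a b).card : ℝ) ^ k else 0)
      = ∑ s ∈ Finset.range n, ∑ b ∈ netShell G a s, θ s * (c s b : ℝ) ^ k := by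
    rw [← Finset.sum_filter, ← Finset.sum_fiberwise_of_maps_to (t := Finset.range n)
      (g := fun b => G.dist a b)
      (fun b hb => Finset.mem_range.2 (dist_lt_card_of_reachable (Finset.mem_filter.1 hb).2))]
    refine Finset.sum_congr rfl fun s _ => ?_
    have hset : ({b ∈ ({b | G.Reachable a b} : Finset (Fin n)) | G.dist a b = s}) =
        netShell G a s := by
      ext b
      simp only [Finset.mem_filter, Finset.mem_univ, true_and, mem_netShell]
      constructor
      · rintro ⟨h1, h2⟩
        rw [← h1.coe_dist_eq_edist, h2]
      · intro h
        have h1 : G.Reachable a b := SimpleGraph.reachable_of_edist_ne_top (by rw [h]; simp)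
        refine ⟨h1, ?_⟩
        rw [← h1.coe_dist_eq_edist] at h
        exact_mod_cast h
    rw [hset]
    refine Finset.sum_congr rfl fun b hb => ?_
    have hs : G.dist a b = s := by
      rw [← hset] at hb
      exact (Finset.mem_filter.1 hb).2
    simp only [hc, farBall, hs]
  rw [e1]
  obtain ⟨j, hj⟩ := hadj a
  have hja : j ∈ netShell G a 1 := mem_netShell.2 (by
    rw [SimpleGraph.edist_eq_one_iff_adj.2 hj]; rfl)
  have hn : 1 < n := by
    have := Fintype.one_lt_card_iff.2 ⟨a, j, hj.ne⟩
    simpa using this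
  have hC0 : 0 ≤ C := by
    have := hC a 1 le_rfl
    simp only [Nat.cast_one, one_pow, mul_one] at this
    exact le_trans (Nat.cast_nonneg _) this
  -- the pairs at distance zero
  have h0 : ∑ b ∈ netShell G a 0, θ 0 * (c 0 b : ℝ) ^ k
      ≤ 2 ^ k * ((1 : ℕ) ^ (d - 1) * sp 1 * θ 1) := by
    have hsh : netShell G a 0 = {a} := by
      ext b
      simp [mem_netShell, SimpleGraph.edist_eq_zero_iff, eq_comm (a := b)]
    rw [hsh, Finset.sum_singleton]
    have hfl : 1 ≤ ⌊r⌋₊ := Nat.le_floor (by simpa using hr)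
    have haj : ({a, j} : Finset (Fin n)) ⊆ netBall G a r := by
      intro b hb
      rw [mem_netBall]
      rcases Finset.mem_insert.1 hb with rfl | hb
      · simp
      · rw [Finset.mem_singleton.1 hb, SimpleGraph.edist_eq_one_iff_adj.2 hj]
        exact_mod_cast hfl
    have hball2 : 2 ≤ (netBall G a r).card := by
      rw [← Finset.card_pair hj.ne]
      exact Finset.card_le_card haj
    have hc0 : c 0 a = (netBall G a r).card := by
      simp only [hc]
      congr 1
      ext b
      simp [mem_netOpenBall]
    have hc1 : c 1 j + 1 = (netBall G a r).card := by
      simp only [hc]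
      have : netOpenBall G j 1 = {j} := by
        ext b
        simp [mem_netOpenBall, SimpleGraph.edist_eq_zero_iff, eq_comm (a := b)]
      rw [this, Finset.card_sdiff_of_subset (by
        rw [Finset.singleton_subset_iff]; exact haj (by simp)), Finset.card_singleton]
      omega
    have hcc : (c 0 a : ℝ) ≤ 2 * c 1 j := by
      have : c 0 a ≤ 2 * c 1 j := by omega
      exact_mod_cast this
    calc θ 0 * (c 0 a : ℝ) ^ k ≤ θ 1 * (2 * c 1 j) ^ k := by
          gcongr
          exact hθ 1
      _ = 2 ^ k * ((c 1 j : ℝ) ^ k * θ 1) := by rw [mul_pow]; ring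
      _ ≤ 2 ^ k * (sp 1 * θ 1) := by
          gcongr
          · exact hθ 1
          · exact hle 1 j hja
      _ = _ := by simp
  have hs : ∀ s, 1 ≤ s → ∑ b ∈ netShell G a s, θ s * (c s b : ℝ) ^ k
      ≤ C * ((s : ℝ) ^ (d - 1) * sp s * θ s) := by
    intro s hs1
    calc ∑ b ∈ netShell G a s, θ s * (c s b : ℝ) ^ k
        ≤ ∑ b ∈ netShell G a s, θ s * sp s :=
          Finset.sum_le_sum fun b hb => mul_le_mul_of_nonneg_left (hle s b hb) (hθ s)
      _ = (netShell G a s).card * (sp s * θ s) := by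
          rw [Finset.sum_const, nsmul_eq_mul]; ring
      _ ≤ C * (s : ℝ) ^ (d - 1) * (sp s * θ s) :=
          mul_le_mul_of_nonneg_right (hC a s hs1) (mul_nonneg (hsp0 s) (hθ s))
      _ = _ := by ring
  have hn0 : (0 : ℕ) ∈ Finset.range n := Finset.mem_range.2 (by omega)
  have hn1 : (1 : ℕ) ∈ Finset.range n := Finset.mem_range.2 hn
  rw [add_mul]
  rw [← Finset.add_sum_erase _ _ hn0, add_comm]
  refine add_le_add ?_ (h0.trans ?_)
  · rw [Finset.mul_sum]
    refine (Finset.sum_le_sum fun s hs' => hs s ?_).trans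
      (Finset.sum_le_sum_of_subset_of_nonneg (Finset.erase_subset _ _) fun s hs' _ =>
        mul_nonneg hC0 (hterm0 s hs'))
    exact Nat.one_le_iff_ne_zero.2 (Finset.ne_of_mem_erase hs')
  · exact mul_le_mul_of_nonneg_left (Finset.single_le_sum hterm0 hn1) (by positivity)

/-- The weak dependence sums grow at least like the number of units. -/
lemma card_le_weakDependence {d : ℕ} (hadj : ∀ i, ∃ j, G.Adj i j) {θ : ℕ → ℝ}
    (hθ : ∀ s, 0 ≤ θ s) (hθ1 : θ 1 = 1) :
    (n : ℝ) ≤ ∑ i, ∑ s ∈ Finset.range n, (s : ℝ) ^ (d - 1) *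
        (((netShell G i s).sup fun j =>
          (netBall G i r \ netOpenBall G j s).card ^ 1 : ℕ) : ℝ) * θ s := by
  have : ∀ i : Fin n, (1 : ℝ) ≤ ∑ s ∈ Finset.range n, (s : ℝ) ^ (d - 1) *
        (((netShell G i s).sup fun j =>
          (netBall G i r \ netOpenBall G j s).card ^ 1 : ℕ) : ℝ) * θ s := by
    intro i
    obtain ⟨j, hj⟩ := hadj i
    have hji : j ∈ netShell G i 1 := mem_netShell.2 (by
      rw [SimpleGraph.edist_eq_one_iff_adj.2 hj]; rfl)
    have hn : 1 < n := by
      have := Fintype.one_lt_card_iff.2 ⟨i, j, hj.ne⟩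
      simpa using this
    refine le_trans ?_ (Finset.single_le_sum (fun s _ => mul_nonneg (mul_nonneg (by positivity)
      (Nat.cast_nonneg _)) (hθ s)) (Finset.mem_range.2 hn))
    have h1 : 1 ≤ (netBall G i r \ netOpenBall G j 1).card ^ 1 := by
      rw [pow_one, Nat.one_le_iff_ne_zero, Finset.card_ne_zero]
      refine ⟨i, Finset.mem_sdiff.2 ⟨mem_netBall.2 (by simp), ?_⟩⟩
      rw [mem_netOpenBall, SimpleGraph.edist_eq_one_iff_adj.2 hj.symm]
      simp
    have h2 := h1.trans (Finset.le_sup (f := fun j => (netBall G i r \ netOpenBall G j 1).card ^ 1)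
      hji)
    have h3 : (1 : ℝ) ≤ (((netShell G i 1).sup fun j =>
          (netBall G i r \ netOpenBall G j 1).card ^ 1 : ℕ) : ℝ) := by exact_mod_cast h2
    simpa [hθ1] using h3
  calc (n : ℝ) = ∑ _i : Fin n, (1 : ℝ) := by simp
    _ ≤ _ := Finset.sum_le_sum fun i _ => this i

end Counting

/-! ### Characteristic function of a sum of weakly dependent variables -/

/-- A family of centred variables, bounded by `M`, indexed by the units of a network. The variable
`X i` is measurable with respect to `𝓕 i`, and the `σ`-algebras belonging to sets of units at
distance at least `s` are `α`-mixing with coefficient at most `τ s`, where `τ s → 0`. -/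
structure WeaklyDependent {Ω : Type*} {m0 : MeasurableSpace Ω} (μ : Measure Ω) {n : ℕ}
    (G : SimpleGraph (Fin n)) (𝓕 : Fin n → MeasurableSpace Ω) (X : Fin n → Ω → ℝ) (M : ℝ)
    (τ : ℕ → ℝ) : Prop where
  le : ∀ i, 𝓕 i ≤ m0
  measurable : ∀ i, Measurable[𝓕 i] (X i)
  bound_pos : 0 < M
  bound : ∀ i ω, |X i ω| ≤ M
  integral_eq_zero : ∀ i, ∫ ω, X i ω ∂μ = 0
  mixing : ∀ (H H' : Finset (Fin n)) (s : ℕ), (∀ i ∈ H, ∀ j ∈ H', (s : ℕ∞) ≤ G.edist i j) →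
    MixingLE (⨆ i ∈ H, 𝓕 i) (⨆ i ∈ H', 𝓕 i) μ (τ s)
  tendsto : Tendsto τ atTop (𝓝 0)

lemma integrable_of_measurable_of_bound {Ω E : Type*} [MeasurableSpace Ω] {μ : Measure Ω}
    [IsFiniteMeasure μ] [NormedAddCommGroup E] [MeasurableSpace E] [BorelSpace E]
    [SecondCountableTopology E] {f : Ω → E} (hf : Measurable f) (C : ℝ) (hC : ∀ ω, ‖f ω‖ ≤ C) :
    Integrable f μ :=
  Integrable.of_bound hf.aestronglyMeasurable C (ae_of_all _ hC)

lemma integral_abs_le_sqrt_integral_sq {Ω : Type*} [MeasurableSpace Ω] {μ : Measure Ω}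
    [IsProbabilityMeasure μ] {f : Ω → ℝ} (hf : Measurable f) (C : ℝ) (hC : ∀ ω, |f ω| ≤ C) :
    ∫ ω, |f ω| ∂μ ≤ √(∫ ω, f ω ^ 2 ∂μ) := by
  refine Real.le_sqrt_of_sq_le ?_
  have hm : MemLp (fun ω => |f ω|) 2 μ :=
    MemLp.of_bound hf.abs.aestronglyMeasurable C (ae_of_all _ fun ω => by simpa using hC ω)
  have h := variance_nonneg (fun ω => |f ω|) μ
  rw [variance_eq_sub hm] at h
  simp only [Pi.pow_apply, sq_abs] at h
  linarith

namespace WeaklyDependent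

variable {Ω : Type*} {m0 : MeasurableSpace Ω} {μ : Measure Ω} {n : ℕ} {G : SimpleGraph (Fin n)}
  {𝓕 : Fin n → MeasurableSpace Ω} {X : Fin n → Ω → ℝ} {M : ℝ} {τ : ℕ → ℝ}

lemma iSup_le (h : WeaklyDependent μ G 𝓕 X M τ) (H : Finset (Fin n)) : ⨆ i ∈ H, 𝓕 i ≤ m0 :=
  iSup₂_le fun i _ => h.le i

lemma measurable_iSup (h : WeaklyDependent μ G 𝓕 X M τ) {H : Finset (Fin n)} {i : Fin n}
    (hi : i ∈ H) : Measurable[⨆ i ∈ H, 𝓕 i] (X i) :=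
  (h.measurable i).mono (le_iSup₂_of_le i hi le_rfl) le_rfl

lemma measurable' (h : WeaklyDependent μ G 𝓕 X M τ) (i : Fin n) : Measurable (X i) :=
  (h.measurable i).mono (h.le i) le_rfl

lemma tau_nonneg (h : WeaklyDependent μ G 𝓕 X M τ) (s : ℕ) : 0 ≤ τ s :=
  (h.mixing ∅ ∅ s (by simp)).nonneg

lemma abs_sum_le (h : WeaklyDependent μ G 𝓕 X M τ) (H : Finset (Fin n)) (ω : Ω) :
    |∑ i ∈ H, X i ω| ≤ n * M := by
  calc |∑ i ∈ H, X i ω| ≤ ∑ i ∈ H, |X i ω| := Finset.abs_sum_le_sum_abs _ _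
    _ ≤ ∑ _i ∈ H, M := Finset.sum_le_sum fun i _ => h.bound i ω
    _ = H.card * M := by simp
    _ ≤ n * M := by
      have h1 : H.card ≤ n := by simpa using H.card_le_univ
      have h2 : (H.card : ℝ) ≤ n := by exact_mod_cast h1
      exact mul_le_mul_of_nonneg_right h2 h.bound_pos.le

/-- The sum over the neighbourhood of radius `r` of unit `i`. -/
def ballSum (G : SimpleGraph (Fin n)) (r : ℝ) (X : Fin n → Ω → ℝ) (i : Fin n) (ω : Ω) : ℝ :=
  ∑ j ∈ netBall G i r, X j ω

lemma measurable_ballSum (h : WeaklyDependent μ G 𝓕 X M τ) (r : ℝ) (i : Fin n) :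
    Measurable (ballSum G r X i) :=
  Finset.measurable_fun_sum _ fun j _ => h.measurable' j

lemma measurable_sum (h : WeaklyDependent μ G 𝓕 X M τ) : Measurable fun ω => ∑ i, X i ω :=
  Finset.measurable_fun_sum _ fun j _ => h.measurable' j

/-- The local estimate `∑ X_i ∑_{j near i} X_j` of the variance of the sum. -/
def localSq (G : SimpleGraph (Fin n)) (r : ℝ) (X : Fin n → Ω → ℝ) (ω : Ω) : ℝ :=
  ∑ i, X i ω * ballSum G r X i ω

lemma measurable_localSq (h : WeaklyDependent μ G 𝓕 X M τ) (r : ℝ) :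
    Measurable (localSq G r X) :=
  Finset.measurable_fun_sum _ fun i _ => (h.measurable' i).mul (h.measurable_ballSum r i)

lemma abs_localSq_le (h : WeaklyDependent μ G 𝓕 X M τ) (r : ℝ) (ω : Ω) :
    |localSq G r X ω| ≤ n * (M * (n * M)) := by
  calc |localSq G r X ω| ≤ ∑ i, |X i ω * ballSum G r X i ω| := Finset.abs_sum_le_sum_abs _ _
    _ ≤ ∑ _i : Fin n, M * (n * M) := Finset.sum_le_sum fun i _ => by
        rw [abs_mul]
        exact mul_le_mul (h.bound i ω) (h.abs_sum_le _ ω) (abs_nonneg _) h.bound_pos.le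
    _ = _ := by simp

variable [IsProbabilityMeasure μ]

lemma integral_abs_mul_mul_le (h : WeaklyDependent μ G 𝓕 X M τ) (i j k : Fin n) (s : ℕ)
    (hij : (s : ℕ∞) ≤ G.edist i j) (hjk : (s : ℕ∞) ≤ G.edist j k) :
    ∫ ω, |X i ω| * (X j ω * X k ω) ∂μ ≤ 4 * M ^ 3 * τ s := by
  have hmix := h.mixing {j} {i, k} s (by
    intro a ha b hb
    rw [Finset.mem_singleton.1 ha]
    rcases Finset.mem_insert.1 hb with rfl | hb
    · rwa [SimpleGraph.edist_comm]
    · rwa [Finset.mem_singleton.1 hb])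
  have hM := h.bound_pos
  have := hmix.abs_cov_le (h.iSup_le _) (h.iSup_le _) (X := X j) (Y := fun ω => |X i ω| * X k ω)
    (h.measurable_iSup (by simp))
    ((measurable_abs.comp (h.measurable_iSup (by simp))).mul (h.measurable_iSup (by simp)))
    hM (b := M * M) (by positivity) (h.bound j) (fun ω => by
      rw [abs_mul, abs_abs]
      exact mul_le_mul (h.bound i ω) (h.bound k ω) (abs_nonneg _) hM.le)
  rw [h.integral_eq_zero j, zero_mul, sub_zero] at this
  refine le_trans (le_of_eq ?_) ((le_abs_self _).trans (this.trans (le_of_eq ?_)))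
  · exact integral_congr_ae (ae_of_all _ fun ω => by ring)
  · ring

lemma cov_quadruple_le (h : WeaklyDependent μ G 𝓕 X M τ) (i j k l : Fin n) (s : ℕ)
    (hik : (s : ℕ∞) ≤ G.edist i k) (hil : (s : ℕ∞) ≤ G.edist i l)
    (hjk : (s : ℕ∞) ≤ G.edist j k) (hjl : (s : ℕ∞) ≤ G.edist j l) :
    ∫ ω, (X i ω * X j ω) * (X k ω * X l ω) ∂μ
      - (∫ ω, X i ω * X j ω ∂μ) * ∫ ω, X k ω * X l ω ∂μ ≤ 4 * M ^ 4 * τ s := by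
  have hmix := h.mixing {i, j} {k, l} s (by
    intro a ha b hb
    rcases Finset.mem_insert.1 ha with rfl | ha <;> rcases Finset.mem_insert.1 hb with rfl | hb
    · exact hik
    · rwa [Finset.mem_singleton.1 hb]
    · rwa [Finset.mem_singleton.1 ha]
    · rwa [Finset.mem_singleton.1 ha, Finset.mem_singleton.1 hb])
  have hM := h.bound_pos
  have hb : ∀ a b ω, |X a ω * X b ω| ≤ M * M := fun a b ω => by
    rw [abs_mul]
    exact mul_le_mul (h.bound a ω) (h.bound b ω) (abs_nonneg _) hM.le
  have := hmix.abs_cov_le (h.iSup_le _) (h.iSup_le _) (X := fun ω => X i ω * X j ω)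
    (Y := fun ω => X k ω * X l ω)
    ((h.measurable_iSup (by simp)).mul (h.measurable_iSup (by simp)))
    ((h.measurable_iSup (by simp)).mul (h.measurable_iSup (by simp)))
    (a := M * M) (b := M * M) (by positivity) (by positivity) (hb i j) (hb k l)
  refine (le_abs_self _).trans (this.trans (le_of_eq ?_))
  ring

/-- Pairs in different components of the network are uncorrelated, since they are mixing with
every coefficient `τ s`. -/
lemma cov_quadruple_nonpos (h : WeaklyDependent μ G 𝓕 X M τ) (i j k l : Fin n)
    (hik : G.edist i k = ⊤) (hil : G.edist i l = ⊤) (hjk : G.edist j k = ⊤)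
    (hjl : G.edist j l = ⊤) :
    ∫ ω, (X i ω * X j ω) * (X k ω * X l ω) ∂μ
      - (∫ ω, X i ω * X j ω ∂μ) * ∫ ω, X k ω * X l ω ∂μ ≤ 0 := by
  have hlim : Tendsto (fun s => 4 * M ^ 4 * τ s) atTop (𝓝 0) := by
    simpa using h.tendsto.const_mul (4 * M ^ 4)
  exact ge_of_tendsto hlim (Eventually.of_forall fun s =>
    h.cov_quadruple_le i j k l s (by simp [hik]) (by simp [hil]) (by simp [hjk]) (by simp [hjl]))

lemma integrable_mul (h : WeaklyDependent μ G 𝓕 X M τ) (i j : Fin n) :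
    Integrable (fun ω => X i ω * X j ω) μ :=
  integrable_of_measurable_of_bound ((h.measurable' i).mul (h.measurable' j)) (M * M) fun ω => by
    rw [norm_mul]
    exact mul_le_mul (h.bound i ω) (h.bound j ω) (abs_nonneg _) h.bound_pos.le

lemma integrable_abs_mul_mul (h : WeaklyDependent μ G 𝓕 X M τ) (i j k : Fin n) :
    Integrable (fun ω => |X i ω| * (X j ω * X k ω)) μ :=
  (h.integrable_mul j k).bdd_mul (c := M) (h.measurable' i).abs.aestronglyMeasurable
    (ae_of_all _ fun ω => by simpa using h.bound i ω)

lemma integrable_mul_mul_mul (h : WeaklyDependent μ G 𝓕 X M τ) (i j k l : Fin n) :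
    Integrable (fun ω => X i ω * X j ω * (X k ω * X l ω)) μ :=
  (h.integrable_mul k l).bdd_mul (c := M * M)
    ((h.measurable' i).mul (h.measurable' j)).aestronglyMeasurable
    (ae_of_all _ fun ω => by
      rw [norm_mul]
      exact mul_le_mul (h.bound i ω) (h.bound j ω) (abs_nonneg _) h.bound_pos.le)

/-- Third moments of the terms of the Taylor expansion. -/
lemma sum_integral_abs_mul_sq_le (h : WeaklyDependent μ G 𝓕 X M τ) (r : ℝ) :
    ∑ i, ∫ ω, |X i ω| * ballSum G r X i ω ^ 2 ∂μ ≤ 12 * M ^ 3 * pairSum G r τ 1 := by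
  have e : ∀ i, ∫ ω, |X i ω| * ballSum G r X i ω ^ 2 ∂μ
      = ∑ j ∈ netBall G i r, ∑ k ∈ netBall G i r, ∫ ω, |X i ω| * (X j ω * X k ω) ∂μ := by
    intro i
    have : ∀ ω, |X i ω| * ballSum G r X i ω ^ 2
        = ∑ j ∈ netBall G i r, ∑ k ∈ netBall G i r, |X i ω| * (X j ω * X k ω) := fun ω => by
      rw [ballSum, sq, Finset.sum_mul_sum, Finset.mul_sum]
      simp_rw [Finset.mul_sum]
    simp_rw [this]
    rw [integral_finsetSum _ fun j _ => integrable_finsetSum _ fun k _ =>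
      h.integrable_abs_mul_mul i j k]
    exact Finset.sum_congr rfl fun j _ => integral_finsetSum _ fun k _ =>
      h.integrable_abs_mul_mul i j k
  have hM := h.bound_pos
  simp_rw [e]
  refine (sum_triples_le (τ := fun s => 4 * M ^ 3 * τ s)
    (fun s => mul_nonneg (by positivity) (h.tau_nonneg s))
    (fun i j k s h1 _ h3 => h.integral_abs_mul_mul_le i j k s h1 h3)).trans (le_of_eq ?_)
  rw [pairSum_const_mul]; ring

lemma integral_localSq_sub_sq_le (h : WeaklyDependent μ G 𝓕 X M τ) (r : ℝ) :
    ∫ ω, (localSq G r X ω - ∫ ω', localSq G r X ω' ∂μ) ^ 2 ∂μ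
      ≤ 16 * M ^ 4 * pairSum G r τ 2 := by
  have hM := h.bound_pos
  have hl : ∀ ω, localSq G r X ω = ∑ i, ∑ j ∈ netBall G i r, X i ω * X j ω := fun ω => by
    simp only [localSq, ballSum, Finset.mul_sum]
  have hmem : MemLp (localSq G r X) 2 μ :=
    MemLp.of_bound (h.measurable_localSq r).aestronglyMeasurable _
      (ae_of_all _ fun ω => h.abs_localSq_le r ω)
  have hE : ∫ ω, localSq G r X ω ∂μ = ∑ i, ∑ j ∈ netBall G i r, ∫ ω, X i ω * X j ω ∂μ := by
    simp_rw [hl]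
    rw [integral_finsetSum _ fun i _ => integrable_finsetSum _ fun j _ => h.integrable_mul i j]
    exact Finset.sum_congr rfl fun i _ => integral_finsetSum _ fun j _ => h.integrable_mul i j
  have hE2 : ∫ ω, localSq G r X ω ^ 2 ∂μ = ∑ i, ∑ j ∈ netBall G i r, ∑ k, ∑ l ∈ netBall G k r,
      ∫ ω, X i ω * X j ω * (X k ω * X l ω) ∂μ := by
    have : ∀ ω, localSq G r X ω ^ 2 = ∑ i, ∑ j ∈ netBall G i r, ∑ k, ∑ l ∈ netBall G k r,
        X i ω * X j ω * (X k ω * X l ω) := fun ω => by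
      rw [hl, sq, Finset.sum_mul]
      refine Finset.sum_congr rfl fun i _ => ?_
      rw [Finset.sum_mul]
      refine Finset.sum_congr rfl fun j _ => ?_
      rw [Finset.mul_sum]
      exact Finset.sum_congr rfl fun k _ => Finset.mul_sum _ _ _
    simp_rw [this]
    have i4 := h.integrable_mul_mul_mul
    rw [integral_finsetSum _ fun i _ => integrable_finsetSum _ fun j _ =>
      integrable_finsetSum _ fun k _ => integrable_finsetSum _ fun l _ => i4 i j k l]
    refine Finset.sum_congr rfl fun i _ => ?_
    rw [integral_finsetSum _ fun j _ =>
      integrable_finsetSum _ fun k _ => integrable_finsetSum _ fun l _ => i4 i j k l]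
    refine Finset.sum_congr rfl fun j _ => ?_
    rw [integral_finsetSum _ fun k _ => integrable_finsetSum _ fun l _ => i4 i j k l]
    exact Finset.sum_congr rfl fun k _ => integral_finsetSum _ fun l _ => i4 i j k l
  have hv := variance_eq_sub hmem
  rw [variance_eq_integral hmem.aestronglyMeasurable.aemeasurable] at hv
  rw [hv]
  simp only [Pi.pow_apply]
  rw [hE2, hE]
  have hsq : (∑ i, ∑ j ∈ netBall G i r, ∫ ω, X i ω * X j ω ∂μ) ^ 2
      = ∑ i, ∑ j ∈ netBall G i r, ∑ k, ∑ l ∈ netBall G k r,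
        (∫ ω, X i ω * X j ω ∂μ) * ∫ ω, X k ω * X l ω ∂μ := by
    rw [sq, Finset.sum_mul]
    refine Finset.sum_congr rfl fun i _ => ?_
    rw [Finset.sum_mul]
    refine Finset.sum_congr rfl fun j _ => ?_
    rw [Finset.mul_sum]
    exact Finset.sum_congr rfl fun k _ => Finset.mul_sum _ _ _
  rw [hsq]
  simp_rw [← Finset.sum_sub_distrib]
  refine (sum_quadruples_le (τ := fun s => 4 * M ^ 4 * τ s)
    (fun s => mul_nonneg (by positivity) (h.tau_nonneg s))
    (fun i j k l s h1 h2 h3 h4 => h.cov_quadruple_le i j k l s h1 h2 h3 h4)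
    (fun i j k l h1 h2 h3 h4 => h.cov_quadruple_nonpos i j k l h1 h2 h3 h4)).trans (le_of_eq ?_)
  rw [pairSum_const_mul]; ring

variable {r ρ : ℝ}

/-- A unit is nearly uncorrelated with bounded functions of the units outside its neighbourhood. -/
lemma abs_integral_mul_far_le (h : WeaklyDependent μ G 𝓕 X M τ)
    (hfar : ∀ i, MixingLE (𝓕 i) (⨆ j ∈ (netBall G i r)ᶜ, 𝓕 j) μ ρ) (i : Fin n) {f : Ω → ℝ}
    (hf : Measurable[⨆ j ∈ (netBall G i r)ᶜ, 𝓕 j] f) {b : ℝ} (hb : 0 < b) (hfb : ∀ ω, |f ω| ≤ b) :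
    |∫ ω, X i ω * f ω ∂μ| ≤ 4 * M * b * ρ := by
  have := (hfar i).abs_cov_le (h.le i) (h.iSup_le _) (h.measurable i) hf h.bound_pos hb (h.bound i)
    hfb
  rwa [h.integral_eq_zero i, zero_mul, sub_zero] at this

lemma sum_sub_ballSum (i : Fin n) (ω : Ω) :
    ∑ j, X j ω - ballSum G r X i ω = ∑ j ∈ (netBall G i r)ᶜ, X j ω := by
  rw [ballSum, ← Finset.sum_add_sum_compl (netBall G i r)]; ring

lemma abs_integral_localSq_sub_le (h : WeaklyDependent μ G 𝓕 X M τ)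
    (hfar : ∀ i, MixingLE (𝓕 i) (⨆ j ∈ (netBall G i r)ᶜ, 𝓕 j) μ ρ) :
    |∫ ω, localSq G r X ω ∂μ - ∫ ω, (∑ i, X i ω) ^ 2 ∂μ| ≤ 4 * n ^ 2 * M ^ 2 * ρ := by
  have e : ∀ ω, localSq G r X ω - (∑ i, X i ω) ^ 2
      = -∑ i, ∑ j ∈ (netBall G i r)ᶜ, X i ω * X j ω := fun ω => by
    simp_rw [← Finset.mul_sum, ← sum_sub_ballSum, mul_sub, Finset.sum_sub_distrib, localSq,
      ← Finset.sum_mul]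
    ring
  have i1 : Integrable (localSq G r X) μ :=
    integrable_of_measurable_of_bound (h.measurable_localSq r) _ (h.abs_localSq_le r)
  have i2 : Integrable (fun ω => (∑ i, X i ω) ^ 2) μ := by
    refine integrable_of_measurable_of_bound (h.measurable_sum.pow_const 2) ((n * M) ^ 2)
      fun ω => ?_
    rw [norm_pow, Real.norm_eq_abs]
    exact pow_le_pow_left₀ (abs_nonneg _) (h.abs_sum_le _ ω) 2
  have hρ : 0 ≤ ρ ∨ n = 0 := by
    rcases Nat.eq_zero_or_pos n with hn | hn
    · exact Or.inr hn
    · exact Or.inl (hfar ⟨0, hn⟩).nonneg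
  rw [← integral_sub i1 i2]
  simp_rw [e]
  rw [integral_neg, abs_neg, integral_finsetSum _ fun i _ => integrable_finsetSum _ fun j _ =>
    h.integrable_mul i j]
  have hM := h.bound_pos
  calc |∑ i, ∫ ω, ∑ j ∈ (netBall G i r)ᶜ, X i ω * X j ω ∂μ|
      ≤ ∑ i, |∫ ω, ∑ j ∈ (netBall G i r)ᶜ, X i ω * X j ω ∂μ| := Finset.abs_sum_le_sum_abs _ _
    _ ≤ ∑ _i : Fin n, n * (4 * M * M * ρ) := by
        refine Finset.sum_le_sum fun i _ => ?_
        rw [integral_finsetSum _ fun j _ => h.integrable_mul i j]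
        refine (Finset.abs_sum_le_sum_abs _ _).trans ?_
        refine (Finset.sum_le_sum fun j hj => h.abs_integral_mul_far_le hfar i
          (h.measurable_iSup hj) hM (h.bound j)).trans ?_
        rw [Finset.sum_const, nsmul_eq_mul]
        have h1 : (netBall G i r)ᶜ.card ≤ n := by simpa using (netBall G i r)ᶜ.card_le_univ
        have h2 : ((netBall G i r)ᶜ.card : ℝ) ≤ n := by exact_mod_cast h1
        have := (hfar i).nonneg
        gcongr
    _ = 4 * n ^ 2 * M ^ 2 * ρ := by simp; ring

lemma norm_integral_mul_cexp_far_le (h : WeaklyDependent μ G 𝓕 X M τ)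
    (hfar : ∀ i, MixingLE (𝓕 i) (⨆ j ∈ (netBall G i r)ᶜ, 𝓕 j) μ ρ) (i : Fin n) (u : ℝ) :
    ‖∫ ω, (X i ω : ℂ) *
      Complex.exp (Complex.I * (u * (∑ j, X j ω - ballSum G r X i ω) : ℝ)) ∂μ‖ ≤ 8 * M * ρ := by
  have hm : Measurable[⨆ j ∈ (netBall G i r)ᶜ, 𝓕 j]
      fun ω => u * (∑ j, X j ω - ballSum G r X i ω) := by
    simp_rw [sum_sub_ballSum]
    exact (Finset.measurable_fun_sum _ fun j hj => h.measurable_iSup hj).const_mul u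
  have hm' : Measurable fun ω => u * (∑ j, X j ω - ballSum G r X i ω) := hm.mono (h.iSup_le _) le_rfl
  have hX := h.measurable' i
  have hcos := h.abs_integral_mul_far_le hfar i (Real.measurable_cos.comp hm) one_pos
    fun ω => Real.abs_cos_le_one _
  have hsin := h.abs_integral_mul_far_le hfar i (Real.measurable_sin.comp hm) one_pos
    fun ω => Real.abs_sin_le_one _
  have hi1 : Integrable (fun ω => X i ω * Real.cos (u * (∑ j, X j ω - ballSum G r X i ω))) μ := by
    refine integrable_of_measurable_of_bound (hX.mul (Real.measurable_cos.comp hm')) (M * 1)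
      fun ω => ?_
    rw [norm_mul]
    exact mul_le_mul (h.bound i ω) (Real.abs_cos_le_one _) (norm_nonneg _) h.bound_pos.le
  have hi2 : Integrable (fun ω => X i ω * Real.sin (u * (∑ j, X j ω - ballSum G r X i ω))) μ := by
    refine integrable_of_measurable_of_bound (hX.mul (Real.measurable_sin.comp hm')) (M * 1)
      fun ω => ?_
    rw [norm_mul]
    exact mul_le_mul (h.bound i ω) (Real.abs_sin_le_one _) (norm_nonneg _) h.bound_pos.le
  have e : ∀ ω, (X i ω : ℂ) *
      Complex.exp (Complex.I * (u * (∑ j, X j ω - ballSum G r X i ω) : ℝ))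
      = ((X i ω * Real.cos (u * (∑ j, X j ω - ballSum G r X i ω)) : ℝ) : ℂ)
        + Complex.I * ((X i ω * Real.sin (u * (∑ j, X j ω - ballSum G r X i ω)) : ℝ) : ℂ) := by
    intro ω
    rw [mul_comm Complex.I, Complex.exp_mul_I, ← Complex.ofReal_cos, ← Complex.ofReal_sin]
    simp only [Complex.ofReal_mul (X i ω)]
    ring
  simp_rw [e]
  rw [integral_add hi1.ofReal (hi2.ofReal.const_mul _), integral_const_mul, integral_complex_ofReal,
    integral_complex_ofReal]
  refine (norm_add_le _ _).trans ?_
  rw [norm_mul, Complex.norm_I, one_mul, Complex.norm_real, Complex.norm_real]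
  simp only [Function.comp_def] at hcos hsin
  rw [Real.norm_eq_abs, Real.norm_eq_abs]
  linarith

/-- Stein's identity holds approximately for `f(z) = e^{iuz}` and the normalized sum: the
characteristic function nearly solves the Gaussian differential equation. -/
lemma norm_stein_le (h : WeaklyDependent μ G 𝓕 X M τ)
    (hfar : ∀ i, MixingLE (𝓕 i) (⨆ j ∈ (netBall G i r)ᶜ, 𝓕 j) μ ρ) {S : ℝ} (hS : 0 < S)
    (hvar : ∫ ω, (∑ i, X i ω) ^ 2 ∂μ = S ^ 2) (u : ℝ) :
    ‖∫ ω, (((∑ i, X i ω) / S : ℝ) : ℂ) * Complex.exp (Complex.I * (u * ((∑ i, X i ω) / S) : ℝ)) ∂μ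
      - Complex.I * u * ∫ ω, Complex.exp (Complex.I * (u * ((∑ i, X i ω) / S) : ℝ)) ∂μ‖
      ≤ 8 * n * M * ρ / S
        + |u| * ((4 * n ^ 2 * M ^ 2 * ρ + 4 * M ^ 2 * √(pairSum G r τ 2)) / S ^ 2)
        + u ^ 2 * (24 * M ^ 3 * pairSum G r τ 1 / S ^ 3) := by
  have hM := h.bound_pos
  have hX := h.measurable'
  have hB := h.measurable_ballSum r
  have hW := h.measurable_sum
  have hQ := h.measurable_localSq r
  set W : Ω → ℝ := fun ω => ∑ i, X i ω with hWdef
  set B : Fin n → Ω → ℝ := ballSum G r X with hBdef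
  set Q : Ω → ℝ := localSq G r X with hQdef
  set E : Ω → ℂ := fun ω => Complex.exp (Complex.I * (u * (W ω / S) : ℝ)) with hE
  set E' : Fin n → Ω → ℂ := fun i ω => Complex.exp (Complex.I * (u / S * (W ω - B i ω) : ℝ)) with hE'
  have hEn : ∀ ω, ‖E ω‖ = 1 := fun ω => Complex.norm_exp_I_mul_ofReal _
  have hE'n : ∀ i ω, ‖E' i ω‖ = 1 := fun i ω => Complex.norm_exp_I_mul_ofReal _
  have hEm : Measurable E := by fun_prop
  have hE'm : ∀ i, Measurable (E' i) := fun i => by fun_prop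
  have hBn : ∀ i ω, |B i ω| ≤ n * M := fun i ω => h.abs_sum_le _ ω
  have hWn : ∀ ω, |W ω| ≤ n * M := fun ω => h.abs_sum_le _ ω
  -- the three parts of the decomposition
  set T1 : Fin n → Ω → ℂ := fun i ω => (X i ω : ℂ) * E' i ω with hT1
  set T2 : Fin n → Ω → ℂ := fun i ω => (X i ω : ℂ) *
    (E ω - E' i ω - Complex.I * (u / S * B i ω : ℝ) * E ω) with hT2
  set T3 : Ω → ℂ := fun ω => E ω * ((Q ω - S ^ 2 : ℝ) : ℂ) with hT3
  have hT2n : ∀ i ω, ‖T2 i ω‖ ≤ 2 * (u / S) ^ 2 * (|X i ω| * B i ω ^ 2) := by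
    intro i ω
    have e1 : E' i ω = E ω * Complex.exp (Complex.I * (-(u / S * B i ω) : ℝ)) := by
      simp only [hE, hE']
      rw [← Complex.exp_add, ← mul_add, ← Complex.ofReal_add]
      congr 3
      ring
    have e2 : T2 i ω = -((X i ω : ℂ) * (E ω * (Complex.exp (Complex.I * (-(u / S * B i ω) : ℝ)) - 1
        - Complex.I * (-(u / S * B i ω) : ℝ)))) := by
      simp only [hT2]
      rw [e1]
      push_cast
      ring
    rw [e2, norm_neg, norm_mul, norm_mul, hEn, one_mul, Complex.norm_real, Real.norm_eq_abs]
    calc _ ≤ |X i ω| * (2 * (-(u / S * B i ω)) ^ 2) :=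
          mul_le_mul_of_nonneg_left (norm_cexp_sub_one_sub_le _) (abs_nonneg _)
      _ = _ := by ring
  have hT1i : ∀ i, Integrable (T1 i) μ := fun i => by
    refine integrable_of_measurable_of_bound (by fun_prop) M fun ω => ?_
    simp only [hT1]
    rw [norm_mul, hE'n, mul_one, Complex.norm_real]
    exact h.bound i ω
  have hXB : ∀ i, Integrable (fun ω => |X i ω| * B i ω ^ 2) μ := fun i => by
    refine integrable_of_measurable_of_bound (by fun_prop) (M * (n * M) ^ 2) fun ω => ?_
    rw [norm_mul, norm_pow, Real.norm_eq_abs, Real.norm_eq_abs, abs_abs]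
    exact mul_le_mul (h.bound i ω) (pow_le_pow_left₀ (abs_nonneg _) (hBn i ω) 2) (by positivity)
      hM.le
  have hT2i : ∀ i, Integrable (T2 i) μ := fun i =>
    ((hXB i).const_mul (2 * (u / S) ^ 2)).mono' (by
      have : Measurable (T2 i) := by fun_prop
      exact this.aestronglyMeasurable) (ae_of_all _ (hT2n i))
  have hQi : Integrable (fun ω => Q ω - S ^ 2) μ :=
    (integrable_of_measurable_of_bound hQ _ (h.abs_localSq_le r)).sub (integrable_const _)
  have hT3i : Integrable T3 μ := by
    refine hQi.norm.mono' (by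
      have : Measurable T3 := by fun_prop
      exact this.aestronglyMeasurable) (ae_of_all _ fun ω => ?_)
    simp only [hT3]
    rw [norm_mul, hEn, one_mul, Complex.norm_real]
  have hWEi : Integrable (fun ω => ((W ω / S : ℝ) : ℂ) * E ω) μ := by
    refine integrable_of_measurable_of_bound (by fun_prop) (n * M / S) fun ω => ?_
    rw [norm_mul, hEn, mul_one, Complex.norm_real, Real.norm_eq_abs, abs_div, abs_of_pos hS]
    exact div_le_div_of_nonneg_right (hWn ω) hS.le
  have hEi : Integrable E μ := integrable_of_measurable_of_bound hEm 1 fun ω => (hEn ω).le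
  have hSc : (S : ℂ) ≠ 0 := by exact_mod_cast hS.ne'
  have hdec : ∀ ω, ((W ω / S : ℝ) : ℂ) * E ω - Complex.I * u * E ω
      = (S : ℂ)⁻¹ * (∑ i, T1 i ω) + (S : ℂ)⁻¹ * (∑ i, T2 i ω)
        + Complex.I * u * ((S : ℂ) ^ 2)⁻¹ * T3 ω := by
    intro ω
    have e1 : ∑ i, T1 i ω + ∑ i, T2 i ω
        = (W ω : ℂ) * E ω - Complex.I * (u / S) * (Q ω : ℂ) * E ω := by
      rw [← Finset.sum_add_distrib]
      have : ∀ i, T1 i ω + T2 i ω = (X i ω : ℂ) * E ω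
          - Complex.I * (u / S) * E ω * ((X i ω * B i ω : ℝ) : ℂ) := fun i => by
        simp only [hT1, hT2]; push_cast; ring
      simp_rw [this]
      rw [Finset.sum_sub_distrib, ← Finset.sum_mul, ← Finset.mul_sum, ← Complex.ofReal_sum,
        ← Complex.ofReal_sum]
      simp only [hWdef, hQdef, localSq, hBdef]
      ring
    rw [← mul_add, e1]
    simp only [hT3]
    push_cast
    field_simp
    ring
  have hint : ∫ ω, ((W ω / S : ℝ) : ℂ) * E ω ∂μ - Complex.I * u * ∫ ω, E ω ∂μ
      = (S : ℂ)⁻¹ * (∑ i, ∫ ω, T1 i ω ∂μ) + (S : ℂ)⁻¹ * (∑ i, ∫ ω, T2 i ω ∂μ)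
        + Complex.I * u * ((S : ℂ) ^ 2)⁻¹ * ∫ ω, T3 ω ∂μ := by
    rw [← integral_const_mul, ← integral_sub hWEi (hEi.const_mul _)]
    simp_rw [hdec]
    have j1 : Integrable (fun ω => ∑ i, T1 i ω) μ := integrable_finsetSum _ fun i _ => hT1i i
    have j2 : Integrable (fun ω => ∑ i, T2 i ω) μ := integrable_finsetSum _ fun i _ => hT2i i
    have j12 : Integrable (fun ω => (S : ℂ)⁻¹ * (∑ i, T1 i ω) + (S : ℂ)⁻¹ * (∑ i, T2 i ω)) μ :=
      (j1.const_mul _).add (j2.const_mul _)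
    rw [integral_add j12 (hT3i.const_mul _), integral_add (j1.const_mul _) (j2.const_mul _), integral_const_mul, integral_const_mul,
      integral_const_mul, integral_finsetSum _ fun i _ => hT1i i,
      integral_finsetSum _ fun i _ => hT2i i]
  have b1 : ‖∑ i, ∫ ω, T1 i ω ∂μ‖ ≤ 8 * n * M * ρ := by
    refine (norm_sum_le _ _).trans ((Finset.sum_le_sum fun i _ =>
      h.norm_integral_mul_cexp_far_le hfar i (u / S)).trans (le_of_eq ?_))
    simp; ring
  have b2 : ‖∑ i, ∫ ω, T2 i ω ∂μ‖ ≤ 2 * (u / S) ^ 2 * (12 * M ^ 3 * pairSum G r τ 1) := by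
    refine (norm_sum_le _ _).trans ?_
    refine le_trans ?_ (mul_le_mul_of_nonneg_left (h.sum_integral_abs_mul_sq_le r)
      (by positivity : 0 ≤ 2 * (u / S) ^ 2))
    rw [Finset.mul_sum]
    refine Finset.sum_le_sum fun i _ => ?_
    rw [← integral_const_mul]
    exact norm_integral_le_of_norm_le ((hXB i).const_mul _) (ae_of_all _ (hT2n i))
  have b3 : ‖∫ ω, T3 ω ∂μ‖ ≤ 4 * n ^ 2 * M ^ 2 * ρ + 4 * M ^ 2 * √(pairSum G r τ 2) := by
    set q := ∫ ω, Q ω ∂μ with hq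
    have hQq : Integrable (fun ω => |Q ω - q|) μ :=
      ((integrable_of_measurable_of_bound hQ _ (h.abs_localSq_le r)).sub (integrable_const _)).abs
    have c1 : ‖∫ ω, T3 ω ∂μ‖ ≤ ∫ ω, (|Q ω - q| + |q - S ^ 2|) ∂μ := by
      refine norm_integral_le_of_norm_le (hQq.add (integrable_const _)) (ae_of_all _ fun ω => ?_)
      simp only [hT3]
      rw [norm_mul, hEn, one_mul, Complex.norm_real, Real.norm_eq_abs]
      exact abs_sub_le _ _ _
    rw [integral_add hQq (integrable_const _)] at c1
    have c2 : ∫ ω, |Q ω - q| ∂μ ≤ 4 * M ^ 2 * √(pairSum G r τ 2) := by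
      refine (integral_abs_le_sqrt_integral_sq (hQ.sub_const q) (n * (M * (n * M)) + |q|)
        fun ω => (abs_sub _ _).trans (add_le_add (h.abs_localSq_le r ω) le_rfl)).trans ?_
      refine (Real.sqrt_le_sqrt (h.integral_localSq_sub_sq_le r)).trans (le_of_eq ?_)
      rw [Real.sqrt_mul (by positivity), show 16 * M ^ 4 = (4 * M ^ 2) ^ 2 by ring,
        Real.sqrt_sq (by positivity)]
    have c3 : |q - S ^ 2| ≤ 4 * n ^ 2 * M ^ 2 * ρ := by
      rw [← hvar]
      exact h.abs_integral_localSq_sub_le hfar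
    have c4 : ∫ _ω, |q - S ^ 2| ∂μ = |q - S ^ 2| := by simp
    linarith
  rw [hint]
  refine (norm_add₃_le).trans ?_
  have hnS : ‖(S : ℂ)‖ = S := by rw [Complex.norm_real, Real.norm_eq_abs, abs_of_pos hS]
  rw [norm_mul, norm_mul, norm_mul, norm_mul, norm_mul, norm_inv, norm_inv, norm_pow, hnS,
    Complex.norm_I, one_mul, Complex.norm_real, Real.norm_eq_abs]
  calc _ ≤ S⁻¹ * (8 * n * M * ρ) + S⁻¹ * (2 * (u / S) ^ 2 * (12 * M ^ 3 * pairSum G r τ 1))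
        + |u| * (S ^ 2)⁻¹ * (4 * n ^ 2 * M ^ 2 * ρ + 4 * M ^ 2 * √(pairSum G r τ 2)) := by
        gcongr
    _ = _ := by field_simp; ring

end WeaklyDependent

/-! ### The central limit theorem for weakly dependent arrays -/

/-- Bound on the mixing coefficients of variables that depend on their surroundings only up to
distance `R / 2`, when the fundamental variables have mixing coefficients at most `C αhat`. -/
def mixCoeff (R C : ℝ) (αhat : ℝ → ℝ) (s : ℝ) : ℝ := if s < R then 1 else min 1 (C * αhat (s - R))

lemma thetaCoeff_nonneg {R : ℝ} {αhat : ℝ → ℝ} (hα : ∀ s, 0 ≤ s → 0 ≤ αhat s) (s : ℝ) :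
    0 ≤ thetaCoeff R αhat s := by
  unfold thetaCoeff
  split_ifs with h
  · exact zero_le_one
  · exact hα _ (by linarith)

/-- Mixing coefficients are at most `1`, so they may be replaced by any power in `(0, 1]`. -/
lemma mixCoeff_le {R C : ℝ} {αhat : ℝ → ℝ} (hα : ∀ s, 0 ≤ s → 0 ≤ αhat s) {q : ℝ} (hq : 0 < q)
    (hq1 : q ≤ 1) (s : ℝ) : mixCoeff R C αhat s ≤ max 1 C * thetaCoeff R αhat s ^ q := by
  unfold mixCoeff thetaCoeff
  split_ifs with h
  · simp
  · set a := αhat (s - R) with ha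
    have ha0 : 0 ≤ a := hα _ (by linarith)
    rcases le_total 1 a with h1 | h1
    · calc min 1 (C * a) ≤ 1 := min_le_left _ _
        _ ≤ max 1 C * a ^ q := by
          nlinarith [Real.one_le_rpow h1 hq.le, le_max_left 1 C]
    · have h2 : a ≤ a ^ q := by
        rcases ha0.eq_or_lt with h0 | h0
        · rw [← h0, Real.zero_rpow hq.ne']
        · simpa using Real.rpow_le_rpow_of_exponent_ge h0 h1 hq1
      calc min 1 (C * a) ≤ C * a := min_le_right _ _
        _ ≤ max 1 C * a := mul_le_mul_of_nonneg_right (le_max_right _ _) ha0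
        _ ≤ max 1 C * a ^ q := mul_le_mul_of_nonneg_left h2 (le_trans zero_le_one (le_max_left _ _))

section

variable {N : ℕ → ℕ} {Ω : ℕ → Type*} [∀ t, MeasurableSpace (Ω t)] {μ : ∀ t, Measure (Ω t)}
  [∀ t, IsProbabilityMeasure (μ t)]

/-- Central limit theorem for weakly dependent network arrays, in terms of characteristic
functions. -/
theorem tendsto_charFun_of_weaklyDependent (hN : Tendsto N atTop atTop)
    {G : ∀ t, SimpleGraph (Fin (N t))} {d : ℕ} (hDim : DimensionAtMost G d)
    (hadj : ∀ t i, ∃ j, (G t).Adj i j) {αhat : ℝ → ℝ} (hα : ∀ s, 0 ≤ s → 0 ≤ αhat s) {R C M : ℝ}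
    (hR : 2 ≤ R) {𝓕 : ∀ t, Fin (N t) → MeasurableSpace (Ω t)} {X : ∀ t, Fin (N t) → Ω t → ℝ}
    (hX : ∀ t, WeaklyDependent (μ t) (G t) (𝓕 t) (X t) M fun s => mixCoeff R C αhat s)
    (hfar : ∀ t r, 0 < r → ∀ i,
      MixingLE (𝓕 t i) (⨆ j ∈ (netBall (G t) i r)ᶜ, 𝓕 t j) (μ t) (mixCoeff R C αhat r))
    {S : ℕ → ℝ} (hvar : ∀ t, ∫ ω, (∑ i, X t i ω) ^ 2 ∂(μ t) = S t ^ 2)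
    (hwd : WeakDependenceCLT G d (thetaCoeff R αhat) S) (u : ℝ) :
    Tendsto (fun t => ∫ ω, Complex.exp (Complex.I * (u * ((∑ i, X t i ω) / S t) : ℝ)) ∂(μ t)) atTop
      (𝓝 (Complex.exp (-(u : ℂ) ^ 2 / 2))) := by
  obtain ⟨hSpos, r, hrpos, hrtop, p, hp, hk, hlast⟩ := hwd
  obtain ⟨c, hc⟩ := hDim
  have hM := (hX 0).bound_pos
  have hp0 : 0 < p := by linarith
  set θ : ℝ → ℝ := thetaCoeff R αhat with hθ
  have hθ0 := thetaCoeff_nonneg (R := R) hα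
  have hθ1 : ∀ s : ℝ, s ≤ 1 → θ s = 1 := fun s hs => by
    simp only [hθ, thetaCoeff]; rw [if_pos (by linarith)]
  set A : ℕ → ℕ → ℝ := fun k t => ∑ i, ∑ s ∈ Finset.range (N t), (s : ℝ) ^ (d - 1) *
        (((netShell (G t) i s).sup fun j =>
          (netBall (G t) i (r t) \ netOpenBall (G t) j s).card ^ k : ℕ) : ℝ) *
        θ s ^ (1 - (2 + (k : ℝ)) / p) with hA
  have hA1 := hk 1 (Or.inl rfl)
  have hA2 := hk 2 (Or.inr rfl)
  change Tendsto (fun t => 1 / S t ^ (2 + 1) * A 1 t) atTop (𝓝 0) at hA1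
  change Tendsto (fun t => 1 / S t ^ (2 + 2) * A 2 t) atTop (𝓝 0) at hA2
  set b : ℕ → ℝ := fun t => (N t : ℝ) ^ 2 * θ (r t) ^ (1 - 1 / p) / S t with hb
  set m : ℝ := max 1 C with hm
  have hm0 : 0 ≤ m := le_trans zero_le_one (le_max_left _ _)
  have hq : ∀ k : ℕ, k = 1 ∨ k = 2 → 0 < 1 - (2 + (k : ℝ)) / p ∧ 1 - (2 + (k : ℝ)) / p ≤ 1 := by
    intro k hk
    have hk2 : (k : ℝ) ≤ 2 := by rcases hk with rfl | rfl <;> norm_num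
    have : (2 + (k : ℝ)) / p < 1 := by rw [div_lt_one hp0]; linarith
    have h0 : 0 ≤ (2 + (k : ℝ)) / p := by positivity
    constructor <;> linarith
  have hN1 : ∀ᶠ t in atTop, 1 ≤ N t := hN.eventually_ge_atTop 1
  have hr1 : ∀ᶠ t in atTop, 1 ≤ r t := hrtop.eventually_ge_atTop 1
  have hpair : ∀ k : ℕ, k = 1 ∨ k = 2 → ∀ t, 1 ≤ r t →
      pairSum (G t) (r t) (fun s => mixCoeff R C αhat s) k ≤ m * (c + 2 ^ k) * A k t := by
    intro k hk t hrt
    obtain ⟨q0, q1⟩ := hq k hk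
    refine (pairSum_mono (fun s => mixCoeff_le hα q0 q1 (s : ℝ)) k).trans ?_
    rw [pairSum_const_mul, mul_assoc]
    refine mul_le_mul_of_nonneg_left ?_ hm0
    refine pairSum_le_weakDependence (θ := fun s : ℕ => θ s ^ (1 - (2 + (k : ℝ)) / p)) (hc t)
      (hadj t) hrt (fun s => Real.rpow_nonneg (hθ0 _) _) ?_ k
    rw [hθ1 _ (by simp), hθ1 _ (by simp)]
  -- the standard deviations tend to infinity, hence are eventually at least one
  have hS1 : ∀ᶠ t in atTop, 1 ≤ S t := by
    filter_upwards [hA1.eventually_lt_const (zero_lt_one' ℝ), hN1, hSpos] with t h1 h2 h3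
    have h4 : (N t : ℝ) ≤ A 1 t := card_le_weakDependence (hadj t)
      (θ := fun s : ℕ => θ s ^ (1 - (2 + ((1 : ℕ) : ℝ)) / p)) (fun s => Real.rpow_nonneg (hθ0 _) _)
      (by rw [hθ1 _ (by simp), Real.one_rpow])
    have h5 : (1 : ℝ) ≤ N t := by exact_mod_cast h2
    rw [one_div, inv_mul_lt_iff₀ (by positivity)] at h1
    by_contra hlt
    have : S t ^ (2 + 1) ≤ 1 := pow_le_one₀ h3.le (not_le.1 hlt).le
    linarith
  set ε : ℕ → ℝ := fun t => (8 * M * m + 4 * M ^ 2 * m) * b t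
    + 4 * M ^ 2 * √(m * (c + 2 ^ 2) * (1 / S t ^ (2 + 2) * A 2 t))
    + 24 * M ^ 3 * (m * (c + 2 ^ 1)) * (1 / S t ^ (2 + 1) * A 1 t) with hε
  have hεlim : Tendsto ε atTop (𝓝 0) := by
    have h1 := hlast.const_mul (8 * M * m + 4 * M ^ 2 * m)
    have h2 := ((hA2.const_mul (m * (c + 2 ^ 2))).sqrt).const_mul (4 * M ^ 2)
    have h3 := hA1.const_mul (24 * M ^ 3 * (m * (c + 2 ^ 1)))
    simpa only [mul_zero, Real.sqrt_zero, add_zero] using (h1.add h2).add h3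
  have hmain : ∀ᶠ t in atTop,
      ‖∫ ω, Complex.exp (Complex.I * (u * ((∑ i, X t i ω) / S t) : ℝ)) ∂(μ t)
        - Complex.exp (-(u : ℂ) ^ 2 / 2)‖
        ≤ ε t * ((1 + |u| + u ^ 2) * Real.exp (u ^ 2 / 2) * |u|) := by
    filter_upwards [hN1, hr1, hS1] with t hNt hrt hSt
    have hS0 : 0 < S t := by linarith
    have hn1 : (1 : ℝ) ≤ N t := by exact_mod_cast hNt
    set ρ := mixCoeff R C αhat (r t) with hρ
    have hp1 : 1 / p ≤ 1 := by rw [div_le_one hp0]; linarith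
    have hp2 : 1 / p < 1 := by rw [div_lt_one hp0]; linarith
    have hρle : ρ ≤ m * θ (r t) ^ (1 - 1 / p) :=
      mixCoeff_le hα (by linarith) (by linarith [one_div_pos.2 hp0]) _
    have hθr : 0 ≤ θ (r t) ^ (1 - 1 / p) := Real.rpow_nonneg (hθ0 _) _
    -- the contribution of distant units
    have hnb : (N t : ℝ) ^ 2 * ρ / S t ≤ m * b t := by
      calc (N t : ℝ) ^ 2 * ρ / S t ≤ (N t : ℝ) ^ 2 * (m * θ (r t) ^ (1 - 1 / p)) / S t := by gcongr
        _ = m * b t := by simp only [hb]; ring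
    have hρ0 : 0 ≤ ρ := (hfar t (r t) (hrpos t) ⟨0, hNt⟩).nonneg
    have t1 : 8 * N t * M * ρ / S t ≤ 8 * M * m * b t := by
      calc 8 * N t * M * ρ / S t ≤ 8 * (N t) ^ 2 * M * ρ / S t := by
            gcongr
            nlinarith
        _ = 8 * M * ((N t : ℝ) ^ 2 * ρ / S t) := by ring
        _ ≤ 8 * M * (m * b t) := by gcongr
        _ = _ := by ring
    have t2 : 4 * (N t) ^ 2 * M ^ 2 * ρ / S t ^ 2 ≤ 4 * M ^ 2 * m * b t := by
      calc 4 * (N t) ^ 2 * M ^ 2 * ρ / S t ^ 2 ≤ 4 * (N t) ^ 2 * M ^ 2 * ρ / S t := by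
            gcongr
            nlinarith
        _ = 4 * M ^ 2 * ((N t : ℝ) ^ 2 * ρ / S t) := by ring
        _ ≤ 4 * M ^ 2 * (m * b t) := by gcongr
        _ = _ := by ring
    have t3 : 4 * M ^ 2 * √(pairSum (G t) (r t) (fun s => mixCoeff R C αhat s) 2) / S t ^ 2
        ≤ 4 * M ^ 2 * √(m * (c + 2 ^ 2) * (1 / S t ^ (2 + 2) * A 2 t)) := by
      have : m * (c + 2 ^ 2) * (1 / S t ^ (2 + 2) * A 2 t)
          = m * (c + 2 ^ 2) * A 2 t / (S t ^ 2) ^ 2 := by ring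
      rw [this, Real.sqrt_div' _ (by positivity), Real.sqrt_sq (by positivity), ← mul_div_assoc]
      gcongr
      exact hpair 2 (Or.inr rfl) t hrt
    have t4 : 24 * M ^ 3 * pairSum (G t) (r t) (fun s => mixCoeff R C αhat s) 1 / S t ^ 3
        ≤ 24 * M ^ 3 * (m * (c + 2 ^ 1)) * (1 / S t ^ (2 + 1) * A 1 t) := by
      calc _ ≤ 24 * M ^ 3 * (m * (c + 2 ^ 1) * A 1 t) / S t ^ 3 := by
            gcongr
            exact hpair 1 (Or.inl rfl) t hrt
        _ = _ := by ring
    refine norm_integral_cexp_sub_gaussian_le (Z := fun ω => (∑ i, X t i ω) / S t)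
      ((hX t).measurable_sum.div_const _) (M := N t * M / S t) (fun ω => ?_) (fun v => ?_) u
    · rw [abs_div, abs_of_pos hS0]
      exact div_le_div_of_nonneg_right ((hX t).abs_sum_le _ ω) hS0.le
    · refine ((hX t).norm_stein_le (hfar t (r t) (hrpos t)) hS0 (hvar t) v).trans ?_
      rw [add_div]
      set x1 := 8 * N t * M * ρ / S t
      set x2 := 4 * (N t : ℝ) ^ 2 * M ^ 2 * ρ / S t ^ 2
      set x3 := 4 * M ^ 2 * √(pairSum (G t) (r t) (fun s => mixCoeff R C αhat s) 2) / S t ^ 2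
      set x4 := 24 * M ^ 3 * pairSum (G t) (r t) (fun s => mixCoeff R C αhat s) 1 / S t ^ 3
      have hx1 : 0 ≤ x1 := by positivity
      have hx2 : 0 ≤ x2 := by positivity
      have hx3 : 0 ≤ x3 := by positivity
      have hx4 : 0 ≤ x4 := div_nonneg (mul_nonneg (by positivity)
        (pairSum_nonneg (fun s => (hX t).tau_nonneg s) 1)) (by positivity)
      have hsum : x1 + x2 + x3 + x4 ≤ ε t := by
        simp only [hε]
        linarith
      have hv0 := abs_nonneg v
      have hv2 := sq_nonneg v
      calc x1 + |v| * (x2 + x3) + v ^ 2 * x4 ≤ (x1 + x2 + x3 + x4) * (1 + |v| + v ^ 2) := by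
            nlinarith [mul_nonneg hx1 hv0, mul_nonneg hx1 hv2, mul_nonneg hx2 hv2,
              mul_nonneg hx3 hv2, mul_nonneg hx4 hv0]
        _ ≤ ε t * (1 + |v| + v ^ 2) := by gcongr
  rw [tendsto_iff_norm_sub_tendsto_zero]
  refine squeeze_zero' (Eventually.of_forall fun t => norm_nonneg _) hmain ?_
  simpa using hεlim.mul_const ((1 + |u| + u ^ 2) * Real.exp (u ^ 2 / 2) * |u|)

/-- Slutsky's lemma for variables on varying probability spaces: convergence of the characteristic
functions of `A t` to that of the standard normal law carries over to variables `B t` with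
`B t - A t → 0` in probability. -/
theorem tendstoInDistribution_of_charFun {A B : ∀ t, Ω t → ℝ} (hA : ∀ t, AEMeasurable (A t) (μ t))
    (hB : ∀ t, AEMeasurable (B t) (μ t))
    (hlim : ∀ u : ℝ, Tendsto (fun t => ∫ ω, Complex.exp (Complex.I * (u * A t ω : ℝ)) ∂(μ t)) atTop
      (𝓝 (Complex.exp (-(u : ℂ) ^ 2 / 2))))
    (hAB : ∀ δ : ℝ, 0 < δ →
      Tendsto (fun t => (μ t).real {ω | δ < |B t ω - A t ω|}) atTop (𝓝 0)) :
    TendstoInDistribution B atTop (id : ℝ → ℝ) μ (gaussianReal 0 1) := by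
  refine ⟨hB, aemeasurable_id, ProbabilityMeasure.tendsto_of_tendsto_charFun fun u => ?_⟩
  simp only [ProbabilityMeasure.coe_mk, Measure.map_id]
  rw [charFun_gaussianReal]
  have e0 : Complex.exp ((u : ℂ) * (0 : ℝ) * Complex.I - ((1 : NNReal) : ℂ) * (u : ℂ) ^ 2 / 2)
      = Complex.exp (-(u : ℂ) ^ 2 / 2) := by
    congr 1; simp; ring
  rw [e0]
  have e1 : ∀ t, charFun ((μ t).map (B t)) u
      = ∫ ω, Complex.exp (Complex.I * (u * B t ω : ℝ)) ∂(μ t) := fun t => by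
    rw [charFun_apply_real, integral_map (hB t) (by fun_prop)]
    refine integral_congr_ae (ae_of_all _ fun ω => ?_)
    simp only
    congr 1
    push_cast; ring
  simp_rw [e1]
  have hmeas : ∀ {t} {f : Ω t → ℝ}, AEMeasurable f (μ t) →
      AEStronglyMeasurable (fun ω => Complex.exp (Complex.I * (u * f ω : ℝ))) (μ t) :=
    fun hf => (by fun_prop : AEMeasurable _ _).aestronglyMeasurable
  have hint : ∀ {t} {f : Ω t → ℝ}, AEMeasurable f (μ t) →
      Integrable (fun ω => Complex.exp (Complex.I * (u * f ω : ℝ))) (μ t) :=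
    fun hf => Integrable.of_bound (hmeas hf) 1
      (ae_of_all _ fun ω => (Complex.norm_exp_I_mul_ofReal _).le)
  have hdiff : Tendsto (fun t => ∫ ω, Complex.exp (Complex.I * (u * B t ω : ℝ)) ∂(μ t)
      - ∫ ω, Complex.exp (Complex.I * (u * A t ω : ℝ)) ∂(μ t)) atTop (𝓝 0) := by
    rw [Metric.tendsto_atTop]
    intro η hη
    -- split according to whether `|B - A|` exceeds `δ`
    set δ : ℝ := η / (4 * (|u| + 1)) with hδ
    have hu1 : 0 < |u| + 1 := by positivity
    have hδ0 : 0 < δ := by positivity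
    obtain ⟨T, hT⟩ := (Metric.tendsto_atTop.1 (hAB δ hδ0)) (η / 8) (by positivity)
    refine ⟨T, fun t ht => ?_⟩
    have hset : NullMeasurableSet {ω | δ < |B t ω - A t ω|} (μ t) :=
      nullMeasurableSet_lt aemeasurable_const ((hB t).sub (hA t)).abs
    have hPr : (μ t).real {ω | δ < |B t ω - A t ω|} < η / 8 := by
      have := hT t ht
      rwa [Real.dist_0_eq_abs, abs_of_nonneg measureReal_nonneg] at this
    have hpt : ∀ ω, ‖Complex.exp (Complex.I * (u * B t ω : ℝ))
        - Complex.exp (Complex.I * (u * A t ω : ℝ))‖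
        ≤ |u| * δ + Set.indicator {ω | δ < |B t ω - A t ω|} (fun _ => (2 : ℝ)) ω := by
      intro ω
      by_cases hω : δ < |B t ω - A t ω|
      · rw [Set.indicator_of_mem (show ω ∈ {ω | δ < |B t ω - A t ω|} from hω)]
        refine (norm_sub_le _ _).trans ?_
        rw [Complex.norm_exp_I_mul_ofReal, Complex.norm_exp_I_mul_ofReal]
        have : 0 ≤ |u| * δ := by positivity
        linarith
      · rw [Set.indicator_of_notMem (show ω ∉ {ω | δ < |B t ω - A t ω|} from hω), add_zero]
        have e2 : Complex.exp (Complex.I * (u * B t ω : ℝ))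
            - Complex.exp (Complex.I * (u * A t ω : ℝ))
            = Complex.exp (Complex.I * (u * A t ω : ℝ))
              * (Complex.exp (Complex.I * (u * (B t ω - A t ω) : ℝ)) - 1) := by
          rw [mul_sub, ← Complex.exp_add, mul_one]
          congr 2
          push_cast; ring
        rw [e2, norm_mul, Complex.norm_exp_I_mul_ofReal, one_mul]
        refine (Real.norm_exp_I_mul_ofReal_sub_one_le).trans ?_
        rw [Real.norm_eq_abs, abs_mul]
        exact mul_le_mul_of_nonneg_left (not_lt.1 hω) (abs_nonneg _)
    rw [dist_zero_right, ← integral_sub (hint (hB t)) (hint (hA t))]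
    have hind : Integrable (Set.indicator {ω | δ < |B t ω - A t ω|} (fun _ => (2 : ℝ))) (μ t) :=
      (integrable_const (2 : ℝ)).indicator₀ hset
    refine lt_of_le_of_lt (norm_integral_le_of_norm_le ((integrable_const (|u| * δ)).add hind)
      (ae_of_all _ hpt)) ?_
    simp only [Pi.add_apply]
    rw [integral_add (integrable_const _) hind, integral_indicator₀ hset]
    simp only [integral_const, probReal_univ, measureReal_restrict_apply_univ, smul_eq_mul,
      one_mul]
    have : |u| * δ ≤ η / 4 := by
      rw [hδ, ← mul_div_assoc, div_le_div_iff₀ (by positivity) (by norm_num)]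
      nlinarith [abs_nonneg u]
    linarith
  simpa using hdiff.add (hlim u)

end

/-! ### The doubly robust score -/

section Score

variable {Ω T : Type*} [MeasurableSpace Ω] {μ : Measure Ω}

lemma setIntegral_eq_measureReal_mul_integral_cond [IsFiniteMeasure μ] (f : Ω → ℝ)
    (A : Set Ω) : ∫ ω in A, f ω ∂μ = μ.real A * ∫ ω, f ω ∂(cond μ A) := by
  by_cases h0 : μ A = 0
  · simp [Measure.restrict_eq_zero.2 h0, Measure.real, h0]
  · rw [ProbabilityTheory.cond, integral_smul_measure, smul_eq_mul, ENNReal.toReal_inv, ← mul_assoc]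
    have : μ.real A ≠ 0 := by simpa [Measure.real, ENNReal.toReal_eq_zero_iff] using h0
    rw [show (μ A).toReal = μ.real A from rfl, mul_inv_cancel₀ this, one_mul]

/-- A measurable function that is bounded almost surely has bounded conditional means, also when
the conditioning event is null, where the conditional mean is zero by convention. -/
lemma abs_integral_cond_le [IsFiniteMeasure μ] {f : Ω → ℝ} {B : ℝ} (hB : 0 ≤ B)
    (hf : ∀ᵐ ω ∂μ, |f ω| ≤ B) (A : Set Ω) : |∫ ω, f ω ∂(cond μ A)| ≤ B := by
  by_cases h0 : μ A = 0
  · rw [cond_eq_zero_of_meas_eq_zero h0]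
    simpa using hB
  · have := cond_isProbabilityMeasure h0
    have h1 : ∀ᵐ ω ∂(cond μ A), ‖f ω‖ ≤ B := cond_absolutelyContinuous.ae_le hf
    simpa using norm_integral_le_of_norm_le_const h1

variable [Fintype T] [MeasurableSpace T] [MeasurableSingletonClass T]

/-- The mean of the doubly robust score, for a finite covariate `V`. In each cell `{V = v}` the
inverse probability terms have mean zero and the regression term compares the outcome of the treated
with that of the controls; by parallel trends the latter is the mean of the untreated outcome change
`U v` of the treated. -/
lemma integral_drScore [IsProbabilityMeasure μ] {D : Ω → Bool} (hD : Measurable D)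
    {V : Ω → T} (hV : Measurable V) {Y : Ω → ℝ} (hY : Integrable Y μ) {U : T → Ω → ℝ}
    (hU : ∀ v, Integrable (U v) μ) {p : ℝ} (hp : p = μ.real {ω | D ω = true}) {e : T → ℝ}
    (he : ∀ v, e v = (cond μ {ω | V ω = v}).real {ω | D ω = true})
    (he01 : ∀ v, μ {ω | V ω = v} ≠ 0 → 0 < e v ∧ e v < 1) {m : Bool → T → ℝ}
    (hm : ∀ a v, m a v = ∫ ω, Y ω ∂(cond μ {ω | D ω = a ∧ V ω = v}))
    (hcons : ∀ ω, D ω = false → U (V ω) ω = Y ω)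
    (htrend : ∀ v, (∀ c, μ {ω | D ω = c ∧ V ω = v} ≠ 0) →
      ∫ ω, U v ω ∂(cond μ {ω | D ω = true ∧ V ω = v})
        = ∫ ω, U v ω ∂(cond μ {ω | D ω = false ∧ V ω = v}))
    (hint : Integrable (fun ω => drScore (if D ω then 1 else 0) p (e (V ω)) (m true (V ω))
      (m false (V ω)) (Y ω)) μ) :
    ∫ ω, drScore (if D ω then 1 else 0) p (e (V ω)) (m true (V ω)) (m false (V ω)) (Y ω) ∂μ
      = ∫ ω, (Y ω - U (V ω) ω) ∂(cond μ {ω | D ω = true}) := by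
  classical
  have hDs : ∀ a, MeasurableSet {ω | D ω = a} := fun a => hD (measurableSet_singleton a)
  have hVs : ∀ v, MeasurableSet {ω | V ω = v} := fun v => hV (measurableSet_singleton v)
  have hDV : ∀ a v, MeasurableSet {ω | D ω = a ∧ V ω = v} := fun a v => (hDs a).inter (hVs v)
  have hUV : Integrable (fun ω => U (V ω) ω) μ := by
    have : (fun ω => U (V ω) ω) = fun ω => ∑ v, Set.indicator {ω | V ω = v} (U v) ω := by
      funext ω
      rw [Finset.sum_eq_single (V ω) (fun v _ hv => Set.indicator_of_notMem (fun h => hv h.symm) _)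
        (by simp)]
      rw [Set.indicator_of_mem (show ω ∈ {ω' | V ω' = V ω} from rfl)]
    rw [this]
    exact integrable_finsetSum _ fun v _ => (hU v).indicator (hVs v)
  have hsplit : ∀ (f : Ω → ℝ) (A : Set Ω), MeasurableSet A → Integrable f μ →
      ∫ ω in A, f ω ∂μ = ∑ v, ∫ ω in A ∩ {ω | V ω = v}, f ω ∂μ := by
    intro f A hA hf
    have hu : A = ⋃ v, A ∩ {ω | V ω = v} := by
      ext ω; simp
    conv_lhs => rw [hu]
    exact integral_iUnion_fintype (fun v => hA.inter (hVs v)) (fun v w hvw =>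
      Set.disjoint_left.2 fun ω h1 h2 => hvw (h1.2.symm.trans h2.2)) fun v => hf.integrableOn
  set π := μ.real {ω | D ω = true} with hπ
  by_cases hp0 : π = 0
  · -- no unit is treated: both sides vanish
    have hnull : μ {ω | D ω = true} = 0 := by
      simpa [hπ, Measure.real, ENNReal.toReal_eq_zero_iff] using hp0
    rw [cond_eq_zero_of_meas_eq_zero hnull, hp, hp0]
    simp [drScore]
  have hrhs : ∫ ω, (Y ω - U (V ω) ω) ∂(cond μ {ω | D ω = true})
      = π⁻¹ * ∑ v, ∫ ω in {ω | D ω = true ∧ V ω = v}, (Y ω - U (V ω) ω) ∂μ := by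
    have h1 := setIntegral_eq_measureReal_mul_integral_cond (μ := μ)
      (fun ω => Y ω - U (V ω) ω) {ω | D ω = true}
    rw [hsplit (fun ω => Y ω - U (V ω) ω) _ (hDs true) (hY.sub hUV), ← hπ] at h1
    rw [eq_inv_mul_iff_mul_eq₀ hp0, ← h1]
    rfl
  have hlhs := hsplit _ Set.univ MeasurableSet.univ hint
  rw [Measure.restrict_univ] at hlhs
  rw [hlhs, hrhs, Finset.mul_sum]
  refine Finset.sum_congr rfl fun v _ => ?_
  rw [Set.univ_inter]
  -- masses and integrals over the two halves of the cell
  set P := μ.real {ω | V ω = v} with hP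
  have hcell : {ω | V ω = v} = {ω | D ω = true ∧ V ω = v} ∪ {ω | D ω = false ∧ V ω = v} := by
    ext ω
    cases h : D ω <;> simp [h]
  have hdisj : Disjoint {ω | D ω = true ∧ V ω = v} {ω | D ω = false ∧ V ω = v} :=
    Set.disjoint_left.2 fun ω h1 h2 => by simpa using h1.1.symm.trans h2.1
  have hP1 : μ.real {ω | D ω = true ∧ V ω = v} = e v * P := by
    rw [he, hP, measureReal_def, measureReal_def, measureReal_def, ← ENNReal.toReal_mul,
      cond_mul_eq_inter (hVs v)]
    congr 2
    ext ω
    exact and_comm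
  have hP0 : μ.real {ω | D ω = false ∧ V ω = v} = (1 - e v) * P := by
    have : P = μ.real {ω | D ω = true ∧ V ω = v} + μ.real {ω | D ω = false ∧ V ω = v} := by
      rw [hP, hcell, measureReal_union hdisj (hDV false v)]
    rw [hP1] at this
    linarith
  by_cases h0 : μ {ω | V ω = v} = 0
  · have h1 : μ {ω | D ω = true ∧ V ω = v} = 0 := measure_mono_null (fun ω h => h.2) h0
    rw [Measure.restrict_eq_zero.2 h0, Measure.restrict_eq_zero.2 h1]
    simp
  obtain ⟨he0, he1⟩ := he01 v h0
  have hPpos : 0 < P := by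
    rw [hP, measureReal_def]; exact ENNReal.toReal_pos h0 (measure_ne_top _ _)
  have hpos : ∀ c, μ {ω | D ω = c ∧ V ω = v} ≠ 0 := by
    intro c hc
    have hz : μ.real {ω | D ω = c ∧ V ω = v} = 0 := by simp [measureReal_def, hc]
    cases c
    · rw [hP0] at hz; nlinarith
    · rw [hP1] at hz; nlinarith
  have hm1 : ∫ ω in {ω | D ω = true ∧ V ω = v}, Y ω ∂μ = e v * P * m true v := by
    rw [setIntegral_eq_measureReal_mul_integral_cond Y, hP1, hm]
  have hm0 : ∫ ω in {ω | D ω = false ∧ V ω = v}, Y ω ∂μ = (1 - e v) * P * m false v := by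
    rw [setIntegral_eq_measureReal_mul_integral_cond Y, hP0, hm]
  have hU1 : ∫ ω in {ω | D ω = true ∧ V ω = v}, U (V ω) ω ∂μ = e v * P * m false v := by
    have h1 : ∫ ω in {ω | D ω = true ∧ V ω = v}, U (V ω) ω ∂μ
        = ∫ ω in {ω | D ω = true ∧ V ω = v}, U v ω ∂μ :=
      setIntegral_congr_fun (hDV true v) fun ω h => by
        rw [h.2]
    have h2 : ∫ ω in {ω | D ω = false ∧ V ω = v}, U v ω ∂μ
        = ∫ ω in {ω | D ω = false ∧ V ω = v}, Y ω ∂μ :=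
      setIntegral_congr_fun (hDV false v) fun ω h => by
        rw [← hcons ω h.1, h.2]
    rw [setIntegral_eq_measureReal_mul_integral_cond,
      setIntegral_eq_measureReal_mul_integral_cond, ← hm, hP0] at h2
    have h3 := mul_left_cancel₀ (mul_pos (by linarith) hPpos).ne' h2
    rw [h1, setIntegral_eq_measureReal_mul_integral_cond, htrend v hpos, hP1, h3]
  have hone : ∀ c, ∫ _ω in {ω | D ω = c ∧ V ω = v}, (1 : ℝ) ∂μ = μ.real {ω | D ω = c ∧ V ω = v} :=
    fun c => by simp
  have hl1 : ∫ ω in {ω | D ω = true ∧ V ω = v},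
      drScore (if D ω then 1 else 0) p (e (V ω)) (m true (V ω)) (m false (V ω)) (Y ω) ∂μ
      = e v * P * (e v / p * (m true v - m false v)) := by
    have h1 : ∫ ω in {ω | D ω = true ∧ V ω = v},
        drScore (if D ω then 1 else 0) p (e (V ω)) (m true (V ω)) (m false (V ω)) (Y ω) ∂μ
        = ∫ ω in {ω | D ω = true ∧ V ω = v},
          (p⁻¹ * Y ω + (e v / p * (m true v - m false v) - p⁻¹ * m true v) * 1) ∂μ :=
      setIntegral_congr_fun (hDV true v) fun ω h => by
        simp only [h.1, h.2, drScore, if_true]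
        ring
    rw [h1, integral_add (hY.integrableOn.const_mul _) ((integrable_const _).const_mul _),
      integral_const_mul, integral_const_mul, hm1, hone, hP1]
    ring
  have hl0 : ∫ ω in {ω | D ω = false ∧ V ω = v},
      drScore (if D ω then 1 else 0) p (e (V ω)) (m true (V ω)) (m false (V ω)) (Y ω) ∂μ
      = (1 - e v) * P * (e v / p * (m true v - m false v)) := by
    have h1 : ∫ ω in {ω | D ω = false ∧ V ω = v},
        drScore (if D ω then 1 else 0) p (e (V ω)) (m true (V ω)) (m false (V ω)) (Y ω) ∂μ
        = ∫ ω in {ω | D ω = false ∧ V ω = v},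
          (-(e v / (p * (1 - e v))) * Y ω
            + (e v / p * (m true v - m false v) + e v / (p * (1 - e v)) * m false v) * 1) ∂μ :=
      setIntegral_congr_fun (hDV false v) fun ω h => by
        simp only [h.1, h.2, drScore, Bool.false_eq_true, if_false]
        ring
    rw [h1, integral_add (hY.integrableOn.const_mul _) ((integrable_const _).const_mul _),
      integral_const_mul, integral_const_mul, hm0, hone, hP0]
    ring
  conv_lhs => rw [hcell]
  rw [setIntegral_union hdisj (hDV false v) hint.integrableOn hint.integrableOn, hl1, hl0,
    integral_sub hY.integrableOn hUV.integrableOn, hm1, hU1, hp]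
  ring

end Score

/-! ### Sensitivity of the doubly robust score -/

lemma abs_mul_sub_mul_le {x x' y y' A B a b δ : ℝ} (hx : |x| ≤ A) (hy' : |y'| ≤ B)
    (hxx : |x' - x| ≤ a * δ) (hyy : |y' - y| ≤ b * δ) :
    |x' * y' - x * y| ≤ (a * B + A * b) * δ := by
  have e : x' * y' - x * y = (x' - x) * y' + x * (y' - y) := by ring
  have hA : 0 ≤ A := (abs_nonneg _).trans hx
  have h1 : |x' - x| * |y'| ≤ a * δ * B :=
    mul_le_mul hxx hy' (abs_nonneg _) ((abs_nonneg _).trans hxx)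
  have h2 : |x| * |y' - y| ≤ A * (b * δ) := mul_le_mul hx hyy (abs_nonneg _) hA
  rw [e]
  refine (abs_add_le _ _).trans ?_
  rw [abs_mul, abs_mul]
  nlinarith

lemma abs_inv_sub_inv_le {x x' c : ℝ} (hc : 0 < c) (hx : c ≤ x) (hx' : c ≤ x') :
    |x'⁻¹ - x⁻¹| ≤ c⁻¹ ^ 2 * |x' - x| := by
  have h1 : 0 < x := by linarith
  have h2 : 0 < x' := by linarith
  rw [inv_sub_inv h2.ne' h1.ne', abs_div, abs_sub_comm, abs_of_pos (mul_pos h2 h1), inv_pow,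
    div_eq_inv_mul]
  gcongr
  nlinarith

/-- A bound for the doubly robust score under overlap. -/
lemma abs_drScore_le {lo hi B d p e m₁ m₀ y : ℝ} (hlo : 0 < lo) (hhi : hi < 1)
    (hd : d = 0 ∨ d = 1) (hp : p ∈ Set.Icc lo hi) (he : e ∈ Set.Icc lo hi) (hm₁ : |m₁| ≤ B)
    (hm₀ : |m₀| ≤ B) (hy : |y| ≤ B) : |drScore d p e m₁ m₀ y| ≤ 4 * B * lo⁻¹ * (1 - hi)⁻¹ := by
  obtain ⟨hp1, hp2⟩ := hp
  obtain ⟨he1, he2⟩ := he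
  have hp0 : 0 < p := by linarith
  have hepos : 0 < e := by linarith
  have he0 : 0 < 1 - e := by linarith
  have hB : 0 ≤ B := (abs_nonneg _).trans hy
  have hh0 : 0 < 1 - hi := by linarith
  have hh1 : 1 ≤ (1 - hi)⁻¹ := (one_le_inv₀ hh0).2 (by linarith)
  have hinv : p⁻¹ ≤ lo⁻¹ := by gcongr
  have hinve : (1 - e)⁻¹ ≤ (1 - hi)⁻¹ := by gcongr
  have hpos : 0 < p⁻¹ := by positivity
  have hl : 0 < lo⁻¹ := by positivity
  have h10 : |m₁ - m₀| ≤ 2 * B := (abs_sub _ _).trans (by linarith)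
  have hreg : |e / p * (m₁ - m₀)| ≤ 2 * B * lo⁻¹ * (1 - hi)⁻¹ := by
    rw [abs_mul, abs_of_pos (by positivity : 0 < e / p), div_eq_mul_inv]
    calc e * p⁻¹ * |m₁ - m₀| ≤ 1 * lo⁻¹ * (2 * B) := by
          gcongr
          linarith
      _ = 2 * B * lo⁻¹ * 1 := by ring
      _ ≤ _ := by gcongr
  rcases hd with rfl | rfl
  · have h0 : |y - m₀| ≤ 2 * B := (abs_sub _ _).trans (by linarith)
    have h2 : |e / (p * (1 - e)) * (y - m₀)| ≤ 2 * B * lo⁻¹ * (1 - hi)⁻¹ := by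
      rw [abs_mul, abs_of_pos (by positivity : 0 < e / (p * (1 - e))), div_eq_mul_inv, mul_inv]
      calc e * (p⁻¹ * (1 - e)⁻¹) * |y - m₀| ≤ 1 * (lo⁻¹ * (1 - hi)⁻¹) * (2 * B) := by
            gcongr
            linarith
        _ = _ := by ring
    have e3 : drScore 0 p e m₁ m₀ y = e / p * (m₁ - m₀) - e / (p * (1 - e)) * (y - m₀) := by
      simp only [drScore]; ring
    rw [e3]
    exact (abs_sub _ _).trans (by linarith)
  · have h1 : |y - m₁| ≤ 2 * B := (abs_sub _ _).trans (by linarith)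
    have h2 : |p⁻¹ * (y - m₁)| ≤ 2 * B * lo⁻¹ * (1 - hi)⁻¹ := by
      rw [abs_mul, abs_of_pos hpos]
      calc p⁻¹ * |y - m₁| ≤ lo⁻¹ * (2 * B) := by gcongr
        _ = 2 * B * lo⁻¹ * 1 := by ring
        _ ≤ _ := by gcongr
    have e3 : drScore 1 p e m₁ m₀ y = p⁻¹ * (y - m₁) + e / p * (m₁ - m₀) := by
      simp only [drScore]; ring
    rw [e3]
    exact (abs_add_le _ _).trans (by linarith)

/-- Under overlap the doubly robust score is Lipschitz in the nuisance parameters near their true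
values. -/
lemma exists_abs_drScore_sub_le {lo hi B : ℝ} (hlo : 0 < lo) (hhi : hi < 1) (hB : 0 ≤ B) :
    ∃ C δ : ℝ, 0 < C ∧ 0 < δ ∧ ∀ d p e m₁ m₀ y p' e' m₁' m₀' : ℝ, (d = 0 ∨ d = 1) →
      p ∈ Set.Icc lo hi → e ∈ Set.Icc lo hi → |m₁| ≤ B → |m₀| ≤ B → |y| ≤ B →
      |p' - p| + |e' - e| + |m₁' - m₁| + |m₀' - m₀| ≤ δ →
      |drScore d p' e' m₁' m₀' y - drScore d p e m₁ m₀ y|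
        ≤ C * (|p' - p| + |e' - e| + |m₁' - m₁| + |m₀' - m₀|) := by
  -- in the `δ`-neighbourhood, `p'` and `1 - e'` stay above `c`
  set c : ℝ := min lo (1 - hi) / 2 with hc
  have hmin : 0 < min lo (1 - hi) := lt_min hlo (by linarith)
  have hc0 : 0 < c := by positivity
  have hcl : 2 * c ≤ lo := by rw [hc]; linarith [min_le_left lo (1 - hi)]
  have hch : 2 * c ≤ 1 - hi := by rw [hc]; linarith [min_le_right lo (1 - hi)]
  set k : ℝ := c⁻¹ with hk
  have hk0 : 0 < k := by positivity
  set b : ℝ := 2 * B + 2 with hb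
  -- the Lipschitz constants of `e / p`, `(e / p) (1 - e)⁻¹` and the whole score
  set c₁ : ℝ := 1 * k + 1 * k ^ 2 with hc₁
  set c₂ : ℝ := c₁ * k + k * k ^ 2 with hc₂
  refine ⟨k ^ 2 * b + k * 1 + (c₂ * b + k * k * 1) + (c₁ * b + k * 2), min c 1, by positivity,
    lt_min hc0 one_pos, ?_⟩
  intro d p e m₁ m₀ y p' e' m₁' m₀' hd hp he hm₁ hm₀ hy hsmall
  obtain ⟨hp1, hp2⟩ := hp
  obtain ⟨he1, he2⟩ := he
  set E : ℝ := |p' - p| + |e' - e| + |m₁' - m₁| + |m₀' - m₀| with hE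
  have n1 := abs_nonneg (p' - p)
  have n2 := abs_nonneg (e' - e)
  have n3 := abs_nonneg (m₁' - m₁)
  have n4 := abs_nonneg (m₀' - m₀)
  have hEc : E ≤ c := hsmall.trans (min_le_left _ _)
  have hE1 : E ≤ 1 := hsmall.trans (min_le_right _ _)
  have hE0 : 0 ≤ E := by positivity
  have hpE : |p' - p| ≤ E := by linarith
  have heE : |e' - e| ≤ E := by linarith
  have hm1E : |m₁' - m₁| ≤ E := by linarith
  have hm0E : |m₀' - m₀| ≤ E := by linarith
  have ap := abs_le.1 hpE
  have ae := abs_le.1 heE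
  have hpc' : c ≤ p' := by linarith
  have hpc : c ≤ p := by linarith
  have hec : c ≤ 1 - e := by linarith
  have hec' : c ≤ 1 - e' := by linarith
  have he0' : 0 ≤ e' := by linarith
  have hinv : ∀ x, c ≤ x → |x⁻¹| ≤ k := fun x hx => by
    rw [abs_of_pos (inv_pos.2 (by linarith)), hk]
    gcongr
  have hpinv : |p'⁻¹ - p⁻¹| ≤ k ^ 2 * E :=
    (abs_inv_sub_inv_le hc0 hpc hpc').trans (by gcongr)
  have heinv : |(1 - e')⁻¹ - (1 - e)⁻¹| ≤ k ^ 2 * E := by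
    refine (abs_inv_sub_inv_le hc0 hec hec').trans ?_
    rw [show (1 - e') - (1 - e) = -(e' - e) by ring, abs_neg]
    gcongr
  have hratio : |e' * p'⁻¹ - e * p⁻¹| ≤ c₁ * E :=
    abs_mul_sub_mul_le (by rw [abs_of_pos] <;> linarith) (hinv p' hpc')
      (by rw [one_mul]; exact heE) hpinv
  have hratio_le : ∀ q f, c ≤ q → 0 ≤ f → c ≤ 1 - f → |f * q⁻¹| ≤ k := fun q f hq hf hf1 => by
    rw [abs_mul, abs_of_nonneg hf]
    calc f * |q⁻¹| ≤ 1 * k := by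
          gcongr
          · linarith
          · exact hinv q hq
      _ = k := one_mul k
  have hodds : |e' * p'⁻¹ * (1 - e')⁻¹ - e * p⁻¹ * (1 - e)⁻¹| ≤ c₂ * E :=
    abs_mul_sub_mul_le (hratio_le p e hpc (by linarith) hec) (hinv _ hec') hratio heinv
  have hbm : ∀ x x', |x| ≤ B → |x' - x| ≤ E → |y - x'| ≤ b := fun x x' hx hxx => by
    have a1 := abs_le.1 hx
    have a2 := abs_le.1 hxx
    have a3 := abs_le.1 hy
    rw [abs_le]; constructor <;> linarith
  have hdm : ∀ x x', |x' - x| ≤ E → |(y - x') - (y - x)| ≤ 1 * E := fun x x' hxx => by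
    rw [show (y - x') - (y - x) = -(x' - x) by ring, abs_neg, one_mul]; exact hxx
  have hreg : |e' * p'⁻¹ * (m₁' - m₀') - e * p⁻¹ * (m₁ - m₀)| ≤ (c₁ * b + k * 2) * E := by
    refine abs_mul_sub_mul_le (hratio_le p e hpc (by linarith) hec) ?_ hratio ?_
    · have a1 := abs_le.1 hm₁
      have a2 := abs_le.1 hm₀
      have a3 := abs_le.1 hm1E
      have a4 := abs_le.1 hm0E
      rw [abs_le]; constructor <;> linarith
    · rw [show (m₁' - m₀') - (m₁ - m₀) = (m₁' - m₁) - (m₀' - m₀) by ring]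
      exact (abs_sub _ _).trans (by linarith)
  have h1 : |p'⁻¹ * (y - m₁') - p⁻¹ * (y - m₁)| ≤ (k ^ 2 * b + k * 1) * E :=
    abs_mul_sub_mul_le (hinv p hpc) (hbm m₁ m₁' hm₁ hm1E) hpinv (hdm m₁ m₁' hm1E)
  have h0 : |e' * p'⁻¹ * (1 - e')⁻¹ * (y - m₀') - e * p⁻¹ * (1 - e)⁻¹ * (y - m₀)|
      ≤ (c₂ * b + k * k * 1) * E := by
    refine abs_mul_sub_mul_le ?_ (hbm m₀ m₀' hm₀ hm0E) hodds (hdm m₀ m₀' hm0E)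
    rw [abs_mul]
    exact mul_le_mul (hratio_le p e hpc (by linarith) hec) (hinv _ hec) (abs_nonneg _) hk0.le
  have p1 : 0 ≤ (k ^ 2 * b + k * 1) * E := (abs_nonneg _).trans h1
  have p0 : 0 ≤ (c₂ * b + k * k * 1) * E := (abs_nonneg _).trans h0
  rcases hd with rfl | rfl
  · have e3 : drScore 0 p' e' m₁' m₀' y - drScore 0 p e m₁ m₀ y
        = (e' * p'⁻¹ * (m₁' - m₀') - e * p⁻¹ * (m₁ - m₀))
          - (e' * p'⁻¹ * (1 - e')⁻¹ * (y - m₀') - e * p⁻¹ * (1 - e)⁻¹ * (y - m₀)) := by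
      simp only [drScore, div_eq_mul_inv, mul_inv]; ring
    rw [e3]
    refine (abs_sub _ _).trans ?_
    linarith
  · have e3 : drScore 1 p' e' m₁' m₀' y - drScore 1 p e m₁ m₀ y
        = (e' * p'⁻¹ * (m₁' - m₀') - e * p⁻¹ * (m₁ - m₀))
          + (p'⁻¹ * (y - m₁') - p⁻¹ * (y - m₁)) := by
      simp only [drScore, div_eq_mul_inv]; ring
    rw [e3]
    refine (abs_add_le _ _).trans ?_
    linarith

/-! ### Averages of local scores -/

lemma mixingLE_one {Ω : Type*} (m₁ m₂ : MeasurableSpace Ω) [MeasurableSpace Ω]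
    (μ : Measure Ω) [IsProbabilityMeasure μ] : MixingLE m₁ m₂ μ 1 := fun A B _ _ => by
  have h1 := measureReal_nonneg (μ := μ) (s := A)
  have h2 := measureReal_nonneg (μ := μ) (s := B)
  have h4 := measureReal_nonneg (μ := μ) (s := A ∩ B)
  have h5 : μ.real A ≤ 1 := measureReal_le_one
  have h6 : μ.real B ≤ 1 := measureReal_le_one
  have h7 : μ.real (A ∩ B) ≤ 1 := measureReal_le_one
  rw [abs_le]
  constructor <;> nlinarith [mul_nonneg h1 h2]

lemma abs_le_alphaCoeff {Ω : Type*} {m₁ m₂ : MeasurableSpace Ω} [MeasurableSpace Ω]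
    {μ : Measure Ω} [IsProbabilityMeasure μ] {A B : Set Ω} (hA : MeasurableSet[m₁] A)
    (hB : MeasurableSet[m₂] B) :
    |μ.real (A ∩ B) - μ.real A * μ.real B| ≤ alphaCoeff μ m₁ m₂ := by
  refine le_csSup ⟨1, ?_⟩ ⟨A, B, hA, hB, rfl⟩
  rintro _ ⟨A, B, hA, hB, rfl⟩
  exact mixingLE_one m₁ m₂ μ A B hA hB

section Array

variable {L : ℕ} {N : ℕ → ℕ} {Ω 𝓔 : ℕ → Type*} [∀ t, MeasurableSpace (Ω t)]
  [∀ t, MeasurableSpace (𝓔 t)] {μ : ∀ t, Measure (Ω t)} [∀ t, IsProbabilityMeasure (μ t)]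
  {P : ∀ t, NetworkDID L (N t) (Ω t) (𝓔 t)}

lemma NetworkDID.measurable_x {n : ℕ} {Ω 𝓔 : Type*} [MeasurableSpace Ω] [MeasurableSpace 𝓔]
    (P : NetworkDID L n Ω 𝓔) (i : Fin n) : Measurable (P.x i) :=
  (P.measurable_Y1 i).prodMk ((P.measurable_D i).prodMk (P.measurable_ε i))

lemma NetworkDID.sigmaAlg_le {n : ℕ} {Ω 𝓔 : Type*} {m0 : MeasurableSpace Ω} [MeasurableSpace 𝓔]
    (P : NetworkDID L n Ω 𝓔) (H : Finset (Fin n)) : P.sigmaAlg H ≤ m0 :=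
  iSup₂_le fun i _ => (P.measurable_x i).comap_le

lemma AlphaMixing.exists_mixingLE {αhat : ℝ → ℝ} (hMix : AlphaMixing P μ αhat) {κ : ℕ}
    {Q : ∀ t, Fin (N t) → Finset (Fin (N t))}
    (hQ : ∀ t i, ∀ j ∈ Q t i, (P t).G.edist i j ≤ (κ : ℕ∞)) :
    ∃ C : ℝ, 0 ≤ C ∧ ∀ t (H H' : Finset (Fin (N t))) (s : ℝ), 0 ≤ s →
      (∀ i ∈ H, ∀ j ∈ H', (⌈s⌉₊ : ℕ∞) ≤ (P t).G.edist i j) →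
      MixingLE (⨆ i ∈ H, (P t).sigmaAlg (Q t i)) (⨆ i ∈ H', (P t).sigmaAlg (Q t i)) (μ t)
        (mixCoeff (2 * κ) C αhat s) := by
  classical
  obtain ⟨hα, -, ψ, hψ0, ⟨C, hC⟩, hmix⟩ := hMix
  refine ⟨C, (hψ0 0 0).trans (hC 0 0), fun t H H' s hs hd => ?_⟩
  unfold mixCoeff
  split_ifs with hlt
  · exact mixingLE_one _ _ _
  · have hs' : 0 ≤ s - 2 * κ := by linarith
    have hle : ∀ H : Finset (Fin (N t)),
        ⨆ i ∈ H, (P t).sigmaAlg (Q t i) ≤ (P t).sigmaAlg (H.biUnion (Q t)) := fun H =>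
      iSup₂_le fun i hi => iSup₂_le fun j hj =>
        le_iSup₂_of_le j (Finset.mem_biUnion.2 ⟨i, hi, hj⟩) le_rfl
    -- enlarging both sets by `κ` reduces their distance by at most `2κ`
    have hd' : ∀ a ∈ H.biUnion (Q t), ∀ b ∈ H'.biUnion (Q t),
        (⌈s - 2 * κ⌉₊ : ℕ∞) ≤ (P t).G.edist a b := by
      intro a ha b hb
      obtain ⟨i, hi, hai⟩ := Finset.mem_biUnion.1 ha
      obtain ⟨j, hj, hbj⟩ := Finset.mem_biUnion.1 hb
      have h1 : (⌈s⌉₊ : ℕ∞) ≤ (P t).G.edist a b + ((2 * κ : ℕ) : ℕ∞) := by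
        calc (⌈s⌉₊ : ℕ∞) ≤ (P t).G.edist i j := hd i hi j hj
          _ ≤ (P t).G.edist i a + ((P t).G.edist a b + (P t).G.edist b j) :=
            (SimpleGraph.edist_triangle).trans (add_le_add le_rfl SimpleGraph.edist_triangle)
          _ ≤ κ + ((P t).G.edist a b + κ) := by
            gcongr
            · exact hQ t i a hai
            · rw [SimpleGraph.edist_comm]; exact hQ t j b hbj
          _ = _ := by push_cast; ring
      have h2 : ⌈s⌉₊ = ⌈s - 2 * κ⌉₊ + 2 * κ := by
        rw [← Nat.ceil_add_natCast hs']
        congr 1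
        push_cast; ring
      rw [h2, Nat.cast_add] at h1
      exact (ENat.add_le_add_iff_right (ENat.natCast_ne_top _)).1 h1
    intro A B hA hB
    refine le_min (mixingLE_one _ _ _ A B hA hB) ?_
    refine (abs_le_alphaCoeff (hle H A hA) (hle H' B hB)).trans ?_
    refine (hmix _ _ _ hs' t _ _ le_rfl le_rfl hd').trans ?_
    exact mul_le_mul_of_nonneg_right (hC _ _) (hα _ hs')

lemma tendsto_mixCoeff {αhat : ℝ → ℝ} (hα : ∀ s, 0 ≤ s → 0 ≤ αhat s)
    (hα0 : Tendsto αhat atTop (𝓝 0)) {R C : ℝ} (hC : 0 ≤ C) :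
    Tendsto (fun s : ℕ => mixCoeff R C αhat s) atTop (𝓝 0) := by
  have hlim : Tendsto (fun s : ℕ => C * αhat ((s : ℝ) - R)) atTop (𝓝 0) := by
    have h1 : Tendsto (fun s : ℕ => (s : ℝ) - R) atTop atTop :=
      tendsto_atTop_add_const_right _ _ tendsto_natCast_atTop_atTop
    simpa using (hα0.comp h1).const_mul C
  have hev : ∀ᶠ s : ℕ in atTop, R ≤ (s : ℝ) := tendsto_natCast_atTop_atTop.eventually_ge_atTop R
  refine squeeze_zero' ?_ ?_ hlim
  · filter_upwards [hev] with s hs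
    rw [mixCoeff, if_neg (not_lt.2 hs)]
    exact le_min zero_le_one (mul_nonneg hC (hα _ (by linarith)))
  · filter_upwards [hev] with s hs
    rw [mixCoeff, if_neg (not_lt.2 hs)]
    exact min_le_right _ _

/-- Truncation to `[-M, M]`. -/
def truncate (M x : ℝ) : ℝ := max (-M) (min M x)

lemma measurable_truncate (M : ℝ) : Measurable (truncate M) := by
  unfold truncate; fun_prop

lemma abs_truncate_le {M : ℝ} (hM : 0 ≤ M) (x : ℝ) : |truncate M x| ≤ M :=
  abs_le.2 ⟨le_max_left _ _, max_le (by linarith) (min_le_left _ _)⟩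

lemma truncate_eq {M x : ℝ} (hx : |x| ≤ M) : truncate M x = x := by
  rw [truncate, min_eq_right (abs_le.1 hx).2, max_eq_right (abs_le.1 hx).1]

/-- No unit is isolated, since its nearest neighbours are at finite distance. -/
lemma NetworkDID.exists_adj {n K : ℕ} {Ω 𝓔 : Type*} [MeasurableSpace Ω] [MeasurableSpace 𝓔]
    {P : NetworkDID L n Ω 𝓔} (hL : 1 ≤ L) (hLoc : P.Locality K) (i : Fin n) :
    ∃ j, P.G.Adj i j := by
  have hr : P.G.Reachable i (P.nbr i ⟨0, hL⟩) := SimpleGraph.reachable_of_edist_ne_top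
    (ne_top_of_le_ne_top (ENat.natCast_ne_top _) (hLoc i ⟨0, hL⟩))
  obtain ⟨p⟩ := hr
  have hne := P.nbr_ne i ⟨0, hL⟩
  generalize P.nbr i ⟨0, hL⟩ = j at p hne
  cases p with
  | nil => exact absurd rfl hne
  | cons h _ => exact ⟨_, h⟩

/-- Asymptotic normality of averages of scores `φ i` that depend on the fundamental variables of the
units in `Q i`, all within distance `κ` of `i`, and of the averages of estimated scores `φ' i` that
are either equal to the true ones or Lipschitz in estimation errors that vanish fast. -/
theorem tendstoInDistribution_average_of_local (hL : 1 ≤ L) (hN : Tendsto N atTop atTop) {K d : ℕ}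
    (hLoc : ∀ t, (P t).Locality K) (hDim : DimensionAtMost (fun t => (P t).G) d)
    {αhat : ℝ → ℝ} (hMix : AlphaMixing P μ αhat) {κ : ℕ} (hκ : 1 ≤ κ)
    {Q : ∀ t, Fin (N t) → Finset (Fin (N t))}
    (hQ : ∀ t i, ∀ j ∈ Q t i, (P t).G.edist i j ≤ (κ : ℕ∞))
    {φ φ' : ∀ t, Fin (N t) → Ω t → ℝ} (hφ : ∀ t i, Measurable[(P t).sigmaAlg (Q t i)] (φ t i))
    {M : ℝ} (hM : 0 < M) (hφM : ∀ t i, ∀ᵐ ω ∂(μ t), |φ t i ω| ≤ M)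
    (hφ' : ∀ t i, Measurable (φ' t i)) {τ : ℕ → ℝ}
    (hτ : ∀ t, (1 / (N t : ℝ)) * ∑ i, ∫ ω, φ t i ω ∂(μ t) = τ t) {R : ℝ} (hR : R = 2 * κ)
    (hwd : WeakDependenceCLT (fun t => (P t).G) d (thetaCoeff R αhat)
      fun t => √(variance (fun ω => ∑ i, φ t i ω) (μ t)))
    (hest : (∀ t i, φ' t i =ᵐ[μ t] φ t i) ∨
      ∃ (err : ∀ t, Fin (N t) → Ω t → ℝ) (C δ : ℝ), 0 < C ∧ 0 < δ ∧
        FastRates μ err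
          (fun t => √(variance (fun ω => (√(N t : ℝ))⁻¹ * ∑ i, φ t i ω) (μ t))) ∧
        ∀ t i, ∀ᵐ ω ∂(μ t), err t i ω ≤ δ → |φ' t i ω - φ t i ω| ≤ C * err t i ω) :
    TendstoInDistribution
      (fun t ω => √(N t : ℝ) * ((1 / (N t : ℝ)) * ∑ i, φ' t i ω - τ t)
        / √(variance (fun ω => (√(N t : ℝ))⁻¹ * ∑ i, φ t i ω) (μ t)))
      atTop (id : ℝ → ℝ) μ (gaussianReal 0 1) := by
  obtain ⟨C₀, hC₀, hmix⟩ := hMix.exists_mixingLE hQ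
  obtain ⟨hα, hα0, -⟩ := hMix
  rw [← hR] at hmix
  have hκ' : (1 : ℝ) ≤ κ := by exact_mod_cast hκ
  set S : ℕ → ℝ := fun t => √(variance (fun ω => ∑ i, φ t i ω) (μ t)) with hS
  set X : ∀ t, Fin (N t) → Ω t → ℝ := fun t i ω =>
    truncate M (φ t i ω) - ∫ ω', truncate M (φ t i ω') ∂(μ t) with hX
  have htm : ∀ t i, Measurable[(P t).sigmaAlg (Q t i)] fun ω => truncate M (φ t i ω) := fun t i =>
    (measurable_truncate M).comp (hφ t i)
  have htm' : ∀ t i, Measurable fun ω => truncate M (φ t i ω) := fun t i =>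
    (htm t i).mono ((P t).sigmaAlg_le _) le_rfl
  have hφm : ∀ t i, Measurable (φ t i) := fun t i => (hφ t i).mono ((P t).sigmaAlg_le _) le_rfl
  have hφi : ∀ t i, Integrable (φ t i) (μ t) := fun t i =>
    Integrable.of_bound (hφm t i).aestronglyMeasurable M (hφM t i)
  have htb : ∀ t i ω, ‖truncate M (φ t i ω)‖ ≤ M := fun t i ω => abs_truncate_le hM.le _
  have hti : ∀ t i, Integrable (fun ω => truncate M (φ t i ω)) (μ t) := fun t i =>
    integrable_of_measurable_of_bound (htm' t i) M (htb t i)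
  have hae : ∀ t, ∀ᵐ ω ∂(μ t), ∀ i, truncate M (φ t i ω) = φ t i ω := fun t => by
    rw [ae_all_iff]
    intro i
    filter_upwards [hφM t i] with ω hω using truncate_eq hω
  have hXsum : ∀ t, ∀ᵐ ω ∂(μ t),
      ∑ i, X t i ω = ∑ i, φ t i ω - ∑ i, ∫ ω', φ t i ω' ∂(μ t) := fun t => by
    filter_upwards [hae t] with ω hω
    rw [← Finset.sum_sub_distrib]
    refine Finset.sum_congr rfl fun i _ => ?_
    simp only [hX]
    rw [hω i, integral_congr_ae (f := fun ω' => truncate M (φ t i ω')) (g := φ t i)]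
    filter_upwards [hae t] with ω' hω' using hω' i
  have hXwd : ∀ t, WeaklyDependent (μ t) (P t).G (fun i => (P t).sigmaAlg (Q t i)) (X t) (2 * M)
      fun s => mixCoeff R C₀ αhat s := fun t =>
    { le := fun i => (P t).sigmaAlg_le _
      measurable := fun i => (htm t i).sub_const _
      bound_pos := by positivity
      bound := fun i ω => by
        have h1 : ‖∫ ω', truncate M (φ t i ω') ∂(μ t)‖ ≤ M := by
          simpa using norm_integral_le_of_norm_le_const (ae_of_all (μ t) (htb t i))
        refine (abs_sub _ _).trans ?_
        have h2 := htb t i ω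
        rw [Real.norm_eq_abs] at h1 h2
        linarith
      integral_eq_zero := fun i => by
        simp only [hX]
        rw [integral_sub (hti t i) (integrable_const _)]
        simp
      mixing := fun H H' s h => hmix t H H' s (Nat.cast_nonneg s) (by simpa using h)
      tendsto := tendsto_mixCoeff hα hα0 hC₀ }
  have hfar : ∀ t r, 0 < r → ∀ i, MixingLE ((P t).sigmaAlg (Q t i))
      (⨆ j ∈ (netBall (P t).G i r)ᶜ, (P t).sigmaAlg (Q t j)) (μ t) (mixCoeff R C₀ αhat r) := by
    intro t r hr i
    refine (hmix t {i} (netBall (P t).G i r)ᶜ r hr.le ?_).mono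
      (le_iSup₂_of_le i (Finset.mem_singleton_self i) le_rfl) le_rfl
    intro a ha j hj
    rw [Finset.mem_singleton.1 ha]
    rw [Finset.mem_compl, mem_netBall, not_le] at hj
    calc (⌈r⌉₊ : ℕ∞) ≤ ((⌊r⌋₊ + 1 : ℕ) : ℕ∞) := by exact_mod_cast Nat.ceil_le_floor_add_one r
      _ ≤ (P t).G.edist i j := by
        rw [Nat.cast_add, Nat.cast_one]
        exact Order.add_one_le_of_lt hj
  have hφsum : ∀ t, ∫ ω, ∑ i, φ t i ω ∂(μ t) = ∑ i, ∫ ω, φ t i ω ∂(μ t) := fun t =>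
    integral_finsetSum _ fun i _ => hφi t i
  have hvar : ∀ t, ∫ ω, (∑ i, X t i ω) ^ 2 ∂(μ t) = S t ^ 2 := fun t => by
    rw [hS, Real.sq_sqrt (variance_nonneg _ _), variance_eq_integral
      (Finset.measurable_fun_sum _ fun i _ => hφm t i).aemeasurable, hφsum]
    refine integral_congr_ae ?_
    filter_upwards [hXsum t] with ω hω
    rw [hω]
  have hchar := fun u => tendsto_charFun_of_weaklyDependent hN hDim
    (fun t => (P t).exists_adj hL (hLoc t)) hα (by rw [hR]; linarith) hXwd hfar hvar hwd u
  have hσ : ∀ t, √(variance (fun ω => (√(N t : ℝ))⁻¹ * ∑ i, φ t i ω) (μ t)) = S t / √(N t : ℝ) := by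
    intro t
    rw [variance_const_mul, Real.sqrt_mul (sq_nonneg _), Real.sqrt_sq (by positivity), hS]
    ring
  simp_rw [hσ] at hest ⊢
  refine tendstoInDistribution_of_charFun (A := fun t ω => (∑ i, X t i ω) / S t)
    (fun t => ((hXwd t).measurable_sum.div_const _).aemeasurable)
    (fun t => (by
      have := hφ' t
      fun_prop : Measurable fun ω => √(N t : ℝ) * ((1 / (N t : ℝ)) * ∑ i, φ' t i ω - τ t)
        / (S t / √(N t : ℝ))).aemeasurable) hchar ?_
  intro η hη
  have hgood : ∀ᶠ t in atTop, 0 < S t ∧ 1 ≤ N t :=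
    hwd.1.and (hN.eventually_ge_atTop 1)
  -- the normalized estimator differs from the normalized sum only by the estimation error
  have hdiff : ∀ t, 0 < S t → 1 ≤ N t → ∀ᵐ ω ∂(μ t),
      √(N t : ℝ) * ((1 / (N t : ℝ)) * ∑ i, φ' t i ω - τ t) / (S t / √(N t : ℝ))
        - (∑ i, X t i ω) / S t = (∑ i, (φ' t i ω - φ t i ω)) / S t := by
    intro t hSt hNt
    filter_upwards [hXsum t] with ω hω
    have hn : (0 : ℝ) < N t := by exact_mod_cast hNt
    have hsq : √(N t : ℝ) * √(N t : ℝ) = N t := Real.mul_self_sqrt hn.le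
    rw [hω, ← hτ t, Finset.sum_sub_distrib, div_div_eq_mul_div, ← sub_div]
    congr 1
    calc √(N t : ℝ) * ((1 / (N t : ℝ)) * ∑ i, φ' t i ω
          - (1 / (N t : ℝ)) * ∑ i, ∫ ω, φ t i ω ∂(μ t)) * √(N t : ℝ)
          - (∑ i, φ t i ω - ∑ i, ∫ ω', φ t i ω' ∂(μ t))
        = (√(N t : ℝ) * √(N t : ℝ)) * (1 / (N t : ℝ)) * (∑ i, φ' t i ω
          - ∑ i, ∫ ω, φ t i ω ∂(μ t)) - (∑ i, φ t i ω - ∑ i, ∫ ω', φ t i ω' ∂(μ t)) := by ring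
      _ = _ := by
        rw [hsq, mul_one_div_cancel hn.ne']; ring
  rcases hest with hest | ⟨err, C, δ, hC, hδ, ⟨hr1, hr2⟩, herr⟩
  · refine tendsto_const_nhds.congr' ?_
    filter_upwards [hgood] with t ht
    symm
    rw [measureReal_def, ENNReal.toReal_eq_zero_iff]
    left
    have h1 : ∀ᵐ ω ∂(μ t), ∀ i, φ' t i ω = φ t i ω := ae_all_iff.2 (hest t)
    have h2 : ∀ᵐ ω ∂(μ t), ¬ η < |√(N t : ℝ) * ((1 / (N t : ℝ)) * ∑ i, φ' t i ω - τ t)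
        / (S t / √(N t : ℝ)) - (∑ i, X t i ω) / S t| := by
      filter_upwards [hdiff t ht.1 ht.2, h1] with ω ha hb
      rw [ha]
      simp [hb, hη.le]
    simpa [ae_iff] using h2
  · have hsum := (hr1 δ hδ).add (hr2 (η / C) (by positivity))
    rw [add_zero] at hsum
    refine squeeze_zero' (Eventually.of_forall fun t => measureReal_nonneg) ?_ hsum
    filter_upwards [hgood] with t ht
    obtain ⟨hSt, hNt⟩ := ht
    have hn : (0 : ℝ) < N t := by exact_mod_cast hNt
    have hsq : √(N t : ℝ) * √(N t : ℝ) = N t := Real.mul_self_sqrt hn.le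
    have hsn : 0 < √(N t : ℝ) := Real.sqrt_pos.2 hn
    refine le_trans ?_ (measureReal_union_le _ _)
    have hsub : {ω | η < |√(N t : ℝ) * ((1 / (N t : ℝ)) * ∑ i, φ' t i ω - τ t)
        / (S t / √(N t : ℝ)) - (∑ i, X t i ω) / S t|} ≤ᵐ[μ t]
        ({ω | ∃ i, δ < err t i ω} ∪ {ω | η / C * (S t / √(N t : ℝ) / √(N t : ℝ))
          < (1 / (N t : ℝ)) * ∑ i, err t i ω} : Set (Ω t)) := by
      filter_upwards [hdiff t hSt hNt, ae_all_iff.2 (herr t)] with ω ha hb hω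
      by_contra hcon
      have hcon1 : ∀ i, err t i ω ≤ δ := fun i => by
        by_contra hi
        exact hcon (Or.inl ⟨i, not_le.1 hi⟩)
      have hcon2 : (1 / (N t : ℝ)) * ∑ i, err t i ω ≤ η / C * (S t / √(N t : ℝ) / √(N t : ℝ)) := by
        by_contra hi
        exact hcon (Or.inr (not_le.1 hi))
      have hω' : η < |(∑ i, (φ' t i ω - φ t i ω)) / S t| := by
        rw [← ha]; exact hω
      have hbd : |∑ i, (φ' t i ω - φ t i ω)| ≤ C * ∑ i, err t i ω := by
        rw [Finset.mul_sum]
        exact (Finset.abs_sum_le_sum_abs _ _).trans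
          (Finset.sum_le_sum fun i _ => hb i (hcon1 i))
      rw [abs_div, abs_of_pos hSt, lt_div_iff₀ hSt] at hω'
      rw [div_div (S t), hsq, one_div, inv_mul_le_iff₀ hn] at hcon2
      have h3 : (N t : ℝ) * (η / C * (S t / N t)) = η * S t / C := by field_simp
      rw [h3, le_div_iff₀ hC] at hcon2
      linarith
    rw [measureReal_def, measureReal_def]
    exact ENNReal.toReal_mono (measure_ne_top _ _) (measure_mono_ae hsub)

end Array

/-! ### Measurability and locality of the scores -/

lemma Measurable.drScore {Ω : Type*} {m : MeasurableSpace Ω} {d p e m₁ m₀ y : Ω → ℝ}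
    (hd : Measurable d) (hp : Measurable p) (he : Measurable e) (hm₁ : Measurable m₁)
    (hm₀ : Measurable m₀) (hy : Measurable y) :
    Measurable fun ω => drScore (d ω) (p ω) (e ω) (m₁ ω) (m₀ ω) (y ω) := by
  unfold _root_.drScore
  fun_prop

lemma measurable_select {Ω T : Type*} {m : MeasurableSpace Ω} [MeasurableSpace T] [Countable T]
    [MeasurableSingletonClass T] {V : Ω → T} (hV : Measurable V) {f : T → Ω → ℝ}
    (hf : ∀ v, Measurable (f v)) : Measurable fun ω => f (V ω) ω :=
  (measurable_from_prod_countable_left (f := fun q : Ω × T => f q.2 q.1) hf).comp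
    (measurable_id.prodMk hV)

lemma ae_measure_fiber_ne_zero {Ω T : Type*} [MeasurableSpace Ω] {μ : Measure Ω} [Countable T]
    (V : Ω → T) : ∀ᵐ ω ∂μ, μ {ω' | V ω' = V ω} ≠ 0 := by
  have : ∀ v, ∀ᵐ ω ∂μ, μ {ω' | V ω' = v} = 0 → V ω ≠ v := by
    intro v
    by_cases h0 : μ {ω' | V ω' = v} = 0
    · have h1 : ∀ᵐ ω ∂μ, V ω ≠ v := by simpa [ae_iff] using h0
      filter_upwards [h1] with ω hω _ using hω
    · exact ae_of_all _ fun ω h => absurd h h0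
  filter_upwards [ae_all_iff.2 this] with ω hω h0
  exact hω _ h0 rfl

namespace NetworkDID

section Local

variable {L n : ℕ} {Ω 𝓔 : Type*} {m m0 : MeasurableSpace Ω} [MeasurableSpace 𝓔]
  {P : NetworkDID L n Ω 𝓔}

/-- The units whose fundamental variables enter the treatment of `i` and the outcome of `j`. -/
def scoreSet (P : NetworkDID L n Ω 𝓔) (i j : Fin n) : Finset (Fin n) :=
  insert i (insert j (Finset.univ.image (P.nbr j)))

lemma edist_le_of_mem_scoreSet {K c : ℕ} (hLoc : P.Locality K) {i j a : Fin n}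
    (hij : P.G.edist i j ≤ (c : ℕ∞)) (ha : a ∈ P.scoreSet i j) :
    P.G.edist i a ≤ ((c + K : ℕ) : ℕ∞) := by
  rw [Nat.cast_add]
  simp only [scoreSet, Finset.mem_insert, Finset.mem_image, Finset.mem_univ, true_and] at ha
  rcases ha with rfl | rfl | ⟨k, rfl⟩
  · simp
  · exact hij.trans le_self_add
  · exact SimpleGraph.edist_triangle.trans (add_le_add hij (hLoc j k))

lemma measurable_D_of_x {j : Fin n} (hx : Measurable[m] (P.x j)) : Measurable[m] (P.D j) :=
  (measurable_fst.comp measurable_snd).comp hx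

lemma measurable_Y1_of_x {j : Fin n} (hx : Measurable[m] (P.x j)) : Measurable[m] (P.Y1 j) :=
  measurable_fst.comp hx

lemma measurable_ε_of_x {j : Fin n} (hx : Measurable[m] (P.x j)) : Measurable[m] (P.ε j) :=
  (measurable_snd.comp measurable_snd).comp hx

lemma measurable_treat_of_x {j : Fin n} (hx : Measurable[m] (P.x j)) : Measurable[m] (P.treat j) :=
  (measurable_of_countable fun b : Bool => if b then (1 : ℝ) else 0).comp (measurable_D_of_x hx)

lemma measurable_DN_of_x {i j : Fin n} (hx : ∀ a ∈ P.scoreSet i j, Measurable[m] (P.x a)) :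
    Measurable[m] (P.DN j) :=
  @measurable_pi_lambda _ _ _ m _ _ fun k => measurable_D_of_x (hx _ (by simp [scoreSet]))

lemma measurable_DNminus_of_x {i j : Fin n} (hx : ∀ a ∈ P.scoreSet i j, Measurable[m] (P.x a)) :
    Measurable[m] (P.DNminus i j) :=
  @measurable_pi_lambda _ _ _ m _ _ fun k => measurable_D_of_x (hx _ (by simp [scoreSet]))

lemma measurable_dY_of_x {i j : Fin n} (hx : ∀ a ∈ P.scoreSet i j, Measurable[m] (P.x a)) :
    Measurable[m] (P.dY j) := by
  have hj := hx j (by simp [scoreSet])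
  refine Measurable.sub ?_ (measurable_Y1_of_x hj)
  exact measurable_select (V := fun ω => (P.D j ω, P.DN j ω))
    (f := fun q ω => P.out j (P.Y1 j ω) q.1 q.2 (P.ε j ω))
    ((measurable_D_of_x hj).prodMk (measurable_DN_of_x hx)) fun q =>
      (P.measurable_out j q.1 q.2).comp ((measurable_Y1_of_x hj).prodMk (measurable_ε_of_x hj))

lemma measurable_phiDir {i : Fin n} (hx : ∀ a ∈ P.scoreSet i i, Measurable[m] (P.x a))
    {η : Ω → DirNuisance L n} (hpi : Measurable[m] fun ω => (η ω).pi i)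
    (he : ∀ v, Measurable[m] fun ω => (η ω).e i v)
    (hm : ∀ a v, Measurable[m] fun ω => (η ω).m i a v) :
    Measurable[m] fun ω => P.phiDir (η ω) i ω := by
  have hV := measurable_DN_of_x hx
  exact Measurable.drScore (measurable_treat_of_x (hx i (by simp [scoreSet]))) hpi
    (measurable_select (f := fun v ω => (η ω).e i v) hV he)
    (measurable_select (f := fun v ω => (η ω).m i true v) hV (hm true))
    (measurable_select (f := fun v ω => (η ω).m i false v) hV (hm false)) (measurable_dY_of_x hx)

lemma measurable_phiPair {i j : Fin n} (hx : ∀ a ∈ P.scoreSet i j, Measurable[m] (P.x a))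
    {η : Ω → P.IndNuisance} (hpi : Measurable[m] fun ω => (η ω).pi i)
    (he : ∀ b v, Measurable[m] fun ω => (η ω).e i j b v)
    (hm : ∀ a b v, Measurable[m] fun ω => (η ω).m i j a b v) :
    Measurable[m] fun ω => P.phiPair (η ω) i j ω := by
  have hV := (measurable_D_of_x (hx j (by simp [scoreSet]))).prodMk (measurable_DNminus_of_x hx)
  exact Measurable.drScore (measurable_treat_of_x (hx i (by simp [scoreSet]))) hpi
    (measurable_select (f := fun q ω => (η ω).e i j q.1 q.2) hV fun q => he q.1 q.2)
    (measurable_select (f := fun q ω => (η ω).m i j true q.1 q.2) hV fun q => hm true q.1 q.2)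
    (measurable_select (f := fun q ω => (η ω).m i j false q.1 q.2) hV fun q => hm false q.1 q.2)
    (measurable_dY_of_x hx)

lemma measurable_x_sigmaAlg {H : Finset (Fin n)} {a : Fin n} (ha : a ∈ H) :
    Measurable[P.sigmaAlg H] (P.x a) :=
  measurable_iff_comap_le.2 (le_iSup₂_of_le a ha le_rfl)

end Local

/-! ### Bounds for the scores and identification of the estimands -/

section Moments

variable {L n : ℕ} {Ω 𝓔 : Type*} [MeasurableSpace Ω] [MeasurableSpace 𝓔]
  {P : NetworkDID L n Ω 𝓔} {μ : Measure Ω} {lo hi Y : ℝ}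

lemma treat_eq (i : Fin n) (ω : Ω) : P.treat i ω = 0 ∨ P.treat i ω = 1 := by
  unfold treat; split_ifs <;> simp

lemma ae_abs_dY_le (hY : P.BoundedOutcomes μ Y) (i : Fin n) :
    ∀ᵐ ω ∂μ, |P.dY i ω| ≤ 2 * |Y| := by
  filter_upwards [hY i] with ω hω
  have h1 := hω.1.le.trans (le_abs_self Y)
  have h2 := hω.2.le.trans (le_abs_self Y)
  exact (abs_sub _ _).trans (by linarith)

lemma measurable_dY (i : Fin n) : Measurable (P.dY i) :=
  measurable_dY_of_x (i := i) fun a _ => P.measurable_x a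

variable [IsProbabilityMeasure μ]

lemma integrable_dY (hY : P.BoundedOutcomes μ Y) (i : Fin n) : Integrable (P.dY i) μ :=
  Integrable.of_bound (measurable_dY i).aestronglyMeasurable _ (ae_abs_dY_le hY i)

lemma integrable_Y1 (hY : P.BoundedOutcomes μ Y) (i : Fin n) : Integrable (P.Y1 i) μ :=
  Integrable.of_bound (P.measurable_Y1 i).aestronglyMeasurable Y
    ((hY i).mono fun _ h => h.1.le)

lemma ae_dir_facts (hO : P.Overlap μ lo hi) (hY : P.BoundedOutcomes μ Y) (i : Fin n) :
    ∀ᵐ ω ∂μ, (P.dirTruth μ).e i (P.DN i ω) ∈ Set.Icc lo hi ∧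
      (∀ a, |(P.dirTruth μ).m i a (P.DN i ω)| ≤ 2 * |Y|) ∧ |P.dY i ω| ≤ 2 * |Y| := by
  filter_upwards [ae_measure_fiber_ne_zero (μ := μ) (P.DN i), ae_abs_dY_le hY i] with ω h1 h2
  exact ⟨hO.2.1 i _ h1, fun a => abs_integral_cond_le (by positivity) (ae_abs_dY_le hY i) _, h2⟩

lemma ae_pair_facts (hO : P.Overlap μ lo hi) (hY : P.BoundedOutcomes μ Y) {i j : Fin n}
    (hij : ∃ k, P.nbr i k = j) :
    ∀ᵐ ω ∂μ, (P.indTruth μ).e i j (P.D j ω) (P.DNminus i j ω) ∈ Set.Icc lo hi ∧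
      (∀ a, |(P.indTruth μ).m i j a (P.D j ω) (P.DNminus i j ω)| ≤ 2 * |Y|) ∧
      |P.dY j ω| ≤ 2 * |Y| := by
  filter_upwards [ae_measure_fiber_ne_zero (μ := μ) (fun ω => (P.D j ω, P.DNminus i j ω)),
    ae_abs_dY_le hY j] with ω h1 h2
  refine ⟨hO.2.2 i j hij _ _ ?_,
    fun a => abs_integral_cond_le (by positivity) (ae_abs_dY_le hY j) _, h2⟩
  simpa only [Prod.mk.injEq] using h1

lemma ae_abs_phiDir_le (hlo : 0 < lo) (hhi : hi < 1) (hO : P.Overlap μ lo hi)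
    (hY : P.BoundedOutcomes μ Y) (i : Fin n) :
    ∀ᵐ ω ∂μ, |P.phiDir (P.dirTruth μ) i ω| ≤ 4 * (2 * |Y|) * lo⁻¹ * (1 - hi)⁻¹ := by
  filter_upwards [ae_dir_facts hO hY i] with ω h
  exact abs_drScore_le hlo hhi (treat_eq i ω) (hO.1 i) h.1 (h.2.1 _) (h.2.1 _) h.2.2

lemma ae_abs_phiPair_le (hlo : 0 < lo) (hhi : hi < 1) (hO : P.Overlap μ lo hi)
    (hY : P.BoundedOutcomes μ Y) {i j : Fin n} (hij : ∃ k, P.nbr i k = j) :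
    ∀ᵐ ω ∂μ, |P.phiPair (P.indTruth μ) i j ω| ≤ 4 * (2 * |Y|) * lo⁻¹ * (1 - hi)⁻¹ := by
  filter_upwards [ae_pair_facts hO hY hij] with ω h
  exact abs_drScore_le hlo hhi (treat_eq i ω) (hO.1 i) h.1 (h.2.1 _) (h.2.1 _) h.2.2

lemma integrable_phiDir (hlo : 0 < lo) (hhi : hi < 1) (hO : P.Overlap μ lo hi)
    (hY : P.BoundedOutcomes μ Y) (i : Fin n) : Integrable (P.phiDir (P.dirTruth μ) i) μ :=
  Integrable.of_bound (measurable_phiDir (η := fun _ => P.dirTruth μ)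
    (fun a _ => P.measurable_x a) measurable_const (fun _ => measurable_const)
    fun _ _ => measurable_const).aestronglyMeasurable _ (ae_abs_phiDir_le hlo hhi hO hY i)

lemma integrable_phiPair (hlo : 0 < lo) (hhi : hi < 1) (hO : P.Overlap μ lo hi)
    (hY : P.BoundedOutcomes μ Y) {i j : Fin n} (hij : ∃ k, P.nbr i k = j) :
    Integrable (P.phiPair (P.indTruth μ) i j) μ :=
  Integrable.of_bound (measurable_phiPair (η := fun _ => P.indTruth μ)
    (fun a _ => P.measurable_x a) measurable_const (fun _ _ => measurable_const)
    fun _ _ _ => measurable_const).aestronglyMeasurable _ (ae_abs_phiPair_le hlo hhi hO hY hij)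

/-- The influence function of the direct effect has the effect as its mean. -/
lemma integral_phiDir (hlo : 0 < lo) (hhi : hi < 1) (hO : P.Overlap μ lo hi)
    (hY : P.BoundedOutcomes μ Y) (hInt : P.IntegrableOutcomes μ) (hT : P.ParallelTrends μ)
    (i : Fin n) :
    ∫ ω, P.phiDir (P.dirTruth μ) i ω ∂μ
      = ∫ ω, (P.y2 i true (P.DN i ω) ω - P.y2 i false (P.DN i ω) ω)
        ∂(ProbabilityTheory.cond μ {ω | P.D i ω = true}) := by
  have hx : ∀ a ∈ P.scoreSet i i, Measurable (P.x a) := fun a _ => P.measurable_x a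
  refine (integral_drScore (μ := μ) (P.measurable_D i) (V := P.DN i) (measurable_DN_of_x hx)
    (Y := P.dY i) (integrable_dY hY i) (U := fun v ω => P.y2 i false v ω - P.Y1 i ω)
    (fun v => (hInt i false v).sub (integrable_Y1 hY i)) (p := (P.dirTruth μ).pi i) rfl
    (e := (P.dirTruth μ).e i) (fun v => rfl) (fun v hv => ?_) (m := (P.dirTruth μ).m i)
    (fun a v => rfl) (fun ω hω => ?_) (fun v hv => hT.1 i v hv)
    (integrable_phiDir hlo hhi hO hY i)).trans ?_
  · obtain ⟨h1, h2⟩ := hO.2.1 i v hv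
    exact ⟨by linarith, by linarith⟩
  · simp only [dY, Y2, hω]
  · refine integral_congr_ae (ae_cond_of_forall_mem (P.measurable_D i (measurableSet_singleton true))
      fun ω hω => ?_)
    have hω' : P.D i ω = true := hω
    simp only [dY, Y2, hω']
    ring

lemma fill_DNminus (i j : Fin n) (ω : Ω) : P.fill i j (P.D i ω) (P.DNminus i j ω) = P.DN j ω := by
  funext k
  by_cases h : P.nbr j k = i
  · simp [fill, DN, h]
  · simp [fill, DN, DNminus, h]

/-- The influence function of the indirect effect of `i` on `j` has the effect as its mean. -/
lemma integral_phiPair (hlo : 0 < lo) (hhi : hi < 1) (hO : P.Overlap μ lo hi)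
    (hY : P.BoundedOutcomes μ Y) (hInt : P.IntegrableOutcomes μ) (hT : P.ParallelTrends μ)
    {i j : Fin n} (hij : ∃ k, P.nbr i k = j) :
    ∫ ω, P.phiPair (P.indTruth μ) i j ω ∂μ
      = ∫ ω, (P.y2 j (P.D j ω) (P.fill i j true (P.DNminus i j ω)) ω
        - P.y2 j (P.D j ω) (P.fill i j false (P.DNminus i j ω)) ω)
        ∂(ProbabilityTheory.cond μ {ω | P.D i ω = true}) := by
  have hx : ∀ a ∈ P.scoreSet i j, Measurable (P.x a) := fun a _ => P.measurable_x a
  have hset : ∀ q : Bool × P.Others i j, {ω | (P.D j ω, P.DNminus i j ω) = q}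
      = {ω | P.D j ω = q.1 ∧ P.DNminus i j ω = q.2} := fun q => by
    ext ω; simp [Prod.ext_iff]
  have hset' : ∀ (c : Bool) (q : Bool × P.Others i j),
      {ω | P.D i ω = c ∧ (P.D j ω, P.DNminus i j ω) = q}
      = {ω | P.D i ω = c ∧ P.D j ω = q.1 ∧ P.DNminus i j ω = q.2} := fun c q => by
    ext ω; simp [Prod.ext_iff]
  refine (integral_drScore (μ := μ) (P.measurable_D i) (V := fun ω => (P.D j ω, P.DNminus i j ω))
    ((P.measurable_D j).prodMk (measurable_DNminus_of_x hx))
    (Y := P.dY j) (integrable_dY hY j)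
    (U := fun q ω => P.y2 j q.1 (P.fill i j false q.2) ω - P.Y1 j ω)
    (fun q => (hInt j _ _).sub (integrable_Y1 hY j)) (p := (P.indTruth μ).pi i) rfl
    (e := fun q => (P.indTruth μ).e i j q.1 q.2) (fun q => by rw [hset]; rfl) (fun q hq => ?_)
    (m := fun a q => (P.indTruth μ).m i j a q.1 q.2)
    (fun a q => by rw [hset']; rfl) (fun ω hω => ?_) (fun q hq => ?_)
    (integrable_phiPair hlo hhi hO hY hij)).trans ?_
  · rw [hset] at hq
    obtain ⟨h1, h2⟩ := hO.2.2 i j hij _ _ hq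
    exact ⟨by linarith, by linarith⟩
  · have := fill_DNminus (P := P) i j ω
    rw [hω] at this
    simp only [dY, Y2, this]
  · simp only [hset'] at hq ⊢
    exact hT.2 i j hij q.1 q.2 hq
  · refine integral_congr_ae (ae_cond_of_forall_mem (P.measurable_D i (measurableSet_singleton true))
      fun ω hω => ?_)
    have := fill_DNminus (P := P) i j ω
    rw [show P.D i ω = true from hω] at this
    simp only [dY, Y2, this]
    ring

end Moments

end NetworkDID

/-! ### Asymptotic normality of the doubly robust estimators -/

namespace NetworkDID

section Errors

variable {L n : ℕ} {Ω 𝓔 : Type*} [MeasurableSpace Ω] [MeasurableSpace 𝓔]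
  {P : NetworkDID L n Ω 𝓔} {μ : Measure Ω}

lemma errPair_nonneg (η : Ω → P.IndNuisance) (i j : Fin n) (ω : Ω) : 0 ≤ P.errPair μ η i j ω := by
  unfold errPair; positivity

/-- The average error over the neighbours being at most `δ / L`, each of the errors is at most
`δ`. -/
lemma errPair_le_of_errInd_le (hL : 1 ≤ L) {η : Ω → P.IndNuisance} {i : Fin n} {ω : Ω} {δ : ℝ}
    (h : P.errInd μ η i ω ≤ δ / L) (k : Fin L) : P.errPair μ η i (P.nbr i k) ω ≤ δ := by
  have hL0 : (0 : ℝ) < L := by exact_mod_cast hL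
  have h1 : P.errPair μ η i (P.nbr i k) ω ≤ ∑ k, P.errPair μ η i (P.nbr i k) ω :=
    Finset.single_le_sum (f := fun k => P.errPair μ η i (P.nbr i k) ω)
      (fun k _ => errPair_nonneg η i _ ω) (Finset.mem_univ k)
  rw [errInd, one_div, inv_mul_le_iff₀ hL0, mul_div_cancel₀ _ hL0.ne'] at h
  exact h1.trans h

end Errors

end NetworkDID

end

theorem theorem7 {L K d : ℕ} (hL : 1 ≤ L) (hd : 1 ≤ d)
    -- population sizes tending to infinity, probability spaces, and populations
    {N : ℕ → ℕ} (hN : Tendsto N atTop atTop)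
    {Ω 𝓔 : ℕ → Type*} [∀ t, MeasurableSpace (Ω t)] [∀ t, MeasurableSpace (𝓔 t)]
    (μ : ∀ t, Measure (Ω t)) [∀ t, IsProbabilityMeasure (μ t)]
    (P : ∀ t, NetworkDID L (N t) (Ω t) (𝓔 t))
    -- standing conditions
    (hInt : ∀ t, (P t).IntegrableOutcomes (μ t))
    (hLoc : ∀ t, (P t).Locality K)
    (hDim : DimensionAtMost (fun t => (P t).G) d)
    -- parallel trends, local interference, overlap, bounded outcomes, mixing
    (hTrend : ∀ t, (P t).ParallelTrends (μ t))
    (hInterf : ∀ t, (P t).LocalInterference (μ t) K)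
    (hOverlap : ∃ lo hi : ℝ, 0 < lo ∧ hi < 1 ∧ ∀ t, (P t).Overlap (μ t) lo hi)
    (hBdd : ∃ Y : ℝ, ∀ t, (P t).BoundedOutcomes (μ t) Y)
    {αhat : ℝ → ℝ} (hMix : AlphaMixing P μ αhat)
    -- nuisance estimates
    (ηD : ∀ t, Ω t → DirNuisance L (N t)) (hηD : ∀ t, NetworkDID.MeasurableDirEst (ηD t))
    (ηI : ∀ t, Ω t → (P t).IndNuisance) (hηI : ∀ t, (P t).MeasurableIndEst (ηI t)) :
    -- direct effect
    (WeakDependenceCLT (fun t => (P t).G) d (thetaCoeff (2 * K) αhat)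
        (fun t => (P t).sumSdDir (μ t)) →
      ((∀ t, (P t).CorrectDir (μ t) (ηD t)) ∨
        FastRates μ (fun t => (P t).errDir (μ t) (ηD t)) (fun t => (P t).sigmaDir (μ t))) →
      TendstoInDistribution
        (fun t ω => √(N t : ℝ) * ((P t).tauHatDir (ηD t) ω - (P t).tauDir (μ t))
          / (P t).sigmaDir (μ t))
        atTop (id : ℝ → ℝ) μ (gaussianReal 0 1)) ∧
    -- indirect effect
    (WeakDependenceCLT (fun t => (P t).G) d (thetaCoeff (4 * K) αhat)
        (fun t => (P t).sumSdInd (μ t)) →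
      ((∀ t, (P t).CorrectInd (μ t) (ηI t)) ∨
        FastRates μ (fun t => (P t).errInd (μ t) (ηI t)) (fun t => (P t).sigmaInd (μ t))) →
      TendstoInDistribution
        (fun t ω => √(N t : ℝ) * ((P t).tauHatInd (ηI t) ω - (P t).tauInd (μ t))
          / (P t).sigmaInd (μ t))
        atTop (id : ℝ → ℝ) μ (gaussianReal 0 1)) := by

  obtain ⟨lo, hi, hlo, hhi, hO⟩ := hOverlap
  obtain ⟨Y, hY⟩ := hBdd
  have hL0 : (0 : ℝ) < L := by exact_mod_cast hL
  -- some unit has a neighbour, at positive distance at most `K`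
  have hK : 1 ≤ K := by
    obtain ⟨t, ht⟩ := (hN.eventually_ge_atTop 1).exists
    by_contra hK0
    have h1 := hLoc t ⟨0, ht⟩ ⟨0, hL⟩
    rw [Nat.lt_one_iff.1 (not_le.1 hK0), Nat.cast_zero, nonpos_iff_eq_zero,
      SimpleGraph.edist_eq_zero_iff] at h1
    exact (P t).nbr_ne _ _ h1.symm
  set M : ℝ := 4 * (2 * |Y|) * lo⁻¹ * (1 - hi)⁻¹ with hM
  have hM0 : 0 ≤ M := mul_nonneg (by positivity) (inv_nonneg.2 (by linarith))
  obtain ⟨C, δ, hC, hδ, hLip⟩ := exists_abs_drScore_sub_le (B := 2 * |Y|) hlo hhi (by positivity)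
  constructor
  · intro hwd hest
    refine tendstoInDistribution_average_of_local (P := P) (κ := K)
      (Q := fun t i => (P t).scoreSet i i)
      (φ := fun t => (P t).phiDir ((P t).dirTruth (μ t)))
      (φ' := fun t i ω => (P t).phiDir (ηD t ω) i ω) hL hN hLoc hDim hMix hK ?_ ?_
      (M := M + 1) (by linarith) ?_ ?_ ?_ rfl hwd ?_
    · intro t i j hj
      simpa using NetworkDID.edist_le_of_mem_scoreSet (hLoc t) (c := 0) (by simp) hj
    · intro t i
      exact NetworkDID.measurable_phiDir (η := fun _ => (P t).dirTruth (μ t))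
        (fun a ha => NetworkDID.measurable_x_sigmaAlg ha) measurable_const
        (fun _ => measurable_const) fun _ _ => measurable_const
    · intro t i
      filter_upwards [NetworkDID.ae_abs_phiDir_le hlo hhi (hO t) (hY t) i] with ω hω
      exact hω.trans (by linarith)
    · intro t i
      exact NetworkDID.measurable_phiDir (fun a _ => (P t).measurable_x a) ((hηD t).1 i)
        ((hηD t).2.1 i) ((hηD t).2.2 i)
    · intro t
      rw [NetworkDID.tauDir]
      congr 1
      exact Finset.sum_congr rfl fun i _ =>
        NetworkDID.integral_phiDir hlo hhi (hO t) (hY t) (hInt t) (hTrend t) i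
    · rcases hest with hest | hest
      · left
        intro t i
        filter_upwards [hest t i] with ω hω
        obtain ⟨h1, h2, h3⟩ := hω
        simp only [NetworkDID.phiDir, h1, h2, h3]
      · refine Or.inr ⟨_, C, δ, hC, hδ, hest, fun t i => ?_⟩
        filter_upwards [NetworkDID.ae_dir_facts (hO t) (hY t) i] with ω hω herr
        exact hLip _ _ _ _ _ _ _ _ _ _ (NetworkDID.treat_eq i ω) ((hO t).1 i) hω.1 (hω.2.1 _)
          (hω.2.1 _) hω.2.2 herr
  · intro hwd hest
    have hQ : ∀ t i, ∀ j ∈ Finset.univ.biUnion fun k => (P t).scoreSet i ((P t).nbr i k),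
        (P t).G.edist i j ≤ ((2 * K : ℕ) : ℕ∞) := by
      intro t i j hj
      obtain ⟨k, -, hk⟩ := Finset.mem_biUnion.1 hj
      have := NetworkDID.edist_le_of_mem_scoreSet (hLoc t) (hLoc t i k) hk
      rwa [two_mul]
    refine tendstoInDistribution_average_of_local (P := P) (κ := 2 * K)
      (Q := fun t i => Finset.univ.biUnion fun k => (P t).scoreSet i ((P t).nbr i k))
      (φ := fun t => (P t).phiInd ((P t).indTruth (μ t)))
      (φ' := fun t i ω => (P t).phiInd (ηI t ω) i ω) hL hN hLoc hDim hMix (by omega) hQ ?_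
      (M := M + 1) (by linarith) ?_ ?_ ?_ (by push_cast; ring) hwd ?_
    · intro t i
      refine Measurable.const_mul (Finset.measurable_fun_sum _ fun k _ => ?_) _
      exact NetworkDID.measurable_phiPair (i := i) (j := (P t).nbr i k)
        (η := fun _ => (P t).indTruth (μ t))
        (fun a ha => NetworkDID.measurable_x_sigmaAlg
          (Finset.mem_biUnion.2 ⟨k, Finset.mem_univ k, ha⟩))
        measurable_const (fun _ _ => measurable_const) fun _ _ _ => measurable_const
    · intro t i
      filter_upwards [ae_all_iff.2 fun k =>
        NetworkDID.ae_abs_phiPair_le hlo hhi (hO t) (hY t) (i := i) ⟨k, rfl⟩] with ω hω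
      rw [NetworkDID.phiInd, abs_mul, abs_of_pos (by positivity), one_div, inv_mul_le_iff₀ hL0]
      refine (Finset.abs_sum_le_sum_abs _ _).trans ((Finset.sum_le_sum fun k _ => hω k).trans ?_)
      simp only [Finset.sum_const, Finset.card_univ, Fintype.card_fin, nsmul_eq_mul]
      exact mul_le_mul_of_nonneg_left (by linarith) hL0.le
    · intro t i
      refine Measurable.const_mul (Finset.measurable_fun_sum _ fun k _ => ?_) _
      exact NetworkDID.measurable_phiPair (fun a _ => (P t).measurable_x a) ((hηI t).1 i)
        ((hηI t).2.1 i _) ((hηI t).2.2 i _)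
    · intro t
      rw [NetworkDID.tauInd]
      congr 1
      refine Finset.sum_congr rfl fun i _ => ?_
      simp only [NetworkDID.phiInd]
      rw [integral_const_mul, integral_finsetSum _ fun k _ =>
        NetworkDID.integrable_phiPair hlo hhi (hO t) (hY t) ⟨k, rfl⟩]
      congr 1
      exact Finset.sum_congr rfl fun k _ =>
        NetworkDID.integral_phiPair hlo hhi (hO t) (hY t) (hInt t) (hTrend t) ⟨k, rfl⟩
    · rcases hest with hest | hest
      · left
        intro t i
        filter_upwards [ae_all_iff.2 (hest t i)] with ω hω
        simp only [NetworkDID.phiInd]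
        congr 1
        refine Finset.sum_congr rfl fun k _ => ?_
        obtain ⟨h1, h2, h3⟩ := hω k
        simp only [NetworkDID.phiPair, h1, h2, h3]
      · refine Or.inr ⟨_, C, δ / L, hC, by positivity, hest, fun t i => ?_⟩
        filter_upwards [ae_all_iff.2 fun k =>
          NetworkDID.ae_pair_facts (hO t) (hY t) (i := i) ⟨k, rfl⟩] with ω hω herr
        have hk : ∀ k, |(P t).phiPair (ηI t ω) i ((P t).nbr i k) ω
            - (P t).phiPair ((P t).indTruth (μ t)) i ((P t).nbr i k) ω|
            ≤ C * (P t).errPair (μ t) (ηI t) i ((P t).nbr i k) ω := fun k =>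
          hLip _ _ _ _ _ _ _ _ _ _ (NetworkDID.treat_eq i ω) ((hO t).1 i) (hω k).1 ((hω k).2.1 _)
            ((hω k).2.1 _) (hω k).2.2 (NetworkDID.errPair_le_of_errInd_le hL herr k)
        simp only [NetworkDID.phiInd, NetworkDID.errInd]
        rw [← mul_sub, ← Finset.sum_sub_distrib, abs_mul, abs_of_pos (by positivity), mul_left_comm]
        refine mul_le_mul_of_nonneg_left ?_ (by positivity)
        rw [Finset.mul_sum]
        exact (Finset.abs_sum_le_sum_abs _ _).trans (Finset.sum_le_sum fun k _ => hk k)
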